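/- Let $p$ be an odd prime, let $\mathbb{C}_p$ be the completed algebraic closure of $\mathbb{Q}_p$ with its absolute value, and let $\pi\in\mathbb{C}_p$ satisfy $\pi^{p-1}=-p$. Write $\mathbb{C}_p^\dagger\langle z_1,\dots,z_N\rangle$ for the ring of overconvergent power series $\sum a_Iz^I$, i.e. those for which there are constants $c>0$ and $d$ with $\mathrm{ord}_p\,a_I\ge c|I|+d$ for all $I$. For a polynomial $P\in\mathbb{C}_p[z_1,\dots,z_n]$ defining a hypersurface $X=\{P=0\}\subset\mathbb{A}^n$, let $DW^\bullet(P)$ be the de Rham complex of the $D$-module $\mathbb{C}_p^\dagger\langle z_1,\dots,z_n,t\rangle e^{\pi Pt}$, that is, the complex $\mathbb{C}_p^\dagger\langle z,t\rangle[dz_1,\dots,dz_n,dt]$ with differential $\sum_u(\partial_u+\pi\,\partial_u(Pt))\,du$ (sum over the variables $u=z_1,\dots,z_n,t$), and put $H^i(X)=H^{i+2}(DW^\bullet(P))$ (Dwork cohomology, indexed in the standard convention). The Frobenius of $X$ is said to be defined if the power series $E_P=e^{\pi(P(z_1^p,\dots,z_n^p)t^p-P(z_1,\dots,z_n)t)}$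 is overconvergent; then $Fr_X$ on $H^i(X)$ is $p^{-1}$ times the map induced by $$g(z,t)\,du_1\cdots du_s\mapsto E_P\cdot g(z_1^p,\dots,z_n^p,t^p)\,d(u_1^p)\cdots d(u_s^p).$$ Let $P\in\mathbb{C}_p[z_1,\dots,z_n]$ be a polynomial with coefficients of absolute value at most $1$ that defines a smooth hypersurface $X\subset\mathbb{A}^n$ over $\mathbb{C}_p$, and let $\tilde X\subset\mathbb{A}^{n+2}$ be the hypersurface $P+xy=0$. 1. If every coefficient $a$ of $P$ satisfies $|a^p-a|<1$ (for instance if $P$ has coefficients in $\mathbb{Z}_p$), then the Frobenius of $X$ is defined. 2. There are $\mathbb{C}_p$-linear isomorphisms $\Phi_i\colon H^i(X)\to H^{i+2}(\tilde X)$ for all $i\ge1$. If the Frobenius of $X$ is defined, then so is the Frobenius of $\tilde X$, and $p\cdot Fr_X=Fr_{\tilde X}$ under these isomorphisms, i.e. $\Phi_i(p\cdot Fr_X(c))=Fr_{\tilde X}(\Phi_i(c))$ for all $i\ge1$ and $c\in H^i(X)$. -/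

import Mathlib

open CategoryTheory

noncomputable section

/-! ### The de Rham complex of a module with commuting derivations -/

section DeRham

universe u

variable {R : Type u} [CommRing R] {M : Type u} [AddCommGroup M] [Module R M]
variable {ι : Type}

/-- Forms of degree `k` in the odd variables `dz i` with coefficients in `M`: the family `ω`
stands for the sum over `s = {i₁ < ⋯ < iₖ}` of `ω s dz i₁ ⋯ dz iₖ`. -/
abbrev DRForm (ι : Type) (M : Type u) (k : ℕ) : Type u :=
  {s : Finset ι // s.card = k} → M

/-- Extension by zero of a form to all finite sets. -/
def drExt {k : ℕ} (ω : DRForm ι M k) (s : Finset ι) : M :=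
  if h : s.card = k then ω ⟨s, h⟩ else 0

lemma drExt_of_card {k : ℕ} (ω : DRForm ι M k) (s : {s : Finset ι // s.card = k}) :
    drExt ω s.1 = ω s := by
  simp [drExt, s.2]

variable [LinearOrder ι]

/-- The sign with `dz i * dz (s \ i) = drSign s i * dz s` for `i ∈ s`. -/
def drSign (s : Finset ι) (i : ι) : ℤ := (-1) ^ (s.filter (· < i)).card

lemma drSign_antisymm (s : Finset ι) {i j : ι} (hi : i ∈ s) (hj : j ∈ s) (hij : i ≠ j) :
    drSign s i * drSign (s.erase i) j = -(drSign s j * drSign (s.erase j) i) := by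
  wlog h : i < j generalizing i j
  · rw [this hj hi hij.symm (lt_of_le_of_ne (not_lt.mp h) hij.symm), neg_neg]
  have h1 : (s.erase j).filter (· < i) = s.filter (· < i) := by
    ext x
    simp only [Finset.mem_filter, Finset.mem_erase]
    constructor
    · rintro ⟨⟨_, h2⟩, h3⟩
      exact ⟨h2, h3⟩
    · rintro ⟨h2, h3⟩
      exact ⟨⟨(h3.trans h).ne, h2⟩, h3⟩
  have h2 : (s.erase i).filter (· < j) = (s.filter (· < j)).erase i := by
    ext x
    simp only [Finset.mem_filter, Finset.mem_erase]
    tauto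
  have hmem : i ∈ s.filter (· < j) := Finset.mem_filter.mpr ⟨hi, h⟩
  have h3 := Finset.card_erase_add_one hmem
  unfold drSign
  rw [h1, h2, ← h3, pow_succ]
  ring

/-- The de Rham differential `ω ↦ ∑ i, dz i * D i ω`. -/
def drD (D : ι → M →ₗ[R] M) (k : ℕ) : DRForm ι M k →ₗ[R] DRForm ι M (k + 1) where
  toFun ω s := ∑ i : {x // x ∈ s.1}, drSign s.1 i •
    D i (ω ⟨s.1.erase i, by rw [Finset.card_erase_of_mem i.2, s.2]; rfl⟩)
  map_add' ω η := by
    ext s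
    simp [Finset.sum_add_distrib]
  map_smul' c ω := by
    ext s
    simp [Finset.smul_sum, smul_comm c]

lemma drD_apply (D : ι → M →ₗ[R] M) (k : ℕ) (ω : DRForm ι M k)
    (s : {s : Finset ι // s.card = k + 1}) :
    drD D k ω s = ∑ i ∈ s.1, drSign s.1 i • D i (drExt ω (s.1.erase i)) := by
  rw [← Finset.sum_coe_sort s.1]
  refine Finset.sum_congr rfl fun i _ => ?_
  rw [← drExt_of_card ω]

lemma drD_comp_drD (D : ι → M →ₗ[R] M) (hD : ∀ i j, D i ∘ₗ D j = D j ∘ₗ D i) (k : ℕ) :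
    drD D (k + 1) ∘ₗ drD D k = 0 := by
  refine LinearMap.ext fun ω => funext fun s => ?_
  have key : drD D (k + 1) (drD D k ω) s =
      ∑ x ∈ s.1.sigma (fun i => s.1.erase i), (drSign s.1 x.1 * drSign (s.1.erase x.1) x.2) •
        D x.1 (D x.2 (drExt ω ((s.1.erase x.1).erase x.2))) := by
    rw [drD_apply, Finset.sum_sigma]
    refine Finset.sum_congr rfl fun i hi => ?_
    have hc : (s.1.erase i).card = k + 1 := by
      rw [Finset.card_erase_of_mem hi, s.2]; rfl
    have h1 := drExt_of_card (drD D k ω) ⟨s.1.erase i, hc⟩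
    rw [h1, drD_apply, map_sum, Finset.smul_sum]
    refine Finset.sum_congr rfl fun j _ => ?_
    rw [map_zsmul, smul_smul]
  rw [LinearMap.comp_apply, key]
  refine Finset.sum_involution (fun x _ => ⟨x.2, x.1⟩) ?_ ?_ ?_ ?_
  · rintro ⟨i, j⟩ h
    simp only [Finset.mem_sigma, Finset.mem_erase] at h
    obtain ⟨hi, hji, hj⟩ := h
    have hc : D j (D i (drExt ω ((s.1.erase j).erase i))) =
        D i (D j (drExt ω ((s.1.erase i).erase j))) := by
      rw [Finset.erase_right_comm]
      exact LinearMap.congr_fun (hD j i) _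
    simp only
    rw [hc, drSign_antisymm s.1 hi hj (Ne.symm hji), neg_smul, neg_add_cancel]
  · rintro ⟨i, j⟩ h _ he
    simp only [Finset.mem_sigma, Finset.mem_erase] at h
    simp only [Sigma.mk.injEq, heq_eq_eq] at he
    exact h.2.1 he.1
  · rintro ⟨i, j⟩ h
    simp only [Finset.mem_sigma, Finset.mem_erase] at h ⊢
    exact ⟨h.2.2, Ne.symm h.2.1, h.1⟩
  · rintro ⟨i, j⟩ h
    rfl

/-- The de Rham complex `M[dz i]` of a module `M` on which the partial derivatives act through
the commuting operators `D i`. -/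
def deRhamComplex (D : ι → M →ₗ[R] M) (hD : ∀ i j, D i ∘ₗ D j = D j ∘ₗ D i) :
    CochainComplex (ModuleCat.{u} R) ℕ :=
  CochainComplex.of (fun k => ModuleCat.of R (DRForm ι M k)) (fun k => ModuleCat.ofHom (drD D k))
    (fun k => by
      rw [← ModuleCat.ofHom_comp, drD_comp_drD D hD k]
      rfl)

lemma deRhamComplex_d (D : ι → M →ₗ[R] M) (hD : ∀ i j, D i ∘ₗ D j = D j ∘ₗ D i) (k : ℕ) :
    (deRhamComplex D hD).d k (k + 1) = ModuleCat.ofHom (drD D k) :=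
  CochainComplex.of_d (fun k => ModuleCat.of R (DRForm ι M k)) (fun k => ModuleCat.ofHom (drD D k)) k

/-- The map of forms given by `g ↦ F g` on coefficients and `dz i ↦ c i dz i`. -/
def drPull {A : Type u} [CommRing A] [Algebra R A] (F : A →ₗ[R] A) (c : ι → A) (k : ℕ) :
    DRForm ι A k →ₗ[R] DRForm ι A k where
  toFun ω s := (∏ i ∈ s.1, c i) * F (ω s)
  map_add' ω η := by
    ext s
    simp [mul_add]
  map_smul' a ω := by
    ext s
    simp

lemma prod_mul_comm_of_ne {A : Type u} [CommRing A] [Algebra R A] (E : A →ₗ[R] A) (c : ι → A)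
    (i : ι) (hE : ∀ j, j ≠ i → ∀ g, E (c j * g) = c j * E g) (s : Finset ι) (hs : i ∉ s) (g : A) :
    E ((∏ j ∈ s, c j) * g) = (∏ j ∈ s, c j) * E g := by
  induction s using Finset.induction_on generalizing g with
  | empty => simp
  | insert j s hj ih =>
    rw [Finset.mem_insert, not_or] at hs
    rw [Finset.prod_insert hj, mul_assoc, hE j (Ne.symm hs.1), ih hs.2, mul_assoc]

lemma drD_drPull {A : Type u} [CommRing A] [Algebra R A] (D : ι → A →ₗ[R] A) (F : A →ₗ[R] A)
    (c : ι → A) (hF : ∀ i g, D i (F g) = c i * F (D i g))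
    (hDc : ∀ i j, j ≠ i → ∀ g, D i (c j * g) = c j * D i g) (k : ℕ) :
    drD D k ∘ₗ drPull F c k = drPull F c (k + 1) ∘ₗ drD D k := by
  refine LinearMap.ext fun ω => funext fun s => ?_
  change drD D k (drPull F c k ω) s = (∏ i ∈ s.1, c i) * F (drD D k ω s)
  rw [drD_apply, drD_apply, map_sum, Finset.mul_sum]
  refine Finset.sum_congr rfl fun i hi => ?_
  have hcard : (s.1.erase i).card = k := by
    rw [Finset.card_erase_of_mem hi, s.2]; rfl
  have h1 := drExt_of_card (drPull F c k ω) ⟨s.1.erase i, hcard⟩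
  have h2 := drExt_of_card ω ⟨s.1.erase i, hcard⟩
  simp only at h1 h2
  rw [h1, h2]
  change _ • D i ((∏ j ∈ s.1.erase i, c j) * F (ω ⟨s.1.erase i, hcard⟩)) = _
  rw [prod_mul_comm_of_ne (D i) c i (hDc i) _ (Finset.notMem_erase i s.1), hF, map_zsmul,
    mul_smul_comm, ← mul_assoc, Finset.prod_erase_mul _ _ hi]

/-- The endomorphism of the de Rham complex of an algebra induced by `F` and `dz i ↦ c i dz i`. -/
def deRhamMap {A : Type u} [CommRing A] [Algebra R A] (D : ι → A →ₗ[R] A)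
    (hD : ∀ i j, D i ∘ₗ D j = D j ∘ₗ D i) (F : A →ₗ[R] A) (c : ι → A)
    (hF : ∀ i g, D i (F g) = c i * F (D i g))
    (hDc : ∀ i j, j ≠ i → ∀ g, D i (c j * g) = c j * D i g) :
    deRhamComplex D hD ⟶ deRhamComplex D hD :=
  CochainComplex.ofHom (fun k => ModuleCat.ofHom (drPull F c k)) (fun k => by
    refine (congrArg _ (deRhamComplex_d D hD k)).trans
      (Eq.trans ?_ (congrArg (fun f => f ≫ _) (deRhamComplex_d D hD k)).symm)
    exact congrArg ModuleCat.ofHom (drD_drPull D F c hF hDc k))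

end DeRham

/-! ### Overconvergent power series -/

section Overconvergent

variable {p : ℕ} [Fact p.Prime]

/-- `∑ a_I z^I` is overconvergent if `‖a_I‖ ≤ C r ^ |I|` for some `C` and some `r` with
`0 < r < 1`, that is, `ord a_I ≥ c |I| + d` for some `d` and some `c > 0`. -/
def IsOverconvergent {ι : Type} (f : MvPowerSeries ι ℂ_[p]) : Prop :=
  ∃ C r : ℝ, 0 < C ∧ 0 < r ∧ r < 1 ∧ ∀ I : ι →₀ ℕ, ‖MvPowerSeries.coeff I f‖ ≤ C * r ^ I.degree

lemma IsOverconvergent.exists_common {ι : Type} {f g : MvPowerSeries ι ℂ_[p]}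
    (hf : IsOverconvergent f) (hg : IsOverconvergent g) :
    ∃ C r : ℝ, 0 < C ∧ 0 < r ∧ r < 1 ∧
      (∀ I : ι →₀ ℕ, ‖MvPowerSeries.coeff I f‖ ≤ C * r ^ I.degree) ∧
      (∀ I : ι →₀ ℕ, ‖MvPowerSeries.coeff I g‖ ≤ C * r ^ I.degree) := by
  obtain ⟨C, r, hC, hr, hr1, h⟩ := hf
  obtain ⟨C', r', hC', hr', hr1', h'⟩ := hg
  refine ⟨max C C', max r r', lt_max_of_lt_left hC, lt_max_of_lt_left hr, max_lt hr1 hr1',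
    fun I => (h I).trans ?_, fun I => (h' I).trans ?_⟩
  · gcongr
    · exact le_max_left _ _
    · exact le_max_left _ _
  · gcongr
    · exact le_max_right _ _
    · exact le_max_right _ _

lemma IsOverconvergent.add {ι : Type} {f g : MvPowerSeries ι ℂ_[p]}
    (hf : IsOverconvergent f) (hg : IsOverconvergent g) : IsOverconvergent (f + g) := by
  obtain ⟨C, r, hC, hr, hr1, h1, h2⟩ := hf.exists_common hg
  refine ⟨C, r, hC, hr, hr1, fun I => ?_⟩
  rw [map_add]
  exact (PadicComplex.isNonarchimedean p _ _).trans (max_le (h1 I) (h2 I))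

lemma IsOverconvergent.mul {ι : Type} {f g : MvPowerSeries ι ℂ_[p]}
    (hf : IsOverconvergent f) (hg : IsOverconvergent g) : IsOverconvergent (f * g) := by
  classical
  obtain ⟨C, r, hC, hr, hr1, h1, h2⟩ := hf.exists_common hg
  refine ⟨C * C, r, mul_pos hC hC, hr, hr1, fun I => ?_⟩
  rw [MvPowerSeries.coeff_mul]
  refine IsUltrametricDist.norm_sum_le_of_forall_le_of_nonneg (by positivity) fun x hx => ?_
  rw [norm_mul, ← Finset.HasAntidiagonal.mem_antidiagonal.mp hx, map_add, pow_add]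
  calc _ ≤ (C * r ^ x.1.degree) * (C * r ^ x.2.degree) :=
        mul_le_mul (h1 _) (h2 _) (norm_nonneg _) (by positivity)
    _ = _ := by ring

lemma isOverconvergent_coe {ι : Type} (P : MvPolynomial ι ℂ_[p]) :
    IsOverconvergent (P : MvPowerSeries ι ℂ_[p]) := by
  induction P using MvPolynomial.induction_on' with
  | monomial m a =>
    refine ⟨(‖a‖ + 1) * 2 ^ m.degree, 1 / 2, by positivity, by norm_num, by norm_num,
      fun I => ?_⟩
    classical
    rw [MvPolynomial.coeff_coe, MvPolynomial.coeff_monomial]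
    split_ifs with h
    · subst h
      rw [mul_assoc, ← mul_pow]
      norm_num
    · rw [norm_zero]
      positivity
  | add P Q hP hQ =>
    rw [MvPolynomial.coe_add]
    exact hP.add hQ

lemma IsOverconvergent.pderiv {ι : Type} {f : MvPowerSeries ι ℂ_[p]}
    (hf : IsOverconvergent f) (i : ι) :
    IsOverconvergent (MvPowerSeries.pderiv ℂ_[p] i f) := by
  obtain ⟨C, r, hC, hr, hr1, h⟩ := hf
  refine ⟨C, r, hC, hr, hr1, fun I => ?_⟩
  rw [MvPowerSeries.coeff_pderiv, norm_mul]
  have h1 : ‖((I i : ℂ_[p]) + 1)‖ ≤ 1 := by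
    have := IsUltrametricDist.norm_natCast_le_one ℂ_[p] (I i + 1)
    simpa using this
  calc _ ≤ ‖MvPowerSeries.coeff (I + Finsupp.single i 1) f‖ * 1 := by gcongr
    _ ≤ C * r ^ (I + Finsupp.single i 1).degree := by rw [mul_one]; exact h _
    _ ≤ C * r ^ I.degree := by
      gcongr ?_ * ?_
      refine pow_le_pow_of_le_one hr.le hr1.le ?_
      rw [map_add]
      exact Nat.le_add_right _ _

lemma IsOverconvergent.expand {ι : Type} {f : MvPowerSeries ι ℂ_[p]}
    (hf : IsOverconvergent f) (q : ℕ) (hq : q ≠ 0) :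
    IsOverconvergent (MvPowerSeries.expand q hq f) := by
  obtain ⟨C, r, hC, hr, hr1, h⟩ := hf
  have hq' : (0 : ℝ) < (q : ℝ)⁻¹ := by positivity
  refine ⟨C, r ^ (q : ℝ)⁻¹, hC, by positivity, Real.rpow_lt_one hr.le hr1 hq', fun I => ?_⟩
  by_cases hI : ∃ m : ι →₀ ℕ, I = q • m
  · obtain ⟨m, rfl⟩ := hI
    rw [MvPowerSeries.coeff_expand_smul, map_nsmul, smul_eq_mul, pow_mul,
      Real.rpow_inv_natCast_pow hr.le hq]
    exact h m
  · have : ∃ i, ¬ q ∣ I i := by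
      by_contra hc
      push Not at hc
      refine hI ⟨I.mapRange (fun a => a / q) (by simp), ?_⟩
      ext i
      simp [Nat.mul_div_cancel' (hc i)]
    obtain ⟨i, hi⟩ := this
    rw [MvPowerSeries.coeff_expand_of_not_dvd q hq f hi, norm_zero]
    positivity

variable (p) in
/-- The ring `ℂ_p^†⟨z i⟩` of overconvergent power series in the variables `z i`. -/
def Overconvergent (ι : Type) : Subalgebra ℂ_[p] (MvPowerSeries ι ℂ_[p]) where
  carrier := {f | IsOverconvergent f}
  mul_mem' := IsOverconvergent.mul
  add_mem' := IsOverconvergent.add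
  algebraMap_mem' a := by
    have := isOverconvergent_coe (MvPolynomial.C a : MvPolynomial ι ℂ_[p])
    rw [MvPolynomial.coe_C] at this
    exact this

/-- A polynomial as an overconvergent power series. -/
def ocPoly {ι : Type} (P : MvPolynomial ι ℂ_[p]) : Overconvergent p ι :=
  ⟨(P : MvPowerSeries ι ℂ_[p]), isOverconvergent_coe P⟩

/-- The partial derivative on overconvergent power series. -/
def ocPderiv {ι : Type} (i : ι) : Overconvergent p ι →ₗ[ℂ_[p]] Overconvergent p ι where
  toFun f := ⟨MvPowerSeries.pderiv ℂ_[p] i f.1, IsOverconvergent.pderiv f.2 i⟩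
  map_add' f g := Subtype.ext (map_add (MvPowerSeries.pderiv ℂ_[p] i) f.1 g.1)
  map_smul' a f := Subtype.ext ((MvPowerSeries.pderiv ℂ_[p] i).map_smul a f.1)

/-- The substitution `z i ↦ z i ^ p` on overconvergent power series. -/
def ocExpand {ι : Type} : Overconvergent p ι →ₗ[ℂ_[p]] Overconvergent p ι where
  toFun f := ⟨MvPowerSeries.expand p (Fact.out : p.Prime).ne_zero f.1,
    IsOverconvergent.expand f.2 p _⟩
  map_add' f g := Subtype.ext (map_add (MvPowerSeries.expand p _) f.1 g.1)
  map_smul' a f := Subtype.ext (map_smul (MvPowerSeries.expand p _) a f.1)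

/-- The action of `∂_i` on the `D`-module `ℂ_p^†⟨z⟩ e^W`: it is `∂_i + (∂_i W)`. -/
def twistedPderiv {ι : Type} (W : MvPolynomial ι ℂ_[p]) (i : ι) :
    Overconvergent p ι →ₗ[ℂ_[p]] Overconvergent p ι :=
  ocPderiv i + LinearMap.mulLeft ℂ_[p] (ocPoly (MvPolynomial.pderiv i W))

lemma coe_twistedPderiv {ι : Type} (W : MvPolynomial ι ℂ_[p]) (i : ι) (g : Overconvergent p ι) :
    (twistedPderiv W i g : MvPowerSeries ι ℂ_[p]) =
      MvPowerSeries.pderiv ℂ_[p] i g + (MvPolynomial.pderiv i W : MvPolynomial ι ℂ_[p]) * g := rfl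

lemma mvPowerSeries_pderiv_comm {ι : Type} (i j : ι) (f : MvPowerSeries ι ℂ_[p]) :
    MvPowerSeries.pderiv ℂ_[p] i (MvPowerSeries.pderiv ℂ_[p] j f) =
      MvPowerSeries.pderiv ℂ_[p] j (MvPowerSeries.pderiv ℂ_[p] i f) := by
  classical
  by_cases hij : i = j
  · rw [hij]
  ext I
  simp only [MvPowerSeries.coeff_pderiv, Finsupp.add_apply, Finsupp.single_apply, hij,
    Ne.symm hij, if_false, add_zero]
  rw [add_right_comm]
  ring

lemma twistedPderiv_comm {ι : Type} (W : MvPolynomial ι ℂ_[p]) (i j : ι) :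
    twistedPderiv W i ∘ₗ twistedPderiv W j = twistedPderiv W j ∘ₗ twistedPderiv W i := by
  refine LinearMap.ext fun g => Subtype.ext ?_
  simp only [LinearMap.comp_apply, coe_twistedPderiv, map_add, Derivation.leibniz, smul_eq_mul,
    ← MvPowerSeries.pderiv_coe]
  rw [mvPowerSeries_pderiv_comm i j (g : MvPowerSeries ι ℂ_[p]),
    mvPowerSeries_pderiv_comm i j (W : MvPowerSeries ι ℂ_[p])]
  ring

lemma twistedPderiv_mul_of_pderiv_eq_zero {ι : Type} (W : MvPolynomial ι ℂ_[p]) (i : ι)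
    (c : MvPolynomial ι ℂ_[p]) (hc : MvPolynomial.pderiv i c = 0) (g : Overconvergent p ι) :
    twistedPderiv W i (ocPoly c * g) = ocPoly c * twistedPderiv W i g := by
  refine Subtype.ext ?_
  have h : MvPowerSeries.pderiv ℂ_[p] i (ocPoly c).1 = 0 := by
    change MvPowerSeries.pderiv ℂ_[p] i (c : MvPowerSeries ι ℂ_[p]) = 0
    rw [MvPowerSeries.pderiv_coe, hc, MvPolynomial.coe_zero]
  change MvPowerSeries.pderiv ℂ_[p] i ((ocPoly c).1 * g.1) +
      (ocPoly (MvPolynomial.pderiv i W)).1 * ((ocPoly c).1 * g.1) =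
    (ocPoly c).1 * (MvPowerSeries.pderiv ℂ_[p] i g.1 +
      (ocPoly (MvPolynomial.pderiv i W)).1 * g.1)
  rw [Derivation.leibniz, h, smul_eq_mul, smul_zero, add_zero, mul_add, mul_left_comm]

end Overconvergent

/-! ### Dwork cohomology and the Frobenius -/

section Dwork

variable {p : ℕ} [Fact p.Prime]

/-- The polynomial `ϖ P t` in the variables `z 0, …, z (n - 1), t`, where `t` is the last one. -/
def dworkPotential {n : ℕ} (ϖ : ℂ_[p]) (P : MvPolynomial (Fin n) ℂ_[p]) :
    MvPolynomial (Fin (n + 1)) ℂ_[p] :=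
  MvPolynomial.C ϖ * (MvPolynomial.rename Fin.castSucc P * MvPolynomial.X (Fin.last n))

/-- The de Rham complex of the `D`-module `ℂ_p^†⟨z, t⟩ e^{ϖ P t}`. -/
def dworkComplex {n : ℕ} (ϖ : ℂ_[p]) (P : MvPolynomial (Fin n) ℂ_[p]) :
    CochainComplex (ModuleCat.{0} ℂ_[p]) ℕ :=
  deRhamComplex (twistedPderiv (dworkPotential ϖ P)) (twistedPderiv_comm _)

/-- The exponent `W(z ^ p) - W(z)`. -/
def frobExponent {ι : Type} (W : MvPolynomial ι ℂ_[p]) : MvPolynomial ι ℂ_[p] :=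
  MvPolynomial.expand p W - W

/-- The formal power series `e^Q` of a polynomial `Q` with zero constant term. -/
def mvExp {ι : Type} (Q : MvPolynomial ι ℂ_[p]) : MvPowerSeries ι ℂ_[p] :=
  (PowerSeries.exp ℂ_[p]).subst (Q : MvPowerSeries ι ℂ_[p])

lemma coeff_pow_eq_zero_of_degree_lt {ι : Type} (f : MvPowerSeries ι ℂ_[p])
    (hf : MvPowerSeries.constantCoeff f = 0) (I : ι →₀ ℕ) (k : ℕ) (hk : I.degree < k) :
    MvPowerSeries.coeff I (f ^ k) = 0 := by
  refine MvPowerSeries.coeff_of_lt_order (lt_of_lt_of_le ?_ (MvPowerSeries.le_order_pow k))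
  have h1 : (1 : ℕ∞) ≤ f.order := MvPowerSeries.one_le_order_iff_constCoeff_eq_zero.mpr hf
  calc (I.degree : ℕ∞) < (k : ℕ∞) := by exact_mod_cast hk
    _ = k • (1 : ℕ∞) := by simp
    _ ≤ k • f.order := nsmul_le_nsmul_right h1 k

lemma coeff_mvExp {ι : Type} (Q : MvPolynomial ι ℂ_[p])
    (hQ : MvPowerSeries.constantCoeff (Q : MvPowerSeries ι ℂ_[p]) = 0) (I : ι →₀ ℕ) (N : ℕ)
    (hN : I.degree < N) :
    MvPowerSeries.coeff I (mvExp Q) = MvPowerSeries.coeff I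
      (∑ k ∈ Finset.range N, algebraMap ℚ ℂ_[p] (1 / k.factorial) •
        (Q : MvPowerSeries ι ℂ_[p]) ^ k) := by
  rw [mvExp, PowerSeries.coeff_subst (PowerSeries.HasSubst.of_constantCoeff_zero hQ), map_sum,
    finsum_eq_sum_of_support_subset (s := Finset.range N)]
  · refine Finset.sum_congr rfl fun k _ => ?_
    rw [PowerSeries.coeff_exp, MvPowerSeries.coeff_smul, smul_eq_mul]
  · intro k hk
    rw [Finset.coe_range, Set.mem_Iio]
    by_contra hc
    refine hk ?_
    simp only
    rw [coeff_pow_eq_zero_of_degree_lt _ hQ I k (by omega), smul_zero]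

lemma pderiv_mvExp {ι : Type} (Q : MvPolynomial ι ℂ_[p])
    (hQ : MvPolynomial.constantCoeff Q = 0) (i : ι) :
    MvPowerSeries.pderiv ℂ_[p] i (mvExp Q) =
      (MvPolynomial.pderiv i Q : MvPolynomial ι ℂ_[p]) * mvExp Q := by
  classical
  have hQ' : MvPowerSeries.constantCoeff (Q : MvPowerSeries ι ℂ_[p]) = 0 := by
    rw [← hQ, ← MvPowerSeries.coeff_zero_eq_constantCoeff_apply, MvPolynomial.coeff_coe]
    rfl
  ext I
  have h1 : (I + Finsupp.single i 1).degree < I.degree + 1 + 1 := by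
    rw [map_add, Finsupp.degree_single]; omega
  have h2 : MvPowerSeries.pderiv ℂ_[p] i (∑ k ∈ Finset.range (I.degree + 1 + 1),
      algebraMap ℚ ℂ_[p] (1 / k.factorial) • (Q : MvPowerSeries ι ℂ_[p]) ^ k) =
      (MvPolynomial.pderiv i Q : MvPolynomial ι ℂ_[p]) * ∑ k ∈ Finset.range (I.degree + 1),
        algebraMap ℚ ℂ_[p] (1 / k.factorial) • (Q : MvPowerSeries ι ℂ_[p]) ^ k := by
    rw [Finset.sum_range_succ', map_add, map_sum, Finset.mul_sum]
    have h3 : MvPowerSeries.pderiv ℂ_[p] i (algebraMap ℚ ℂ_[p] (1 / Nat.factorial 0) •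
        (Q : MvPowerSeries ι ℂ_[p]) ^ 0) = 0 := by
      rw [Derivation.map_smul, pow_zero, MvPowerSeries.pderiv_one, smul_zero]
    rw [h3, add_zero]
    refine Finset.sum_congr rfl fun k _ => ?_
    rw [Derivation.map_smul, MvPowerSeries.pderiv_pow, MvPowerSeries.pderiv_coe, mul_smul_comm,
      Nat.add_sub_cancel, mul_assoc, ← nsmul_eq_mul, ← Nat.cast_smul_eq_nsmul ℂ_[p], smul_smul,
      mul_comm (_ : MvPowerSeries ι ℂ_[p]) (_ ^ k)]
    congr 1
    rw [← map_natCast (algebraMap ℚ ℂ_[p]), ← map_mul]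
    congr 1
    rw [Nat.factorial_succ]
    push_cast
    field_simp
  rw [MvPowerSeries.coeff_pderiv, coeff_mvExp Q hQ' _ _ h1, ← MvPowerSeries.coeff_pderiv, h2,
    MvPowerSeries.coeff_mul, MvPowerSeries.coeff_mul]
  refine Finset.sum_congr rfl fun x hx => ?_
  have h4 : x.2.degree < I.degree + 1 := by
    rw [← Finset.HasAntidiagonal.mem_antidiagonal.mp hx, map_add]; omega
  rw [coeff_mvExp Q hQ' _ _ h4]

lemma pderiv_expand_poly {ι : Type} (i : ι) (W : MvPolynomial ι ℂ_[p]) :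
    MvPolynomial.pderiv i (MvPolynomial.expand p W) =
      (p : MvPolynomial ι ℂ_[p]) * MvPolynomial.X i ^ (p - 1) *
        MvPolynomial.expand p (MvPolynomial.pderiv i W) := by
  classical
  induction W using MvPolynomial.induction_on with
  | C a => simp
  | add P Q hP hQ => rw [map_add, map_add, hP, hQ, map_add, map_add, mul_add]
  | mul_X P j hP =>
    rw [map_mul, MvPolynomial.pderiv_mul, hP, MvPolynomial.pderiv_mul, map_add, map_mul, map_mul,
      MvPolynomial.expand_X, MvPolynomial.pderiv_pow, MvPolynomial.pderiv_X]
    by_cases h : i = j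
    · subst h
      simp only [Pi.single_eq_same, map_one]
      ring
    · rw [Pi.single_eq_of_ne (Ne.symm h)]
      simp only [map_zero, mul_zero, add_zero]
      ring

lemma pderiv_expand {ι : Type} (i : ι) (f : MvPowerSeries ι ℂ_[p]) :
    MvPowerSeries.pderiv ℂ_[p] i
        (MvPowerSeries.expand p (Fact.out : p.Prime).ne_zero f) =
      ((p : MvPolynomial ι ℂ_[p]) * MvPolynomial.X i ^ (p - 1) : MvPolynomial ι ℂ_[p]) *
        MvPowerSeries.expand p (Fact.out : p.Prime).ne_zero (MvPowerSeries.pderiv ℂ_[p] i f) := by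
  classical
  have hp0 : p ≠ 0 := (Fact.out : p.Prime).ne_zero
  have hmon : (p : MvPolynomial ι ℂ_[p]) * MvPolynomial.X i ^ (p - 1) =
      MvPolynomial.monomial (Finsupp.single i (p - 1)) (p : ℂ_[p]) := by
    rw [← MvPolynomial.C_mul_X_pow_eq_monomial, map_natCast]
  have hdiv : ∀ J : ι →₀ ℕ, (¬ ∃ m : ι →₀ ℕ, J = p • m) → ∀ g : MvPowerSeries ι ℂ_[p],
      MvPowerSeries.coeff J (MvPowerSeries.expand p hp0 g) = 0 := by
    intro J hJ g
    have : ∃ j, ¬ p ∣ J j := by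
      by_contra hc
      push Not at hc
      refine hJ ⟨J.mapRange (fun a => a / p) (by simp), ?_⟩
      ext j
      simp [Nat.mul_div_cancel' (hc j)]
    obtain ⟨j, hj⟩ := this
    exact MvPowerSeries.coeff_expand_of_not_dvd p hp0 g hj
  rw [hmon, MvPolynomial.coe_monomial]
  ext J
  rw [MvPowerSeries.coeff_pderiv, MvPowerSeries.coeff_monomial_mul]
  by_cases hJ : ∃ m : ι →₀ ℕ, J + Finsupp.single i 1 = p • m
  · obtain ⟨m, hm⟩ := hJ
    have hmi : J i + 1 = p * m i := by
      have := DFunLike.congr_fun hm i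
      simpa using this
    have hmi0 : 1 ≤ m i := by
      rcases Nat.eq_zero_or_pos (m i) with h | h
      · rw [h] at hmi; omega
      · exact h
    obtain ⟨m', rfl⟩ : ∃ m', m = m' + Finsupp.single i 1 := by
      refine ⟨m - Finsupp.single i 1, ?_⟩
      rw [tsub_add_cancel_of_le]
      rwa [Finsupp.single_le_iff]
    have hJe : J = p • m' + Finsupp.single i (p - 1) := by
      have h1 : J + Finsupp.single i 1 = p • m' + Finsupp.single i (p - 1) + Finsupp.single i 1 := by
        rw [hm, add_assoc, ← Finsupp.single_add, Nat.sub_add_cancel (Nat.one_le_iff_ne_zero.mpr hp0),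
          smul_add, Finsupp.smul_single, smul_eq_mul, mul_one]
      exact add_right_cancel h1
    have hcast : ((J i : ℂ_[p]) + 1) = p * ((m' i : ℂ_[p]) + 1) := by
      have : ((J i + 1 : ℕ) : ℂ_[p]) = ((p * (m' i + 1) : ℕ) : ℂ_[p]) := by
        rw [hmi]; simp
      push_cast at this
      exact this
    rw [hm, MvPowerSeries.coeff_expand_smul, hcast, if_pos (hJe ▸ le_add_self), hJe,
      add_tsub_cancel_right, MvPowerSeries.coeff_expand_smul, MvPowerSeries.coeff_pderiv]
    ring
  · rw [hdiv _ hJ, zero_mul]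
    split_ifs with hle
    · rw [hdiv, mul_zero]
      rintro ⟨m, hm⟩
      refine hJ ⟨m + Finsupp.single i 1, ?_⟩
      rw [smul_add, ← hm, Finsupp.smul_single, smul_eq_mul, mul_one]
      nth_rewrite 1 [← tsub_add_cancel_of_le hle]
      rw [add_assoc, ← Finsupp.single_add, Nat.sub_add_cancel (Nat.one_le_iff_ne_zero.mpr hp0)]
    · rfl

/-- The power series `e^{W(z ^ p) - W(z)}` for `W = ϖ P t`, that is,
`e^{ϖ (P(z ^ p) t ^ p - P(z) t)}`. -/
def frobSeries {n : ℕ} (ϖ : ℂ_[p]) (P : MvPolynomial (Fin n) ℂ_[p]) :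
    MvPowerSeries (Fin (n + 1)) ℂ_[p] :=
  mvExp (frobExponent (dworkPotential ϖ P))

lemma constantCoeff_frobExponent {n : ℕ} (ϖ : ℂ_[p]) (P : MvPolynomial (Fin n) ℂ_[p]) :
    MvPolynomial.constantCoeff (frobExponent (dworkPotential ϖ P)) = 0 := by
  simp [frobExponent, dworkPotential, (Fact.out : p.Prime).ne_zero]

/-- The action of the Frobenius on functions,
`f(z, t) ↦ e^{ϖ (P(z ^ p) t ^ p - P(z) t)} f(z ^ p, t ^ p)`. -/
def frobFun {n : ℕ} (ϖ : ℂ_[p]) (P : MvPolynomial (Fin n) ℂ_[p])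
    (h : IsOverconvergent (frobSeries ϖ P)) :
    Overconvergent p (Fin (n + 1)) →ₗ[ℂ_[p]] Overconvergent p (Fin (n + 1)) :=
  LinearMap.mulLeft ℂ_[p] (⟨frobSeries ϖ P, h⟩ : Overconvergent p (Fin (n + 1))) ∘ₗ ocExpand

/-- The factor `p * z i ^ (p - 1)` in `d (z i ^ p) = p * z i ^ (p - 1) * dz i`. -/
def frobFactor {ι : Type} (i : ι) : MvPolynomial ι ℂ_[p] :=
  (p : MvPolynomial ι ℂ_[p]) * MvPolynomial.X i ^ (p - 1)

lemma pderiv_frobFactor {ι : Type} (i j : ι) (h : j ≠ i) :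
    MvPolynomial.pderiv i (frobFactor j : MvPolynomial ι ℂ_[p]) = 0 := by
  have h1 : (p : MvPolynomial ι ℂ_[p]) = MvPolynomial.C (p : ℂ_[p]) := by rw [map_natCast]
  rw [frobFactor, h1, MvPolynomial.pderiv_C_mul, MvPolynomial.pderiv_pow,
    MvPolynomial.pderiv_X_of_ne h, mul_zero, mul_zero]

lemma twistedPderiv_frobFun {n : ℕ} (ϖ : ℂ_[p]) (P : MvPolynomial (Fin n) ℂ_[p])
    (h : IsOverconvergent (frobSeries ϖ P)) (i : Fin (n + 1))
    (g : Overconvergent p (Fin (n + 1))) :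
    twistedPderiv (dworkPotential ϖ P) i (frobFun ϖ P h g) =
      ocPoly (frobFactor i) * frobFun ϖ P h (twistedPderiv (dworkPotential ϖ P) i g) := by
  refine Subtype.ext ?_
  have hp0 : p ≠ 0 := (Fact.out : p.Prime).ne_zero
  set W := dworkPotential ϖ P with hW
  have hE := pderiv_mvExp (frobExponent W) (constantCoeff_frobExponent ϖ P) i
  have hX := pderiv_expand i g.1
  have hP := pderiv_expand_poly i W
  change MvPowerSeries.pderiv ℂ_[p] i
        (mvExp (frobExponent W) * MvPowerSeries.expand p hp0 g.1) +
      ((MvPolynomial.pderiv i W : MvPolynomial (Fin (n + 1)) ℂ_[p]) :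
        MvPowerSeries (Fin (n + 1)) ℂ_[p]) *
        (mvExp (frobExponent W) * MvPowerSeries.expand p hp0 g.1) =
    ((frobFactor i : MvPolynomial (Fin (n + 1)) ℂ_[p]) : MvPowerSeries (Fin (n + 1)) ℂ_[p]) * (mvExp (frobExponent W) *
      MvPowerSeries.expand p hp0 (MvPowerSeries.pderiv ℂ_[p] i g.1 +
        ((MvPolynomial.pderiv i W : MvPolynomial (Fin (n + 1)) ℂ_[p]) :
        MvPowerSeries (Fin (n + 1)) ℂ_[p]) * g.1))
  have hP' : MvPolynomial.pderiv i (frobExponent W) =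
      frobFactor i * MvPolynomial.expand p (MvPolynomial.pderiv i W) -
        MvPolynomial.pderiv i W := by
    rw [frobExponent, map_sub, hP, frobFactor]
  have hcoe : ((MvPolynomial.pderiv i (frobExponent W) : MvPolynomial (Fin (n + 1)) ℂ_[p]) :
      MvPowerSeries (Fin (n + 1)) ℂ_[p]) = ((frobFactor i : MvPolynomial (Fin (n + 1)) ℂ_[p]) : MvPowerSeries (Fin (n + 1)) ℂ_[p]) *
        MvPowerSeries.expand p hp0 (MvPolynomial.pderiv i W : MvPolynomial _ ℂ_[p]) -
        ((MvPolynomial.pderiv i W : MvPolynomial (Fin (n + 1)) ℂ_[p]) :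
          MvPowerSeries (Fin (n + 1)) ℂ_[p]) := by
    rw [hP', MvPowerSeries.expand_eq_expand, ← MvPolynomial.coe_mul, eq_sub_iff_add_eq,
      ← MvPolynomial.coe_add, sub_add_cancel]
  rw [hcoe] at hE
  rw [Derivation.leibniz, hE, hX, smul_eq_mul, smul_eq_mul, map_add, map_mul]
  change _ * (((frobFactor i : MvPolynomial (Fin (n + 1)) ℂ_[p]) : MvPowerSeries (Fin (n + 1)) ℂ_[p]) * _) + _ + _ = _
  ring

/-- The Frobenius map on the Dwork complex,
`g dz i₁ ⋯ dz iₛ ↦ e^{ϖ (P(z ^ p) t ^ p - P(z) t)} g(z ^ p, t ^ p) d(z i₁ ^ p) ⋯ d(z iₛ ^ p)`. -/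
def dworkFrobenius {n : ℕ} (ϖ : ℂ_[p]) (P : MvPolynomial (Fin n) ℂ_[p])
    (h : IsOverconvergent (frobSeries ϖ P)) : dworkComplex ϖ P ⟶ dworkComplex ϖ P :=
  deRhamMap (twistedPderiv (dworkPotential ϖ P)) (twistedPderiv_comm _) (frobFun ϖ P h)
    (fun i => ocPoly (frobFactor i)) (twistedPderiv_frobFun ϖ P h)
    (fun i j hij => twistedPderiv_mul_of_pderiv_eq_zero _ i _ (pderiv_frobFactor i j hij))

/-- The Dwork cohomology `H^k_DW` of the hypersurface `P = 0`. -/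
abbrev DworkCohomology {n : ℕ} (ϖ : ℂ_[p]) (P : MvPolynomial (Fin n) ℂ_[p]) (k : ℕ) :
    ModuleCat.{0} ℂ_[p] :=
  (dworkComplex ϖ P).homology k

/-- The cohomology `H^i` of the hypersurface `P = 0` in the standard convention for the degree:
it is `H^{i + 2}_DW`. -/
abbrev HypersurfaceCohomology {n : ℕ} (ϖ : ℂ_[p]) (P : MvPolynomial (Fin n) ℂ_[p]) (i : ℕ) :
    ModuleCat.{0} ℂ_[p] :=
  DworkCohomology ϖ P (i + 2)

/-- The Frobenius map on `H^i` of the hypersurface `P = 0` in the standard convention: the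
Frobenius map of the Dwork complex acquires an extra factor `p`, which is removed here. -/
def hypersurfaceFrobenius {n : ℕ} (ϖ : ℂ_[p]) (P : MvPolynomial (Fin n) ℂ_[p])
    (h : IsOverconvergent (frobSeries ϖ P)) (i : ℕ) :
    HypersurfaceCohomology ϖ P i →ₗ[ℂ_[p]] HypersurfaceCohomology ϖ P i :=
  (p : ℂ_[p])⁻¹ • (HomologicalComplex.homologyMap (dworkFrobenius ϖ P h) (i + 2)).hom

/-- `P` defines a smooth hypersurface in affine space over `ℂ_p`. -/
def IsSmoothHypersurface {n : ℕ} (P : MvPolynomial (Fin n) ℂ_[p]) : Prop :=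
  P ≠ 0 ∧ ∀ z : Fin n → ℂ_[p], MvPolynomial.eval z P = 0 →
    ∃ i, MvPolynomial.eval z (MvPolynomial.pderiv i P) ≠ 0

/-- The polynomial `P + x y` in the variables `z 0, …, z (n - 1), x, y`. -/
def addXY {n : ℕ} (P : MvPolynomial (Fin n) ℂ_[p]) : MvPolynomial (Fin (n + 2)) ℂ_[p] :=
  MvPolynomial.rename (Fin.castAdd 2) P +
    MvPolynomial.X (Fin.natAdd n 0) * MvPolynomial.X (Fin.natAdd n 1)

end Dwork

end

/-!
Write `ϖ` for the root of `-p`. The isomorphism is induced by the suspension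
`ω ↦ d(x t) ∧ dy ∧ ω` (`suspMap`), which sends forms in `z, t` to forms in `z, x, y, t` and commutes
with the differentials for the potentials `ϖ t P` and `ϖ t (P + x y)` (`totalD_suspMap`).

Contraction with the vector field `x ∂_x - y ∂_y`, which annihilates the potential, is a homotopy,
so a closed form in `z, x, y, t` is cohomologous to its part of weight zero for this field
(`SuspensionData.exists_homotopy_weight_zero`). Such a form is written with power series in
`z, s, t`, where `s = x y`, and the potential becomes `ϖ t (P + s)`, that of the graph of `-P`. The
graph has no cohomology in high degrees (`exactFrom_graphPotential`). Indeed
`∂_t + ϖ (P + s)` is injective with cokernel the series that do not involve `s`: it is divided by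
as if it were `ϖ s`, and the Neumann series of this division converges and preserves
overconvergence, since `k! / ϖ ^ k`, the size of `(ϖ⁻¹ ∂_t) ^ k`, has at most linear growth in `k`
(`bijective_shift_twistedPderiv`). What is left of `∂_s + ϖ t` is the multiplication by `ϖ t`, and
its cokernel carries the de Rham complex of affine space, which is exact in positive degrees
(`exactFrom_ocPderiv`). The acyclicity of the graph shows that the suspension is surjective and
injective on cohomology classes (`SuspensionData.exists_phi_of_closed`,
`SuspensionData.exact_of_phi_exact`), hence the isomorphism (`exists_suspensionEquiv`).

For the Frobenius, put `u = x y t`. Then `E_{P + x y} = E_P e^{ϖ (u ^ p - u)}`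
(`frobSeries_addXY`), and the second factor is overconvergent. If `ω'` denotes the Frobenius
pullback of a closed form `ω`, then the pullback of the suspension of `ω` and `p` times the
suspension of `ω'` differ by the differential of `f dy ω'`, where
`y f = (p / ϖ) (e^{ϖ (u ^ p - u)} - 1)` (`totalD_formQuad_ocXytQuot`). With the factor `p⁻¹` of
the Frobenius this is the asserted compatibility.

The overconvergence of `e^{ϖ (R(z ^ p) - R(z))}`, with `R = P t`, comes from its product with
`1 + ϖ R`: the `p`-th power of the product is `1` to precision `p ϖ` on a polydisc of radius greater
than `1`, because `ϖ ^ p = - p ϖ` and because `R(z ^ p)` and `R ^ p` are congruent modulo the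
maximal ideal. Extraction of the `p`-th root loses a factor `p` only (`CoeffBound.of_pow_prime`), so
the product, and with it the exponential, is bounded on this polydisc
(`isOverconvergent_mvExp_frobExponent`, `isOverconvergent_frobSeries`).
-/

noncomputable section

/-! ### Differential forms of all degrees and removal of one variable -/

section TotalForms

variable {R : Type*} [CommRing R] {M N : Type*} [AddCommGroup M] [Module R M]
  [AddCommGroup N] [Module R N] {ι : Type}

/-- Forms all of whose components have degree at least `k`. -/
def DegreeGE (k : ℕ) (ω : Finset ι → M) : Prop := ∀ s : Finset ι, s.card < k → ω s = 0

lemma DegreeGE.compLeft {k : ℕ} {ω : Finset ι → N} (h : DegreeGE k ω) (φ : N →ₗ[R] M) :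
    DegreeGE k (φ.compLeft _ ω) := by
  intro s hs
  simp [h s hs]

lemma DegreeGE.mono {k l : ℕ} (hkl : k ≤ l) {ω : Finset ι → M} (h : DegreeGE l ω) :
    DegreeGE k ω := fun s hs => h s (hs.trans_le hkl)

lemma DegreeGE.sub {k : ℕ} {ω η : Finset ι → M} (h : DegreeGE k ω) (h' : DegreeGE k η) :
    DegreeGE k (ω - η) := by
  intro s hs
  simp [h s hs, h' s hs]

/-- The component of degree `k` of a form, as a form of mixed degree. -/
def degreePart (k : ℕ) (ω : Finset ι → M) : Finset ι → M :=
  fun s => if s.card = k then ω s else 0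

lemma degreePart_compLeft (φ : N →ₗ[R] M) (k : ℕ) (ω : Finset ι → N) :
    φ.compLeft _ (degreePart k ω) = degreePart k (φ.compLeft _ ω) := by
  ext s
  simp only [degreePart, LinearMap.compLeft_apply, Function.comp_apply]
  split_ifs <;> simp

variable [LinearOrder ι]

/-- The de Rham differential on forms of mixed degree: a family `ω` of coefficients indexed by all
finite sets `s = {i₁ < ⋯ < iₖ}` stands for the sum of the `ω s dz i₁ ⋯ dz iₖ`. -/
def totalD (D : ι → M →ₗ[R] M) : (Finset ι → M) →ₗ[R] (Finset ι → M) where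
  toFun ω s := ∑ i ∈ s, drSign s i • D i (ω (s.erase i))
  map_add' ω η := by
    ext s
    simp [Finset.sum_add_distrib]
  map_smul' c ω := by
    ext s
    simp [Finset.smul_sum, smul_comm c]

lemma totalD_apply (D : ι → M →ₗ[R] M) (ω : Finset ι → M) (s : Finset ι) :
    totalD D ω s = ∑ i ∈ s, drSign s i • D i (ω (s.erase i)) := rfl

/-- The signs of a form in two odd variables cancel against a symmetric family. -/
lemma sum_drSign_symm_eq_zero (s : Finset ι) (B : ι → ι → M)
    (hB : ∀ i ∈ s, ∀ j ∈ s, i ≠ j → B i j = B j i) :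
    ∑ i ∈ s, ∑ j ∈ s.erase i, (drSign s i * drSign (s.erase i) j) • B i j = 0 := by
  rw [Finset.sum_sigma']
  refine Finset.sum_involution (fun x _ => ⟨x.2, x.1⟩) ?_ ?_ ?_ ?_
  · rintro ⟨i, j⟩ h
    simp only [Finset.mem_sigma, Finset.mem_erase] at h
    obtain ⟨hi, hji, hj⟩ := h
    simp only
    rw [hB j hj i hi hji, drSign_antisymm s hi hj (Ne.symm hji), neg_smul, neg_add_cancel]
  · rintro ⟨i, j⟩ h _ he
    simp only [Finset.mem_sigma, Finset.mem_erase] at h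
    simp only [Sigma.mk.injEq, heq_eq_eq] at he
    exact h.2.1 he.1
  · rintro ⟨i, j⟩ h
    simp only [Finset.mem_sigma, Finset.mem_erase] at h ⊢
    exact ⟨h.2.2, Ne.symm h.2.1, h.1⟩
  · rintro ⟨i, j⟩ h
    rfl

lemma totalD_totalD_apply (D D' : ι → M →ₗ[R] M) (ω : Finset ι → M) (s : Finset ι) :
    totalD D (totalD D' ω) s = ∑ i ∈ s, ∑ j ∈ s.erase i,
      (drSign s i * drSign (s.erase i) j) • D i (D' j (ω ((s.erase i).erase j))) := by
  rw [totalD_apply]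
  refine Finset.sum_congr rfl fun i _ => ?_
  rw [totalD_apply, map_sum, Finset.smul_sum]
  refine Finset.sum_congr rfl fun j _ => ?_
  rw [map_zsmul, smul_smul]

lemma totalD_totalD (D : ι → M →ₗ[R] M) (hD : ∀ i j f, D i (D j f) = D j (D i f))
    (ω : Finset ι → M) : totalD D (totalD D ω) = 0 := by
  ext s
  rw [totalD_totalD_apply]
  refine sum_drSign_symm_eq_zero s (fun i j => D i (D j (ω ((s.erase i).erase j)))) ?_
  intro i _ j _ _
  rw [hD, Finset.erase_right_comm]

lemma totalD_anticomm (D D' : ι → M →ₗ[R] M) (hD : ∀ i j f, D i (D' j f) = D' j (D i f))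
    (ω : Finset ι → M) : totalD D (totalD D' ω) = -totalD D' (totalD D ω) := by
  rw [eq_neg_iff_add_eq_zero]
  ext s
  rw [Pi.add_apply, totalD_totalD_apply, totalD_totalD_apply]
  simp only [← Finset.sum_add_distrib, ← smul_add]
  refine sum_drSign_symm_eq_zero s (fun i j => D i (D' j (ω ((s.erase i).erase j))) +
    D' i (D j (ω ((s.erase i).erase j)))) ?_
  intro i _ j _ _
  rw [hD, add_comm, hD j i, Finset.erase_right_comm]

/-- Multiplication of forms by `dz i` on the left. -/
def extMul (i : ι) : (Finset ι → M) →ₗ[R] (Finset ι → M) :=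
  totalD (Pi.single i LinearMap.id)

lemma extMul_apply (i : ι) (ω : Finset ι → M) (s : Finset ι) :
    extMul (R := R) i ω s = if i ∈ s then drSign s i • ω (s.erase i) else 0 := by
  rw [extMul, totalD_apply]
  have h : ∀ j, drSign s j • (Pi.single i LinearMap.id : ι → M →ₗ[R] M) j (ω (s.erase j)) =
      if i = j then drSign s j • ω (s.erase j) else 0 := by
    intro j
    by_cases hj : i = j
    · subst hj; simp
    · rw [Pi.single_eq_of_ne (Ne.symm hj), if_neg hj]; simp
  simp only [h, Finset.sum_ite_eq]

lemma extMul_extMul (i : ι) (ω : Finset ι → M) :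
    extMul (R := R) i (extMul (R := R) i ω) = 0 := by
  refine totalD_totalD _ (fun j k f => ?_) ω
  by_cases hj : j = i
  · by_cases hk : k = i
    · rw [hj, hk]
    · rw [Pi.single_eq_of_ne hk]; simp
  · rw [Pi.single_eq_of_ne hj]; simp

lemma totalD_extMul (D : ι → M →ₗ[R] M) (i : ι) (ω : Finset ι → M) :
    totalD D (extMul (R := R) i ω) = -extMul (R := R) i (totalD D ω) := by
  refine totalD_anticomm D _ (fun j k f => ?_) ω
  by_cases hk : k = i
  · subst hk; simp
  · rw [Pi.single_eq_of_ne hk]; simp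

lemma totalD_compLeft (D : ι → M →ₗ[R] M) (D' : ι → N →ₗ[R] N) (φ : N →ₗ[R] M)
    (h : ∀ i f, D i (φ f) = φ (D' i f)) (ω : Finset ι → N) :
    totalD D (φ.compLeft _ ω) = φ.compLeft _ (totalD D' ω) := by
  ext s
  simp [totalD_apply, h, map_sum]

/-- The defect of commutation of a coefficient map with one of the derivations contributes an
exterior product. -/
lemma totalD_compLeft_add (D : ι → M →ₗ[R] M) (D' : ι → N →ₗ[R] N) (φ ψ : N →ₗ[R] M) (t : ι)
    (h : ∀ i f, D i (φ f) = φ (D' i f) + if i = t then ψ f else 0) (ω : Finset ι → N) :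
    totalD D (φ.compLeft _ ω) = φ.compLeft _ (totalD D' ω) +
      extMul (R := R) t (ψ.compLeft _ ω) := by
  ext s
  rw [Pi.add_apply, extMul_apply]
  simp [totalD_apply, h, map_sum, Finset.sum_add_distrib]

lemma extMul_compLeft (φ : N →ₗ[R] M) (i : ι) (ω : Finset ι → N) :
    extMul (R := R) i (φ.compLeft _ ω) = φ.compLeft _ (extMul (R := R) i ω) := by
  ext s
  simp only [extMul_apply, LinearMap.compLeft_apply, Function.comp_apply]
  split_ifs <;> simp

/-- Closed forms with components in degrees `≥ k` are exact. -/
def ExactFrom (D : ι → M →ₗ[R] M) (k : ℕ) : Prop :=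
  ∀ ω : Finset ι → M, DegreeGE k ω → totalD D ω = 0 → ∃ η, totalD D η = ω

lemma degreePart_totalD (D : ι → M →ₗ[R] M) (k : ℕ) (ω : Finset ι → M) :
    totalD D (degreePart k ω) = degreePart (k + 1) (totalD D ω) := by
  ext s
  simp only [totalD_apply, degreePart]
  by_cases h : s.card = k + 1
  · rw [if_pos h]
    refine Finset.sum_congr rfl fun i hi => ?_
    rw [if_pos (by rw [Finset.card_erase_of_mem hi, h]; rfl)]
  · rw [if_neg h]
    refine Finset.sum_eq_zero fun i hi => ?_
    have := Finset.card_erase_add_one hi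
    rw [if_neg (by omega), map_zero, smul_zero]

lemma degreePart_extMul (k : ℕ) (i : ι) (ω : Finset ι → M) :
    extMul (R := R) i (degreePart k ω) = degreePart (k + 1) (extMul (R := R) i ω) :=
  degreePart_totalD _ k ω

end TotalForms

section Pivot

variable {R : Type*} [CommRing R] {M N : Type*} [AddCommGroup M] [Module R M]
  [AddCommGroup N] [Module R N] {m : ℕ}

lemma drSign_map {ι κ : Type} [LinearOrder ι] [LinearOrder κ] (e : ι ↪ κ) (he : StrictMono e)
    (s : Finset ι) (j : ι) : drSign (s.map e) (e j) = drSign s j := by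
  unfold drSign
  rw [Finset.filter_map, Finset.card_map]
  congr 2
  ext k
  simp [he.lt_iff_lt]

lemma drSign_mul_self {ι : Type} [LinearOrder ι] (s : Finset ι) (i : ι) :
    drSign s i * drSign s i = 1 := by
  unfold drSign
  rw [← mul_pow]
  simp

/-- The part of a form that does not involve `dz i`, as a form in the other variables. -/
def formRes (i : Fin (m + 1)) : (Finset (Fin (m + 1)) → M) →ₗ[R] (Finset (Fin m) → M) where
  toFun ω S := ω (S.map i.succAboveEmb)
  map_add' _ _ := rfl
  map_smul' _ _ := rfl

/-- The form `b` in the other variables for which `dz i * b` is the part of a form that involves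
`dz i`. -/
def formCon (i : Fin (m + 1)) : (Finset (Fin (m + 1)) → M) →ₗ[R] (Finset (Fin m) → M) where
  toFun ω S := drSign (insert i (S.map i.succAboveEmb)) i • ω (insert i (S.map i.succAboveEmb))
  map_add' _ _ := by ext; simp
  map_smul' c _ := by ext; simp [smul_comm c]

/-- The set of variables other than `z i` in `s`. -/
def pivotPreimage (i : Fin (m + 1)) (s : Finset (Fin (m + 1))) : Finset (Fin m) :=
  Finset.univ.filter fun j => i.succAbove j ∈ s

/-- The form `a + dz i * b`. -/
def formMk (i : Fin (m + 1)) (a b : Finset (Fin m) → M) : Finset (Fin (m + 1)) → M := fun s =>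
  if i ∈ s then drSign s i • b (pivotPreimage i s) else a (pivotPreimage i s)

lemma pivot_notMem (i : Fin (m + 1)) (S : Finset (Fin m)) : i ∉ S.map i.succAboveEmb := by
  simp [Fin.succAbove_ne]

lemma pivotPreimage_map (i : Fin (m + 1)) (S : Finset (Fin m)) :
    pivotPreimage i (S.map i.succAboveEmb) = S := by
  ext j
  simp [pivotPreimage]

lemma pivotPreimage_insert_map (i : Fin (m + 1)) (S : Finset (Fin m)) :
    pivotPreimage i (insert i (S.map i.succAboveEmb)) = S := by
  ext j
  simp [pivotPreimage, Fin.succAbove_ne]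

lemma map_pivotPreimage (i : Fin (m + 1)) (s : Finset (Fin (m + 1))) :
    (pivotPreimage i s).map i.succAboveEmb = s.erase i := by
  ext j
  simp only [pivotPreimage, Finset.mem_map, Finset.mem_filter, Finset.mem_univ, true_and,
    Fin.succAboveEmb_apply, Finset.mem_erase]
  constructor
  · rintro ⟨k, hk, rfl⟩
    exact ⟨Fin.succAbove_ne i k, hk⟩
  · rintro ⟨h, hj⟩
    obtain ⟨k, rfl⟩ := Fin.exists_succAbove_eq h
    exact ⟨k, hj, rfl⟩

lemma formRes_formMk (i : Fin (m + 1)) (a b : Finset (Fin m) → M) :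
    formRes (R := R) i (formMk i a b) = a := by
  ext S
  change formMk i a b (S.map i.succAboveEmb) = _
  rw [formMk, if_neg (pivot_notMem i S), pivotPreimage_map]

lemma formCon_formMk (i : Fin (m + 1)) (a b : Finset (Fin m) → M) :
    formCon (R := R) i (formMk i a b) = b := by
  ext S
  change drSign _ i • formMk i a b (insert i (S.map i.succAboveEmb)) = _
  rw [formMk, if_pos (Finset.mem_insert_self _ _), pivotPreimage_insert_map, smul_smul,
    drSign_mul_self, one_smul]

variable (R) in
lemma formMk_res_con (i : Fin (m + 1)) (ω : Finset (Fin (m + 1)) → M) :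
    formMk i (formRes (R := R) i ω) (formCon (R := R) i ω) = ω := by
  ext s
  rw [formMk]
  change (if i ∈ s then drSign s i • drSign (insert i ((pivotPreimage i s).map _)) i •
    ω (insert i ((pivotPreimage i s).map i.succAboveEmb)) else
      ω ((pivotPreimage i s).map i.succAboveEmb)) = _
  rw [map_pivotPreimage]
  split_ifs with h
  · rw [Finset.insert_erase h, smul_smul, drSign_mul_self, one_smul]
  · rw [Finset.erase_eq_of_notMem h]

variable (R) in
lemma form_ext_pivot (i : Fin (m + 1)) {ω η : Finset (Fin (m + 1)) → M}
    (h : formRes (R := R) i ω = formRes (R := R) i η)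
    (h' : formCon (R := R) i ω = formCon (R := R) i η) : ω = η := by
  rw [← formMk_res_con R i ω, h, h', formMk_res_con]

lemma formRes_totalD (i : Fin (m + 1)) (D : Fin (m + 1) → M →ₗ[R] M)
    (ω : Finset (Fin (m + 1)) → M) :
    formRes (R := R) i (totalD D ω) =
      totalD (fun j => D (i.succAbove j)) (formRes (R := R) i ω) := by
  ext S
  change totalD D ω (S.map i.succAboveEmb) = _
  rw [totalD_apply, totalD_apply, Finset.sum_map]
  refine Finset.sum_congr rfl fun j _ => ?_
  rw [drSign_map i.succAboveEmb (Fin.strictMono_succAbove i), ← Finset.map_erase]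
  rfl

lemma formCon_totalD (i : Fin (m + 1)) (D : Fin (m + 1) → M →ₗ[R] M)
    (ω : Finset (Fin (m + 1)) → M) :
    formCon (R := R) i (totalD D ω) = (D i).compLeft _ (formRes (R := R) i ω) -
      totalD (fun j => D (i.succAbove j)) (formCon (R := R) i ω) := by
  ext S
  set T := insert i (S.map i.succAboveEmb) with hT
  have hiT : i ∈ T := Finset.mem_insert_self _ _
  have hTi : T.erase i = S.map i.succAboveEmb := Finset.erase_insert (pivot_notMem i S)
  change drSign T i • totalD D ω T = D i (ω (S.map i.succAboveEmb)) - _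
  rw [totalD_apply, hT, Finset.sum_insert (pivot_notMem i S), ← hT, hTi, smul_add, smul_smul,
    drSign_mul_self, one_smul, sub_eq_add_neg]
  congr 1
  rw [totalD_apply, Finset.sum_map, Finset.smul_sum, ← Finset.sum_neg_distrib]
  refine Finset.sum_congr rfl fun j hj => ?_
  set k := i.succAboveEmb j with hk
  have hki : k ≠ i := Fin.succAbove_ne i j
  have hkT : k ∈ T := Finset.mem_insert_of_mem (Finset.mem_map_of_mem _ hj)
  have hTk : insert i ((S.erase j).map i.succAboveEmb) = T.erase k := by
    rw [Finset.map_erase, hT, Finset.erase_insert_of_ne (Ne.symm hki)]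
  change _ = -(drSign S j • D k (drSign (insert i ((S.erase j).map i.succAboveEmb)) i •
    ω (insert i ((S.erase j).map i.succAboveEmb))))
  rw [hTk, map_zsmul, smul_smul, smul_smul, ← neg_smul]
  congr 1
  have h1 := drSign_antisymm T hiT hkT (Ne.symm hki)
  rw [hTi, hk, drSign_map i.succAboveEmb (Fin.strictMono_succAbove i), ← hk] at h1
  have h2 := drSign_mul_self T k
  have h3 := drSign_mul_self S j
  linear_combination (drSign T k * drSign S j) * h1 - drSign T i * drSign T k * h3
    - drSign S j * drSign (T.erase k) i * h2

lemma totalD_formMk (i : Fin (m + 1)) (D : Fin (m + 1) → M →ₗ[R] M) (a b : Finset (Fin m) → M) :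
    totalD D (formMk i a b) = formMk i (totalD (fun j => D (i.succAbove j)) a)
      ((D i).compLeft _ a - totalD (fun j => D (i.succAbove j)) b) := by
  refine form_ext_pivot R i ?_ ?_
  · rw [formRes_totalD, formRes_formMk, formRes_formMk]
  · rw [formCon_totalD, formRes_formMk, formCon_formMk, formCon_formMk]

lemma formMk_inj (i : Fin (m + 1)) {a b a' b' : Finset (Fin m) → M}
    (h : formMk i a b = formMk i a' b') : a = a' ∧ b = b' := by
  have h1 := congrArg (formRes (R := ℤ) i) h
  have h2 := congrArg (formCon (R := ℤ) i) h
  rw [formRes_formMk, formRes_formMk] at h1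
  rw [formCon_formMk, formCon_formMk] at h2
  exact ⟨h1, h2⟩

lemma formMk_zero (i : Fin (m + 1)) : formMk i (0 : Finset (Fin m) → M) 0 = 0 := by
  ext s
  simp [formMk]

lemma formMk_add (i : Fin (m + 1)) (a b a' b' : Finset (Fin m) → M) :
    formMk i (a + a') (b + b') = formMk i a b + formMk i a' b' := by
  ext s
  simp only [formMk, Pi.add_apply]
  split_ifs <;> simp

lemma formMk_smul (i : Fin (m + 1)) (c : R) (a b : Finset (Fin m) → M) :
    formMk i (c • a) (c • b) = c • formMk i a b := by
  ext s
  simp only [formMk, Pi.smul_apply]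
  split_ifs <;> simp [smul_comm c]

lemma formMk_compLeft (i : Fin (m + 1)) (φ : M →ₗ[R] N) (a b : Finset (Fin m) → M) :
    φ.compLeft _ (formMk i a b) = formMk i (φ.compLeft _ a) (φ.compLeft _ b) := by
  ext s
  simp only [formMk, LinearMap.compLeft_apply, Function.comp_apply]
  split_ifs <;> simp

lemma DegreeGE.formRes {k : ℕ} {i : Fin (m + 1)} {ω : Finset (Fin (m + 1)) → M}
    (h : DegreeGE k ω) : DegreeGE k (formRes (R := R) i ω) := by
  intro S hS
  exact h _ (by rwa [Finset.card_map])

lemma DegreeGE.formCon {k : ℕ} {i : Fin (m + 1)} {ω : Finset (Fin (m + 1)) → M}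
    (h : DegreeGE (k + 1) ω) : DegreeGE k (formCon (R := R) i ω) := by
  intro S hS
  have : ω (insert i (S.map i.succAboveEmb)) = 0 := h _ (by
    rw [Finset.card_insert_of_notMem (pivot_notMem i S), Finset.card_map]; omega)
  change drSign _ i • ω (insert i (S.map i.succAboveEmb)) = 0
  rw [this, smul_zero]

lemma card_pivotPreimage (i : Fin (m + 1)) (s : Finset (Fin (m + 1))) :
    (pivotPreimage i s).card = (s.erase i).card := by
  rw [← map_pivotPreimage, Finset.card_map]

lemma degreePart_formMk (i : Fin (m + 1)) (k : ℕ) (a b : Finset (Fin m) → M) :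
    formMk i (degreePart (k + 1) a) (degreePart k b) = degreePart (k + 1) (formMk i a b) := by
  ext s
  simp only [formMk, degreePart, card_pivotPreimage]
  by_cases h : i ∈ s
  · have := Finset.card_erase_add_one h
    simp only [h, if_true]
    by_cases h' : s.card = k + 1
    · rw [if_pos h', if_pos (by omega)]
    · rw [if_neg h', if_neg (by omega), smul_zero]
  · simp only [h, if_false, Finset.erase_eq_of_notMem h]

/-- Elimination of a variable whose derivation is injective: the de Rham complex is that of the
cokernel in the other variables, shifted by one. -/
lemma ExactFrom.of_injective (i : Fin (m + 1)) (D : Fin (m + 1) → M →ₗ[R] M)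
    (hD : ∀ j k f, D j (D k f) = D k (D j f)) (hinj : Function.Injective (D i))
    (π : M →ₗ[R] N) (hπ : Function.Surjective π) (hker : ∀ f, π f = 0 → ∃ g, D i g = f)
    (hπD : ∀ g, π (D i g) = 0) (D' : Fin m → N →ₗ[R] N)
    (hD' : ∀ j f, D' j (π f) = π (D (i.succAbove j) f)) {k : ℕ} (h : ExactFrom D' k) :
    ExactFrom D (k + 1) := by
  intro ω hω hdω
  set a := formRes (R := R) i ω with ha
  set b := formCon (R := R) i ω with hb
  set d := totalD (R := R) (M := M) (fun j => D (i.succAbove j)) with hd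
  have h1 : d a = 0 := by rw [hd, ha, ← formRes_totalD, hdω, map_zero]
  have h2 : (D i).compLeft _ a = d b := by
    rw [← sub_eq_zero, hd, ha, hb, ← formCon_totalD, hdω, map_zero]
  have h3 : totalD D' (π.compLeft _ b) = 0 := by
    rw [totalD_compLeft D' _ π hD', ← hd, ← h2]
    ext S
    simp [hπD]
  obtain ⟨c', hc'⟩ := h _ (hω.formCon.compLeft π) h3
  choose lift hlift using hπ
  set c : Finset (Fin m) → M := fun S => lift (c' S) with hc
  have h4 : π.compLeft _ c = c' := by ext S; simp [hc, hlift]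
  have h5 : ∀ S, ∃ g, D i g = (b - d c) S := by
    intro S
    refine hker _ ?_
    have : π.compLeft _ (b - d c) = 0 := by
      rw [map_sub, hd, ← totalD_compLeft D' _ π hD', h4, hc', sub_self]
    exact congrFun this S
  choose e he using h5
  have he' : (D i).compLeft _ e = b - d c := by ext S; exact he S
  have h6 : d e = a := by
    have : (D i).compLeft _ (d e) = (D i).compLeft _ a := by
      rw [hd, ← totalD_compLeft _ _ (D i) (fun j f => hD _ _ f), he', map_sub,
        totalD_totalD _ (fun j k f => hD _ _ f), sub_zero, ← hd, h2]
    ext S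
    exact hinj (congrFun this S)
  refine ⟨formMk i e (-c), ?_⟩
  rw [totalD_formMk, ← hd, h6, he', map_neg, sub_neg_eq_add, sub_add_cancel, ha, hb,
    formMk_res_con]

/-- Elimination of a variable whose derivation is surjective: the de Rham complex is that of the
kernel in the other variables. -/
lemma ExactFrom.of_surjective (i : Fin (m + 1)) (D : Fin (m + 1) → M →ₗ[R] M)
    (hD : ∀ j k f, D j (D k f) = D k (D j f)) (hsurj : Function.Surjective (D i))
    (c : N →ₗ[R] M) (hc : Function.Injective c) (hker : ∀ f, D i f = 0 → ∃ g, c g = f)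
    (D' : Fin m → N →ₗ[R] N)
    (hD' : ∀ j f, D (i.succAbove j) (c f) = c (D' j f)) (hDc : ∀ g, D i (c g) = 0)
    {k : ℕ} (h : ExactFrom D' (k + 1)) : ExactFrom D (k + 1) := by
  intro ω hω hdω
  have hb0 : DegreeGE k (formCon (R := R) i ω) := hω.formCon
  choose I hI using hsurj
  classical
  set e : Finset (Fin m) → M := fun S => if S.card < k then 0 else I (formCon (R := R) i ω S)
    with he
  have he0 : DegreeGE k e := fun S hS => by simp [he, hS]
  have he1 : (D i).compLeft _ e = formCon (R := R) i ω := by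
    ext S
    by_cases hS : S.card < k
    · simp [he, hS, hb0 S hS]
    · simp [he, hS, hI]
  set η := ω - totalD D (formMk i e 0) with hη
  have hη1 : totalD D η = 0 := by
    rw [hη, map_sub, hdω, totalD_totalD D hD, sub_zero]
  have hη2 : formCon (R := R) i η = 0 := by
    rw [hη, map_sub, formCon_totalD, formRes_formMk, formCon_formMk, he1, map_zero, sub_zero,
      sub_self]
  set a := formRes (R := R) i η with ha
  have ha1 : (D i).compLeft _ a = 0 := by
    have := formCon_totalD i D η
    rw [hη1, hη2, map_zero, map_zero, sub_zero] at this
    exact this.symm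
  have ha2 : DegreeGE (k + 1) a := by
    rw [ha, hη, map_sub, formRes_totalD, formRes_formMk]
    refine hω.formRes.sub ?_
    intro S hS
    rw [totalD_apply]
    refine Finset.sum_eq_zero fun j hj => ?_
    rw [he0 _ (by rw [Finset.card_erase_of_mem hj]; have := Finset.card_pos.mpr ⟨j, hj⟩; omega),
      map_zero, smul_zero]
  choose g hg using fun S => hker (a S) (congrFun ha1 S)
  have hg' : c.compLeft _ g = a := by ext S; exact hg S
  have hcinj : Function.Injective (c.compLeft (Finset (Fin m))) := by
    intro u v huv
    ext S
    exact hc (congrFun huv S)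
  obtain ⟨θ, hθ⟩ := h g (fun S hS => hc (by rw [hg, ha2 S hS, map_zero])) (by
    refine hcinj ?_
    rw [← totalD_compLeft (fun j => D (i.succAbove j)) D' c hD', hg', map_zero, ha,
      ← formRes_totalD, hη1, map_zero])
  refine ⟨formMk i e 0 + formMk i (c.compLeft _ θ) 0, ?_⟩
  rw [map_add, totalD_formMk i D (c.compLeft _ θ), totalD_compLeft _ D' c hD', hθ, hg', map_zero,
    sub_zero]
  have h7 : (D i).compLeft _ (c.compLeft (Finset (Fin m)) θ) = 0 := by
    ext S
    simp [hDc]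
  have h8 := formMk_res_con R i η
  rw [hη2, ← ha] at h8
  rw [h7, h8, hη, add_sub_cancel]

end Pivot

/-! ### The suspension isomorphism in terms of operators -/

section Suspension

/-- The operators from which the suspension isomorphism is deduced. The modules `A`, `S` and `M`
stand for the forms in `z, t` with coefficients in the functions of `(z, t)`, `(z, s, t)` and
`(z, x, y, t)`; the differentials `dA`, `dS` and `dM` are those in the directions `z, t`, for the
potentials `ϖ t P`, `ϖ t (P + s)` and `ϖ t (P + x y)`. The remaining directions are kept as the
commuting operators `Ds`, `Dx`, `Dy`, so that the forms in `z, s, t` are the pairs `a + ds b`, and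
the forms in `z, x, y, t` are the quadruples `a₀ + dy a₁ + dx b₀ + dx dy b₁`. -/
structure SuspensionData (K A S M : Type*) [Field K] [AddCommGroup A] [Module K A]
    [AddCommGroup S] [Module K S] [AddCommGroup M] [Module K M] where
  /-- the scalar in the potentials -/
  ϖ : K
  /-- the differential for `ϖ t P` -/
  dA : A →ₗ[K] A
  /-- multiplication by `dt` -/
  eA : A →ₗ[K] A
  /-- multiplication by `t` -/
  tA : A →ₗ[K] A
  dA_eA : ∀ a, dA (eA a) = -eA (dA a)
  eA_eA : ∀ a, eA (eA a) = 0
  dA_tA : ∀ a, dA (tA a) = tA (dA a) + eA a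
  eA_tA : ∀ a, eA (tA a) = tA (eA a)
  /-- the differential for `ϖ t (P + s)` in the directions `z, t` -/
  dS : S →ₗ[K] S
  /-- the twisted derivation in the direction `s` -/
  Ds : S →ₗ[K] S
  /-- multiplication by `s` -/
  Xs : S →ₗ[K] S
  /-- inclusion of the functions that do not depend on `s` -/
  c : A →ₗ[K] S
  /-- evaluation at `s = 0` -/
  ev : S →ₗ[K] A
  /-- the quotient in the division by `s` -/
  sh : S →ₗ[K] S
  dS_c : ∀ a, dS (c a) = c (dA a) + ϖ • Xs (c (eA a))
  Ds_c : ∀ a, Ds (c a) = ϖ • c (tA a)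
  dS_Xs : ∀ f, dS (Xs f) = Xs (dS f)
  Xs_inj : Function.Injective Xs
  ev_c : ∀ a, ev (c a) = a
  ev_Xs : ∀ f, ev (Xs f) = 0
  ev_dS : ∀ f, ev (dS f) = dA (ev f)
  c_ev_add : ∀ f, c (ev f) + Xs (sh f) = f
  /-- the differential for `ϖ t (P + x y)` in the directions `z, t` -/
  dM : M →ₗ[K] M
  /-- the twisted derivation in the direction `x` -/
  Dx : M →ₗ[K] M
  /-- the twisted derivation in the direction `y` -/
  Dy : M →ₗ[K] M
  /-- multiplication by `x` -/
  X : M →ₗ[K] M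
  /-- multiplication by `y` -/
  Y : M →ₗ[K] M
  /-- the substitution `s = x y` -/
  j : S →ₗ[K] M
  dM_dM : ∀ f, dM (dM f) = 0
  dM_Dx : ∀ f, dM (Dx f) = Dx (dM f)
  dM_Dy : ∀ f, dM (Dy f) = Dy (dM f)
  Dx_Dy : ∀ f, Dx (Dy f) = Dy (Dx f)
  dM_X : ∀ f, dM (X f) = X (dM f)
  dM_Y : ∀ f, dM (Y f) = Y (dM f)
  Dx_X : ∀ f, Dx (X f) = X (Dx f) + f
  Dy_Y : ∀ f, Dy (Y f) = Y (Dy f) + f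
  Dx_Y : ∀ f, Dx (Y f) = Y (Dx f)
  Dy_X : ∀ f, Dy (X f) = X (Dy f)
  X_Y : ∀ f, X (Y f) = Y (X f)
  X_inj : Function.Injective X
  Y_inj : Function.Injective Y
  j_inj : Function.Injective j
  dM_j : ∀ f, dM (j f) = j (dS f)
  Dx_j : ∀ f, Dx (j f) = Y (j (Ds f))
  Dy_j : ∀ f, Dy (j f) = X (j (Ds f))
  j_Xs : ∀ f, j (Xs f) = X (Y (j f))
  Dx_X_j : ∀ f, Dx (X (j f)) = j (Ds (Xs f))
  /-- the inverse of the Euler operator `x ∂_x - y ∂_y` on functions of nonzero weight -/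
  Gz : M →ₗ[K] M
  /-- the inverse of `x ∂_x - y ∂_y - 1` -/
  Gm : M →ₗ[K] M
  /-- the inverse of `x ∂_x - y ∂_y + 1` -/
  Gp : M →ₗ[K] M
  /-- the part of weight `0`, as a function of `s = x y` -/
  q : M →ₗ[K] S
  /-- the part of weight `1`, divided by `x` -/
  qp : M →ₗ[K] S
  /-- the part of weight `-1`, divided by `y` -/
  qm : M →ₗ[K] S
  Gz_spec : ∀ f, f - j (q f) = X (Dx (Gz f)) - Y (Dy (Gz f))
  Gm_spec : ∀ f, f - X (j (qp f)) = X (Dx (Gm f)) - Dy (Y (Gm f))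
  Gp_spec : ∀ f, f - Y (j (qm f)) = Dx (X (Gp f)) - Y (Dy (Gp f))
  dM_Gz : ∀ f, dM (Gz f) = Gz (dM f)
  dM_Gm : ∀ f, dM (Gm f) = Gm (dM f)
  dM_Gp : ∀ f, dM (Gp f) = Gp (dM f)
  Dy_Gz : ∀ f, Dy (Gz f) = Gm (Dy f)
  Dx_Gz : ∀ f, Dx (Gz f) = Gp (Dx f)
  Dx_Gm : ∀ f, Dx (Gm f) = Gz (Dx f)
  Dy_Gp : ∀ f, Dy (Gp f) = Gz (Dy f)
  q_j : ∀ f, q (j f) = f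
  qp_X_j : ∀ f, qp (X (j f)) = f

namespace SuspensionData

variable {K A S M : Type*} [Field K] [AddCommGroup A] [Module K A]
    [AddCommGroup S] [Module K S] [AddCommGroup M] [Module K M] (T : SuspensionData K A S M)

/-- Closed forms `a₀ + dy a₁ + dx b₀ + dx dy b₁`. -/
def Closed (a₀ a₁ b₀ b₁ : M) : Prop :=
  T.dM a₀ = 0 ∧ T.Dy a₀ = T.dM a₁ ∧ T.Dx a₀ = T.dM b₀ ∧ T.Dx a₁ - T.Dy b₀ + T.dM b₁ = 0

/-- The form `a₀ + dy a₁ + dx b₀ + dx dy b₁` is the differential of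
`u₀ + dy u₁ + dx v₀ + dx dy v₁`. -/
def IsD (u₀ u₁ v₀ v₁ a₀ a₁ b₀ b₁ : M) : Prop :=
  T.dM u₀ = a₀ ∧ T.Dy u₀ - T.dM u₁ = a₁ ∧ T.Dx u₀ - T.dM v₀ = b₀ ∧
    T.Dx u₁ - (T.Dy v₀ - T.dM v₁) = b₁

/-- The coefficient of `dy` in `d(x t) dy a`. -/
def phiY : A →ₗ[K] M := -(T.X ∘ₗ T.j ∘ₗ T.c ∘ₗ T.eA)

/-- The coefficient of `dx dy` in `d(x t) dy a`. -/
def phiXY : A →ₗ[K] M := T.j ∘ₗ T.c ∘ₗ T.tA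

lemma phiY_apply (a : A) : T.phiY a = -T.X (T.j (T.c (T.eA a))) := rfl

lemma phiXY_apply (a : A) : T.phiXY a = T.j (T.c (T.tA a)) := rfl

/-- The differential commutes with the inclusion of the functions of `(z, t)` up to the
contribution `ϖ x y dt` of the potential. -/
lemma dM_incl (a : A) : T.dM (T.j (T.c a)) = T.j (T.c (T.dA a)) +
    T.ϖ • T.X (T.Y (T.j (T.c (T.eA a)))) := by
  rw [T.dM_j, T.dS_c, map_add, map_smul, T.j_Xs]

lemma dM_phiY (a : A) : -T.dM (T.phiY a) = T.phiY (T.dA a) := by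
  rw [phiY_apply, phiY_apply, map_neg, T.dM_X, T.dM_incl, T.dA_eA, T.eA_eA]
  simp

lemma phi_commutes (a : A) :
    T.Dx (T.phiY a) + T.dM (T.phiXY a) = T.phiXY (T.dA a) := by
  rw [phiY_apply, phiXY_apply, phiXY_apply, map_neg, T.Dx_X, T.dM_incl, T.Dx_j, T.Ds_c, T.dA_tA,
    T.eA_tA]
  simp only [map_add, map_smul]
  abel

/-- A closed form is cohomologous to its part of weight zero for the vector field
`x ∂_x - y ∂_y`: contraction with this field is a homotopy. -/
lemma exists_homotopy_weight_zero {a₀ a₁ b₀ b₁ : M} (h : T.Closed a₀ a₁ b₀ b₁) :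
    ∃ u₀ u₁ v₀ v₁, T.IsD u₀ u₁ v₀ v₁ (a₀ - T.j (T.q a₀)) (a₁ - T.X (T.j (T.qp a₁)))
      (b₀ - T.Y (T.j (T.qm b₀))) (b₁ - T.j (T.q b₁)) := by
  obtain ⟨h1, h2, h3, h4⟩ := h
  -- the contraction of the form with `x ∂_x - y ∂_y`, divided by the weights
  refine ⟨T.X (T.Gp b₀) - T.Y (T.Gm a₁), T.X (T.Gz b₁), T.Y (T.Gz b₁), 0, ?_, ?_, ?_, ?_⟩
  · rw [T.Gz_spec, map_sub, T.dM_X, T.dM_Y, T.dM_Gp, T.dM_Gm, ← h2, ← h3, T.Dx_Gz, T.Dy_Gz]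
  · have h5 : T.dM (T.Gz b₁) = T.Dy (T.Gp b₀) - T.Dx (T.Gm a₁) := by
      rw [T.dM_Gz, T.Dy_Gp, T.Dx_Gm, ← map_sub]
      congr 1
      rw [← sub_eq_zero, ← h4]
      abel
    rw [T.Gm_spec, map_sub, T.dM_X, h5, map_sub, T.Dy_X]
    abel
  · have h5 : T.dM (T.Gz b₁) = T.Dy (T.Gp b₀) - T.Dx (T.Gm a₁) := by
      rw [T.dM_Gz, T.Dy_Gp, T.Dx_Gm, ← map_sub]
      congr 1
      rw [← sub_eq_zero, ← h4]
      abel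
    rw [T.Gp_spec, map_sub, T.dM_Y, h5, map_sub, T.Dx_Y]
    abel
  · rw [T.Gz_spec, map_zero, sub_zero, T.Dx_X, T.Dy_Y]
    abel

lemma Dy_Y_j (f : S) : T.Dy (T.Y (T.j f)) = T.j (T.Ds (T.Xs f)) := by
  rw [← T.Dx_X_j, T.Dx_X, T.Dy_Y, T.Dx_j, T.Dy_j, T.X_Y]

/-- The differential of a form of weight zero, in terms of functions of `s = x y`. -/
lemma isD_weight_zero (u w v y : S) : T.IsD (T.j u) (T.X (T.j w)) (T.Y (T.j v)) (T.j y)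
    (T.j (T.dS u)) (T.X (T.j (T.Ds u - T.dS w))) (T.Y (T.j (T.Ds u - T.dS v)))
    (T.j (T.Ds (T.Xs (w - v)) + T.dS y)) := by
  refine ⟨T.dM_j u, ?_, ?_, ?_⟩
  · rw [T.Dy_j, T.dM_X, T.dM_j, map_sub, map_sub]
  · rw [T.Dx_j, T.dM_Y, T.dM_j, map_sub, map_sub]
  · rw [T.Dx_X_j, T.Dy_Y_j, T.dM_j, map_sub, map_sub, map_add, map_sub]
    abel

lemma closed_weight_zero {α₀ α₁ β₀ β₁ : S}
    (h : T.Closed (T.j α₀) (T.X (T.j α₁)) (T.Y (T.j β₀)) (T.j β₁)) :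
    T.dS α₀ = 0 ∧ T.Ds α₀ = T.dS α₁ ∧ T.Ds α₀ = T.dS β₀ ∧
      T.Ds (T.Xs (α₁ - β₀)) + T.dS β₁ = 0 := by
  obtain ⟨h1, h2, h3, h4⟩ := h
  obtain ⟨g1, g2, g3, g4⟩ := T.isD_weight_zero α₀ α₁ β₀ β₁
  refine ⟨T.j_inj ?_, T.j_inj (T.X_inj ?_), T.j_inj (T.Y_inj ?_), T.j_inj ?_⟩
  · rw [← g1, h1, map_zero]
  · rw [← sub_eq_zero, ← map_sub, ← map_sub, ← g2, h2, sub_self]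
  · rw [← sub_eq_zero, ← map_sub, ← map_sub, ← g3, h3, sub_self]
  · rw [← g4, map_zero, ← h4]
    abel

lemma IsD.closed {u₀ u₁ v₀ v₁ a₀ a₁ b₀ b₁ : M} (h : T.IsD u₀ u₁ v₀ v₁ a₀ a₁ b₀ b₁) :
    T.Closed a₀ a₁ b₀ b₁ := by
  obtain ⟨rfl, rfl, rfl, rfl⟩ := h
  refine ⟨T.dM_dM _, ?_, ?_, ?_⟩
  · rw [map_sub, T.dM_dM, T.dM_Dy, sub_zero]
  · rw [map_sub, T.dM_dM, T.dM_Dx, sub_zero]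
  · simp only [map_sub, T.dM_dM, T.dM_Dx, T.dM_Dy, T.Dx_Dy]
    abel

/-- Every closed form in `z, x, y, t` of sufficiently high degree is cohomologous to
`d(x t) dy a` for some closed form `a` in `z, t`. The hypothesis `hV` is the acyclicity, in high
degrees, of the forms in `z, s, t`. -/
lemma exists_phi_of_closed (G₃ G₂ : Submodule K S)
    (hV : ∀ a b, a ∈ G₃ → b ∈ G₂ → T.dS a = 0 → T.Ds a = T.dS b →
      ∃ u v, T.dS u = a ∧ T.Ds u - T.dS v = b)
    {a₀ a₁ b₀ b₁ : M} (h : T.Closed a₀ a₁ b₀ b₁) (ha₀ : T.q a₀ ∈ G₃) (hb₀ : T.qm b₀ ∈ G₂)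
    (hγ : T.Xs (T.qp a₁ - T.qm b₀) ∈ G₃) (hb₁ : T.q b₁ ∈ G₂) :
    ∃ ω u₀ u₁ v₀ v₁, T.dA ω = 0 ∧
      T.IsD u₀ u₁ v₀ v₁ a₀ (a₁ - T.phiY ω) b₀ (b₁ - T.phiXY ω) := by
  obtain ⟨u₀', u₁', v₀', v₁', h1⟩ := T.exists_homotopy_weight_zero h
  set α₀ := T.q a₀
  set α₁ := T.qp a₁
  set β₀ := T.qm b₀
  set β₁ := T.q b₁
  have hcl : T.Closed (T.j α₀) (T.X (T.j α₁)) (T.Y (T.j β₀)) (T.j β₁) := by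
    obtain ⟨g1, g2, g3, g4⟩ := h1.closed
    obtain ⟨h1, h2, h3, h4⟩ := h
    simp only [map_sub] at g1 g2 g3 g4
    refine ⟨?_, ?_, ?_, ?_⟩
    · simpa [h1] using g1
    · simpa [h2] using g2
    · simpa [h3] using g3
    · have : T.Dx (T.X (T.j α₁)) - T.Dy (T.Y (T.j β₀)) + T.dM (T.j β₁) =
          (T.Dx a₁ - T.Dy b₀ + T.dM b₁) - (T.Dx a₁ - T.Dx (T.X (T.j α₁)) -
            (T.Dy b₀ - T.Dy (T.Y (T.j β₀))) + (T.dM b₁ - T.dM (T.j β₁))) := by abel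
      rw [this, h4, g4, sub_zero]
  obtain ⟨c1, c2, c3, c4⟩ := T.closed_weight_zero hcl
  -- the form of weight zero is the pullback of `α₀ + ds β₀` along `s = x y` plus a remainder, in
  -- which the difference of the coefficients of `dy` and `dx` is carried by `dy` and `dx dy` alone
  obtain ⟨u, v, huv1, huv2⟩ := hV α₀ β₀ ha₀ hb₀ c1 c3
  obtain ⟨u', v', huv1', huv2'⟩ := hV (T.Xs (α₁ - β₀)) (-β₁) hγ (G₂.neg_mem hb₁)
    (by rw [T.dS_Xs, map_sub, ← c2, ← c3, sub_self, map_zero])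
    (by rw [map_neg, ← sub_eq_zero, sub_neg_eq_add, c4])
  -- `u' = ω + s r` with `ω` its value at `s = 0`: `ω` yields the suspension, `r` a correction of the
  -- primitive
  set ω := T.ev u'
  set r := T.sh u'
  have hu' : T.c ω + T.Xs r = u' := T.c_ev_add u'
  have hω : T.dA ω = 0 := by rw [← T.ev_dS, huv1', T.ev_Xs]
  have e1 : α₁ - β₀ = T.ϖ • T.c (T.eA ω) + T.dS r := by
    refine T.Xs_inj ?_
    rw [← huv1', ← hu', map_add, T.dS_c, hω, map_zero, zero_add, T.dS_Xs, map_add, map_smul]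
  have e2 : β₁ = -(T.ϖ • T.c (T.tA ω)) - T.Ds (T.Xs r) + T.dS v' := by
    rw [← neg_inj, ← huv2', ← hu', map_add, T.Ds_c]
    abel
  obtain ⟨w0, w1, w2, w3⟩ := T.isD_weight_zero u (v - r) v v'
  refine ⟨-(T.ϖ • ω), u₀' + T.j u, u₁' + T.X (T.j (v - r)), v₀' + T.Y (T.j v), v₁' + T.j v',
    by rw [map_neg, map_smul, hω, smul_zero, neg_zero], ?_⟩
  obtain ⟨k0, k1, k2, k3⟩ := h1
  refine ⟨?_, ?_, ?_, ?_⟩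
  · rw [map_add, k0, w0, huv1]
    abel
  · have e3 : α₁ = β₀ + (T.ϖ • T.c (T.eA ω) + T.dS r) := by rw [← e1]; abel
    have e4 : T.Ds u - T.dS (v - r) = α₁ - T.ϖ • T.c (T.eA ω) := by
      rw [e3, map_sub, ← huv2]; abel
    rw [map_add, map_add, add_sub_add_comm, k1, w1, e4, phiY_apply]
    simp only [map_sub, map_smul, map_neg]
    abel
  · rw [map_add, map_add, add_sub_add_comm, k2, w2, huv2]
    abel
  · have e4 : T.Ds (T.Xs (v - r - v)) + T.dS v' = β₁ + T.ϖ • T.c (T.tA ω) := by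
      rw [e2, sub_sub_cancel_left, map_neg, map_neg]; abel
    rw [e4] at w3
    have : T.Dx (u₁' + T.X (T.j (v - r))) - (T.Dy (v₀' + T.Y (T.j v)) - T.dM (v₁' + T.j v')) =
        (T.Dx u₁' - (T.Dy v₀' - T.dM v₁')) +
        (T.Dx (T.X (T.j (v - r))) - (T.Dy (T.Y (T.j v)) - T.dM (T.j v'))) := by
      simp only [map_add]
      abel
    rw [this, k3, w3, phiXY_apply]
    simp only [map_add, map_smul, map_neg]
    abel

lemma q_dM (f : M) : T.q (T.dM f) = T.dS (T.q f) := by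
  refine T.j_inj ?_
  have h := congrArg T.dM (T.Gz_spec f)
  have h' := T.Gz_spec (T.dM f)
  rw [map_sub, map_sub, T.dM_X, T.dM_Dx, T.dM_Y, T.dM_Dy, T.dM_Gz, ← h', T.dM_j] at h
  exact (sub_right_injective h).symm

lemma qp_dM (f : M) : T.qp (T.dM f) = T.dS (T.qp f) := by
  refine T.j_inj (T.X_inj ?_)
  have h := congrArg T.dM (T.Gm_spec f)
  have h' := T.Gm_spec (T.dM f)
  rw [map_sub, map_sub, T.dM_X, T.dM_X, T.dM_Dx, T.dM_Dy, T.dM_Y, T.dM_Gm, ← h', T.dM_j] at h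
  exact (sub_right_injective h).symm

lemma qm_dM (f : M) : T.qm (T.dM f) = T.dS (T.qm f) := by
  refine T.j_inj (T.Y_inj ?_)
  have h := congrArg T.dM (T.Gp_spec f)
  have h' := T.Gp_spec (T.dM f)
  rw [map_sub, map_sub, T.dM_Dx, T.dM_X, T.dM_Y, T.dM_Y, T.dM_Dy, T.dM_Gp, ← h', T.dM_j] at h
  exact (sub_right_injective h).symm

lemma qp_Dy (f : M) : T.qp (T.Dy f) = T.Ds (T.q f) := by
  refine T.j_inj (T.X_inj ?_)
  have h := congrArg T.Dy (T.Gz_spec f)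
  have h' := T.Gm_spec (T.Dy f)
  rw [← T.Dy_Gz, T.Dx_Dy] at h'
  rw [map_sub, map_sub, T.Dy_X, ← h', T.Dy_j] at h
  exact (sub_right_injective h).symm

lemma qm_Dx (f : M) : T.qm (T.Dx f) = T.Ds (T.q f) := by
  refine T.j_inj (T.Y_inj ?_)
  have h := congrArg T.Dx (T.Gz_spec f)
  have h' := T.Gp_spec (T.Dx f)
  rw [← T.Dx_Gz, ← T.Dx_Dy] at h'
  rw [map_sub, map_sub, T.Dx_Y, ← h', T.Dx_j] at h
  exact (sub_right_injective h).symm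

lemma q_Dx (f : M) : T.q (T.Dx f) = T.Ds (T.Xs (T.qp f)) := by
  refine T.j_inj ?_
  have h := congrArg T.Dx (T.Gm_spec f)
  have h' : T.Dx f - T.j (T.q (T.Dx f)) = _ := T.Gz_spec (T.Dx f)
  rw [← T.Dx_Gm] at h'
  have e : T.Dx (T.X (T.Dx (T.Gm f))) - T.Dx (T.Dy (T.Y (T.Gm f))) =
      T.X (T.Dx (T.Dx (T.Gm f))) - T.Y (T.Dy (T.Dx (T.Gm f))) := by
    rw [T.Dx_X, T.Dy_Y, map_add, T.Dx_Y, T.Dx_Dy]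
    abel
  rw [map_sub, map_sub, e, ← h', T.Dx_X_j] at h
  exact (sub_right_injective h).symm

lemma q_Dy (f : M) : T.q (T.Dy f) = T.Ds (T.Xs (T.qm f)) := by
  refine T.j_inj ?_
  have h := congrArg T.Dy (T.Gp_spec f)
  have h' : T.Dy f - T.j (T.q (T.Dy f)) = _ := T.Gz_spec (T.Dy f)
  rw [← T.Dy_Gp] at h'
  have e : T.Dy (T.Dx (T.X (T.Gp f))) - T.Dy (T.Y (T.Dy (T.Gp f))) =
      T.X (T.Dx (T.Dy (T.Gp f))) - T.Y (T.Dy (T.Dy (T.Gp f))) := by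
    rw [T.Dx_X, T.Dy_Y, map_add, T.Dy_X, T.Dx_Dy]
    abel
  rw [map_sub, map_sub, e, ← h', T.Dy_Y_j] at h
  exact (sub_right_injective h).symm

/-- A closed form `a` in `z, t` of sufficiently high degree is exact if `d(x t) dy a` is. -/
lemma exact_of_phi_exact (G₃ G₂ : Submodule K S)
    (hV : ∀ a b, a ∈ G₃ → b ∈ G₂ → T.dS a = 0 → T.Ds a = T.dS b →
      ∃ u v, T.dS u = a ∧ T.Ds u - T.dS v = b)
    {ω : A} (hω : T.dA ω = 0) {u₀ u₁ v₀ v₁ : M}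
    (h : T.IsD u₀ u₁ v₀ v₁ 0 (T.phiY ω) 0 (T.phiXY ω)) (hcω : T.c ω ∈ G₃)
    (hγ : T.Xs (T.qp u₁ - T.qm v₀) ∈ G₃) (hv₁ : T.q v₁ ∈ G₂) : ∃ θ, T.dA θ = ω := by
  obtain ⟨h1, h2, h3, h4⟩ := h
  replace h2 := congrArg T.qp h2
  replace h3 := congrArg T.qm h3
  replace h4 := congrArg T.q h4
  rw [phiY_apply, map_neg, T.qp_X_j, map_sub, T.qp_Dy, T.qp_dM] at h2
  rw [map_sub, T.qm_Dx, T.qm_dM, map_zero] at h3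
  rw [phiXY_apply, T.q_j, map_sub, map_sub, T.q_Dx, T.q_Dy, T.q_dM] at h4
  set γ := T.qp u₁ - T.qm v₀ with hγdef
  have e1 : T.dS γ = T.c (T.eA ω) := by
    rw [hγdef, map_sub, ← sub_eq_zero.mp h3, ← neg_sub, h2, neg_neg]
  have e2 : T.Ds (T.Xs γ) = T.c (T.tA ω) - T.dS (T.q v₁) := by
    rw [← h4, hγdef, map_sub, map_sub]
    abel
  -- `ω` extends to a closed form in `z, s, t`, whose primitive is evaluated at `s = 0`
  obtain ⟨u, v, hu, -⟩ := hV (T.c ω - T.ϖ • T.Xs γ) (T.ϖ • T.q v₁)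
    (G₃.sub_mem hcω (G₃.smul_mem _ hγ)) (G₂.smul_mem _ hv₁)
    (by rw [map_sub, T.dS_c, hω, map_zero, zero_add, map_smul, T.dS_Xs, e1, sub_self])
    (by rw [map_sub, T.Ds_c, map_smul, e2, smul_sub, map_smul]; abel)
  refine ⟨T.ev u, ?_⟩
  rw [← T.ev_dS, hu, map_sub, map_smul, T.ev_Xs, T.ev_c, smul_zero, sub_zero]

end SuspensionData

end Suspension

/-! ### Growth of coefficients -/

section CoeffBound

variable {p : ℕ} [Fact p.Prime] {ι : Type}

/-- The coefficients of `f` satisfy `‖a_I‖ ≤ C r ^ |I|`. -/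
def CoeffBound (C r : ℝ) (f : MvPowerSeries ι ℂ_[p]) : Prop :=
  ∀ I : ι →₀ ℕ, ‖MvPowerSeries.coeff I f‖ ≤ C * r ^ I.degree

lemma isOverconvergent_iff {f : MvPowerSeries ι ℂ_[p]} :
    IsOverconvergent f ↔ ∃ C r : ℝ, 0 < C ∧ 0 < r ∧ r < 1 ∧ CoeffBound C r f := Iff.rfl

namespace CoeffBound

variable {C C' r r' : ℝ} {f g : MvPowerSeries ι ℂ_[p]}

lemma mono (h : CoeffBound C r f) (hC : C ≤ C') (hr : 0 ≤ r) : CoeffBound C' r f :=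
  fun I => (h I).trans (by gcongr)

lemma mono_radius (h : CoeffBound C r f) (hC : 0 ≤ C) (hr : 0 ≤ r) (hrr : r ≤ r') :
    CoeffBound C r' f :=
  fun I => (h I).trans (by gcongr)

lemma add (hf : CoeffBound C r f) (hg : CoeffBound C r g) : CoeffBound C r (f + g) := by
  intro I
  rw [map_add]
  exact (PadicComplex.isNonarchimedean p _ _).trans (max_le (hf I) (hg I))

lemma neg (hf : CoeffBound C r f) : CoeffBound C r (-f) := by
  intro I
  rw [map_neg, norm_neg]
  exact hf I

lemma sub (hf : CoeffBound C r f) (hg : CoeffBound C r g) : CoeffBound C r (f - g) := by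
  rw [sub_eq_add_neg]
  exact hf.add hg.neg

lemma smul (hf : CoeffBound C r f) (a : ℂ_[p]) : CoeffBound (‖a‖ * C) r (a • f) := by
  intro I
  rw [MvPowerSeries.coeff_smul, norm_mul, mul_assoc]
  exact mul_le_mul_of_nonneg_left (hf I) (norm_nonneg _)

lemma sum {κ : Type*} {s : Finset κ} {F : κ → MvPowerSeries ι ℂ_[p]} (hC : 0 ≤ C) (hr : 0 ≤ r)
    (h : ∀ k ∈ s, CoeffBound C r (F k)) : CoeffBound C r (∑ k ∈ s, F k) := by
  intro I
  rw [map_sum]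
  exact IsUltrametricDist.norm_sum_le_of_forall_le_of_nonneg (by positivity) fun k hk => h k hk I

lemma mul (hC : 0 ≤ C) (hr : 0 ≤ r) (hf : CoeffBound C r f) (hg : CoeffBound C' r g)
    (hC' : 0 ≤ C') : CoeffBound (C * C') r (f * g) := by
  classical
  intro I
  rw [MvPowerSeries.coeff_mul]
  refine IsUltrametricDist.norm_sum_le_of_forall_le_of_nonneg (by positivity) fun x hx => ?_
  rw [norm_mul, ← Finset.HasAntidiagonal.mem_antidiagonal.mp hx, map_add, pow_add]
  calc _ ≤ (C * r ^ x.1.degree) * (C' * r ^ x.2.degree) :=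
        mul_le_mul (hf _) (hg _) (norm_nonneg _) (by positivity)
    _ = _ := by ring

lemma one (hr : 0 ≤ r) : CoeffBound 1 r (1 : MvPowerSeries ι ℂ_[p]) := by
  classical
  intro I
  rw [MvPowerSeries.coeff_one]
  split_ifs with h
  · simp [h]
  · rw [norm_zero]
    positivity

lemma pow (hC : 0 ≤ C) (hr : 0 ≤ r) (hf : CoeffBound C r f) (k : ℕ) :
    CoeffBound (C ^ k) r (f ^ k) := by
  induction k with
  | zero => simpa using one hr
  | succ k ih =>
    rw [pow_succ, pow_succ]
    exact mul (by positivity) hr ih hf hC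

lemma nsmul (hf : CoeffBound C r f) (k : ℕ) :
    CoeffBound (‖(k : ℂ_[p])‖ * C) r (k • f) := by
  have := hf.smul (k : ℂ_[p])
  rwa [Nat.cast_smul_eq_nsmul] at this

lemma coe {P : MvPolynomial ι ℂ_[p]} (h : ∀ m, ‖P.coeff m‖ ≤ C) {d : ℕ}
    (hd : P.totalDegree ≤ d) (hr : 0 < r) (hr1 : r ≤ 1) :
    CoeffBound (C * (r ^ d)⁻¹) r (P : MvPowerSeries ι ℂ_[p]) := by
  intro I
  have hC : 0 ≤ C := (norm_nonneg _).trans (h 0)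
  rw [MvPolynomial.coeff_coe]
  by_cases hI : I ∈ P.support
  · have h1 : I.degree ≤ d := (MvPolynomial.le_totalDegree hI).trans hd
    refine (h I).trans ?_
    rw [mul_assoc]
    refine le_mul_of_one_le_right hC ?_
    rw [← div_eq_inv_mul, one_le_div (by positivity)]
    exact pow_le_pow_of_le_one hr.le hr1 h1
  · rw [MvPolynomial.notMem_support_iff.mp hI, norm_zero]
    positivity

end CoeffBound

lemma one_add_pow_eq_add_sum {R : Type*} [CommRing R] (g : R) {q : ℕ} (hq : 0 < q) :
    (1 + g) ^ q = 1 + (q • g + ∑ j ∈ Finset.range (q - 1), q.choose (j + 2) • g ^ (j + 2)) := by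
  obtain ⟨q, rfl⟩ := Nat.exists_eq_add_of_le' hq
  rw [add_comm 1 g, add_pow, Finset.sum_range_succ', Finset.sum_range_succ', Nat.add_sub_cancel]
  simp only [one_pow, mul_one, pow_zero, Nat.choose_zero_right, Nat.cast_one, zero_add, pow_one,
    Nat.choose_one_right, nsmul_eq_mul]
  rw [add_comm, add_comm (∑ _ ∈ _, _), mul_comm]
  simp only [mul_comm]

/-- If the `p`-th power of `1 + g` is within `‖p ϖ‖` of `1`, then `1 + g` is within `‖ϖ‖` of `1`,
in the sense of coefficients on a polydisc. Here `‖ϖ‖ ^ (p - 1) = ‖p‖` is what makes the term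
`g ^ p` as small as the term `p g`. -/
lemma CoeffBound.of_pow_prime {g ε : MvPowerSeries ι ℂ_[p]} {r δ : ℝ} (hr : 0 < r)
    (hδ : 0 < δ) (hδ1 : δ ≤ 1) (hδp : δ ^ (p - 1) ≤ ‖(p : ℂ_[p])‖)
    (hg0 : MvPowerSeries.constantCoeff g = 0) (h : (1 + g) ^ p = 1 + ε)
    (hε : CoeffBound (‖(p : ℂ_[p])‖ * δ) r ε) : CoeffBound δ r g := by
  classical
  have hp : p.Prime := Fact.out
  have hp0 : (p : ℂ_[p]) ≠ 0 := by exact_mod_cast hp.ne_zero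
  have hpn : 0 < ‖(p : ℂ_[p])‖ := norm_pos_iff.mpr hp0
  suffices H : ∀ n, ∀ I : ι →₀ ℕ, I.degree < n → ‖MvPowerSeries.coeff I g‖ ≤ δ * r ^ I.degree from
    fun I => H _ I (Nat.lt_succ_self _)
  intro n
  induction n with
  | zero => intro I hI; omega
  | succ n ih =>
    -- powers of `g` only involve lower coefficients, since `g` has no constant term
    have hpow : ∀ j, ∀ I : ι →₀ ℕ, I.degree < n + j →
        ‖MvPowerSeries.coeff I (g ^ (j + 1))‖ ≤ δ ^ (j + 1) * r ^ I.degree := by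
      intro j
      induction j with
      | zero => intro I hI; simpa using ih I hI
      | succ j ihj =>
        intro I hI
        rw [pow_succ' g, MvPowerSeries.coeff_mul]
        refine IsUltrametricDist.norm_sum_le_of_forall_le_of_nonneg (by positivity) fun x hx => ?_
        have hdeg : x.1.degree + x.2.degree = I.degree := by
          rw [← map_add, Finset.HasAntidiagonal.mem_antidiagonal.mp hx]
        by_cases h1 : x.1.degree = 0
        · rw [(Finsupp.degree_eq_zero_iff x.1).mp h1, MvPowerSeries.coeff_zero_eq_constantCoeff,
            hg0, zero_mul, norm_zero]
          positivity
        by_cases h2 : x.2.degree < j + 1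
        · rw [coeff_pow_eq_zero_of_degree_lt g hg0 _ _ h2, mul_zero, norm_zero]
          positivity
        rw [norm_mul, ← hdeg, pow_add r]
        calc _ ≤ (δ * r ^ x.1.degree) * (δ ^ (j + 1) * r ^ x.2.degree) :=
              mul_le_mul (ih _ (by omega)) (ihj _ (by omega)) (norm_nonneg _) (by positivity)
          _ = _ := by ring
    intro I hI
    have hexp : (p : ℂ_[p]) * MvPowerSeries.coeff I g = MvPowerSeries.coeff I ε -
        ∑ j ∈ Finset.range (p - 1), MvPowerSeries.coeff I (p.choose (j + 2) • g ^ (j + 2)) := by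
      have h1 := one_add_pow_eq_add_sum g hp.pos
      rw [h, add_right_inj] at h1
      rw [h1, map_add, map_sum, map_nsmul, nsmul_eq_mul, add_sub_cancel_right]
    have hnorm : ‖(p : ℂ_[p]) * MvPowerSeries.coeff I g‖ ≤ ‖(p : ℂ_[p])‖ * (δ * r ^ I.degree) := by
      rw [hexp, sub_eq_add_neg]
      refine (PadicComplex.isNonarchimedean p _ _).trans (max_le ?_ ?_)
      · rw [← mul_assoc]
        exact hε I
      · rw [norm_neg]
        refine IsUltrametricDist.norm_sum_le_of_forall_le_of_nonneg (by positivity) fun j hj => ?_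
        rw [Finset.mem_range] at hj
        rw [map_nsmul, nsmul_eq_mul, norm_mul, ← mul_assoc]
        have h2 := hpow (j + 1) I (by omega)
        have h3 : ‖((p.choose (j + 2) : ℕ) : ℂ_[p])‖ * δ ^ (j + 2) ≤ ‖(p : ℂ_[p])‖ * δ := by
          by_cases hjp : j + 2 = p
          · have h4 : δ ^ p = δ ^ (p - 1) * δ := by rw [← pow_succ, Nat.sub_add_cancel hp.one_le]
            rw [hjp, Nat.choose_self, Nat.cast_one, norm_one, one_mul, h4]
            gcongr
          · obtain ⟨c, hc⟩ := hp.dvd_choose_self (k := j + 2) (by omega) (by omega)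
            rw [hc, Nat.cast_mul, norm_mul]
            have := IsUltrametricDist.norm_natCast_le_one ℂ_[p] c
            calc ‖(p : ℂ_[p])‖ * ‖(c : ℂ_[p])‖ * δ ^ (j + 2) ≤ ‖(p : ℂ_[p])‖ * 1 * δ ^ 1 := by
                  gcongr ?_ * ?_ * ?_
                  exact pow_le_pow_of_le_one hδ.le hδ1 (by omega)
              _ = _ := by ring
        calc _ ≤ ‖((p.choose (j + 2) : ℕ) : ℂ_[p])‖ * (δ ^ (j + 2) * r ^ I.degree) := by
              gcongr
          _ ≤ _ := by
              rw [← mul_assoc]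
              gcongr
    rw [norm_mul] at hnorm
    exact le_of_mul_le_mul_left hnorm hpn

end CoeffBound

/-! ### Norms of factorials -/

section Factorial

variable {p : ℕ} [Fact p.Prime]

lemma norm_natCast_padicComplex {n : ℕ} (hn : n ≠ 0) :
    ‖(n : ℂ_[p])‖ = ((p : ℝ) ^ padicValNat p n)⁻¹ := by
  have h1 := PadicComplex.norm_extends' p (n : ℚ_[p])
  have h2 := Padic.eq_padicNorm (p := p) (n : ℚ)
  have h3 := padicNorm.eq_zpow_of_nonzero (p := p) (q := (n : ℚ)) (by exact_mod_cast hn)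
  rw [h3] at h2
  simp only [map_natCast, PadicComplex.coe_natCast, Rat.cast_natCast, padicValRat.of_nat,
    zpow_neg, zpow_natCast, Rat.cast_inv, Rat.cast_pow] at h1 h2
  rw [h1, h2]

lemma norm_prime_padicComplex : ‖(p : ℂ_[p])‖ = (p : ℝ)⁻¹ := by
  rw [norm_natCast_padicComplex (Fact.out : p.Prime).ne_zero, padicValNat_self, pow_one]

lemma inv_le_norm_natCast {n : ℕ} (hn : n ≠ 0) : ‖(n : ℂ_[p])‖⁻¹ ≤ n := by
  rw [norm_natCast_padicComplex hn, inv_inv]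
  exact_mod_cast Nat.le_of_dvd (Nat.pos_of_ne_zero hn) pow_padicValNat_dvd

lemma norm_root_pow {ϖ : ℂ_[p]} (hϖ : ϖ ^ (p - 1) = -(p : ℂ_[p])) :
    ‖ϖ‖ ^ (p - 1) = (p : ℝ)⁻¹ := by
  rw [← norm_pow, hϖ, norm_neg, norm_prime_padicComplex]

lemma root_ne_zero {ϖ : ℂ_[p]} (hϖ : ϖ ^ (p - 1) = -(p : ℂ_[p])) : ϖ ≠ 0 := by
  have hp : p.Prime := Fact.out
  rintro rfl
  rw [zero_pow (Nat.sub_ne_zero_of_lt hp.one_lt), zero_eq_neg] at hϖ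
  exact hp.ne_zero (by exact_mod_cast hϖ)

lemma norm_root_lt_one {ϖ : ℂ_[p]} (hϖ : ϖ ^ (p - 1) = -(p : ℂ_[p])) : ‖ϖ‖ < 1 := by
  have hp : p.Prime := Fact.out
  have h := norm_root_pow hϖ
  by_contra hc
  have h1 : 1 ≤ ‖ϖ‖ ^ (p - 1) := one_le_pow₀ (not_lt.mp hc)
  rw [h] at h1
  exact absurd h1 (not_le.mpr (inv_lt_one_of_one_lt₀ (by exact_mod_cast hp.one_lt)))

lemma norm_prime_le_root {ϖ : ℂ_[p]} (hϖ : ϖ ^ (p - 1) = -(p : ℂ_[p])) :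
    ‖(p : ℂ_[p])‖ ≤ ‖ϖ‖ := by
  have hp : p.Prime := Fact.out
  rw [norm_prime_padicComplex, ← norm_root_pow hϖ]
  refine pow_le_of_le_one (norm_nonneg _) (norm_root_lt_one hϖ).le
    (Nat.sub_ne_zero_of_lt hp.one_lt)

/-- Legendre's formula for the factorial, where `‖ϖ‖ ^ (p - 1) = 1 / p`. -/
lemma norm_root_pow_div_factorial {ϖ : ℂ_[p]} (hϖ : ϖ ^ (p - 1) = -(p : ℂ_[p])) (k : ℕ) :
    (‖ϖ‖ ^ k * ‖((k.factorial : ℕ) : ℂ_[p])‖⁻¹) ^ (p - 1) = ((p : ℝ) ^ (p.digits k).sum)⁻¹ := by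
  have hp : p.Prime := Fact.out
  have hp0 : (p : ℝ) ≠ 0 := by exact_mod_cast hp.ne_zero
  have h1 := sub_one_mul_padicValNat_factorial (p := p) k
  have h2 := Nat.digit_sum_le p k
  rw [mul_pow, ← pow_mul, mul_comm k, pow_mul, norm_root_pow hϖ,
    norm_natCast_padicComplex k.factorial_ne_zero, inv_inv, ← pow_mul, mul_comm _ (p - 1), h1,
    inv_pow, inv_mul_eq_iff_eq_mul₀ (pow_ne_zero _ hp0), eq_mul_inv_iff_mul_eq₀
    (pow_ne_zero _ hp0), ← pow_add, Nat.sub_add_cancel h2]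

lemma norm_root_pow_div_factorial_le {ϖ : ℂ_[p]} (hϖ : ϖ ^ (p - 1) = -(p : ℂ_[p])) {k : ℕ}
    (hk : k ≠ 0) : ‖ϖ‖ ^ k * ‖((k.factorial : ℕ) : ℂ_[p])‖⁻¹ ≤ ‖ϖ‖ := by
  have hp : p.Prime := Fact.out
  refine le_of_pow_le_pow_left₀ (Nat.sub_ne_zero_of_lt hp.one_lt) (norm_nonneg _) ?_
  rw [norm_root_pow_div_factorial hϖ, norm_root_pow hϖ]
  have h1 : (1 : ℝ) < p := by exact_mod_cast hp.one_lt
  refine inv_anti₀ (by positivity) (le_self_pow₀ h1.le ?_)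
  intro h0
  rw [List.sum_eq_zero_iff] at h0
  exact Nat.getLast_digit_ne_zero p hk (h0 _ (List.getLast_mem _))

/-- The failure of `k ! / ϖ ^ k` to be bounded is polynomial in `k`. -/
lemma norm_factorial_div_root_pow_le {ϖ : ℂ_[p]} (hϖ : ϖ ^ (p - 1) = -(p : ℂ_[p])) (k : ℕ) :
    ‖((k.factorial : ℕ) : ℂ_[p]) * (ϖ⁻¹) ^ k‖ ≤ p * (k + 1) := by
  have hp : p.Prime := Fact.out
  have h1 : (1 : ℝ) < p := by exact_mod_cast hp.one_lt
  rcases Nat.eq_zero_or_pos k with rfl | hk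
  · simpa using h1.le
  have h2 : ‖((k.factorial : ℕ) : ℂ_[p]) * (ϖ⁻¹) ^ k‖ =
      (‖ϖ‖ ^ k * ‖((k.factorial : ℕ) : ℂ_[p])‖⁻¹)⁻¹ := by
    rw [norm_mul, norm_pow, norm_inv, mul_inv, inv_inv, inv_pow, mul_comm]
  have h3 : ‖((k.factorial : ℕ) : ℂ_[p]) * (ϖ⁻¹) ^ k‖ ≤ (p : ℝ) ^ (p.digits k).length := by
    refine le_of_pow_le_pow_left₀ (Nat.sub_ne_zero_of_lt hp.one_lt) (by positivity) ?_
    rw [h2, inv_pow, norm_root_pow_div_factorial hϖ, inv_inv, ← pow_mul]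
    refine pow_le_pow_right₀ h1.le ?_
    have := List.sum_le_card_nsmul (p.digits k) (p - 1) fun x hx => by
      have := Nat.digits_lt_base hp.one_lt hx
      omega
    simpa using this
  have h4 : (p : ℝ) ^ (p.digits k).length ≤ p * k := by
    exact_mod_cast Nat.base_pow_length_digits_le p k hp.one_lt hk.ne'
  refine h3.trans (h4.trans ?_)
  gcongr
  linarith

end Factorial

/-! ### Exponentials -/

section Exponential

variable {p : ℕ} [Fact p.Prime] {ι κ : Type}

lemma constantCoeff_coe_eq_zero {Q : MvPolynomial ι ℂ_[p]}
    (hQ : MvPolynomial.constantCoeff Q = 0) :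
    MvPowerSeries.constantCoeff (Q : MvPowerSeries ι ℂ_[p]) = 0 := by
  rw [← hQ, ← MvPowerSeries.coeff_zero_eq_constantCoeff_apply, MvPolynomial.coeff_coe]
  rfl

lemma constantCoeff_mvExp (Q : MvPolynomial ι ℂ_[p]) (hQ : MvPolynomial.constantCoeff Q = 0) :
    MvPowerSeries.constantCoeff (mvExp Q) = 1 := by
  rw [← MvPowerSeries.coeff_zero_eq_constantCoeff_apply,
    coeff_mvExp Q (constantCoeff_coe_eq_zero hQ) 0 1 (by simp)]
  simp

/-- A solution of the differential equation of `e ^ Q` is determined by its constant term. -/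
lemma eq_mvExp {Q : MvPolynomial ι ℂ_[p]} (hQ : MvPolynomial.constantCoeff Q = 0)
    {f : MvPowerSeries ι ℂ_[p]} (hf : MvPowerSeries.constantCoeff f = 1)
    (h : ∀ i, MvPowerSeries.pderiv ℂ_[p] i f = (MvPolynomial.pderiv i Q : MvPolynomial ι ℂ_[p]) * f) :
    f = mvExp Q := by
  classical
  rw [← sub_eq_zero]
  set g := f - mvExp Q with hg
  have hg0 : MvPowerSeries.constantCoeff g = 0 := by
    rw [hg, map_sub, hf, constantCoeff_mvExp Q hQ, sub_self]
  have hgd : ∀ i, MvPowerSeries.pderiv ℂ_[p] i g =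
      (MvPolynomial.pderiv i Q : MvPolynomial ι ℂ_[p]) * g := by
    intro i
    rw [hg, map_sub, h, pderiv_mvExp Q hQ, mul_sub]
  suffices H : ∀ n, ∀ I : ι →₀ ℕ, I.degree < n → MvPowerSeries.coeff I g = 0 by
    ext I
    exact H _ I (Nat.lt_succ_self _)
  intro n
  induction n with
  | zero => intro I hI; omega
  | succ n ih =>
    intro I hI
    by_cases hI0 : I = 0
    · rw [hI0, MvPowerSeries.coeff_zero_eq_constantCoeff, hg0]
    obtain ⟨i, hi⟩ := Finsupp.ne_iff.mp hI0
    obtain ⟨J, rfl⟩ : ∃ J, I = J + Finsupp.single i 1 :=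
      ⟨I - Finsupp.single i 1, by
        rw [tsub_add_cancel_of_le]
        rw [Finsupp.single_le_iff]
        exact Nat.one_le_iff_ne_zero.mpr hi⟩
    rw [map_add, Finsupp.degree_single] at hI
    have h1 := congrArg (MvPowerSeries.coeff J) (hgd i)
    rw [MvPowerSeries.coeff_pderiv, MvPowerSeries.coeff_mul, Finset.sum_eq_zero] at h1
    · exact (mul_eq_zero.mp h1).resolve_right (by exact_mod_cast Nat.succ_ne_zero (J i))
    · intro x hx
      rw [ih x.2, mul_zero]
      have := congrArg Finsupp.degree (Finset.HasAntidiagonal.mem_antidiagonal.mp hx)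
      rw [map_add] at this
      omega

lemma mvExp_add {Q Q' : MvPolynomial ι ℂ_[p]} (hQ : MvPolynomial.constantCoeff Q = 0)
    (hQ' : MvPolynomial.constantCoeff Q' = 0) : mvExp (Q + Q') = mvExp Q * mvExp Q' := by
  refine (eq_mvExp (by rw [map_add, hQ, hQ', add_zero]) ?_ fun i => ?_).symm
  · rw [map_mul, constantCoeff_mvExp Q hQ, constantCoeff_mvExp Q' hQ', mul_one]
  · rw [Derivation.leibniz, pderiv_mvExp Q hQ, pderiv_mvExp Q' hQ', map_add, MvPolynomial.coe_add,
      smul_eq_mul, smul_eq_mul]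
    ring

lemma mvExp_nsmul {Q : MvPolynomial ι ℂ_[p]} (hQ : MvPolynomial.constantCoeff Q = 0) (k : ℕ) :
    mvExp (k • Q) = mvExp Q ^ k := by
  induction k with
  | zero =>
    rw [zero_smul, pow_zero]
    exact (eq_mvExp (by simp) (by simp) (by simp)).symm
  | succ k ih =>
    rw [add_smul, one_smul, mvExp_add (by rw [map_nsmul, hQ, smul_zero]) hQ, ih, pow_succ]

lemma pderiv_rename_emb (e : ι ↪ κ) (i : ι) (f : MvPowerSeries ι ℂ_[p]) :
    MvPowerSeries.pderiv ℂ_[p] (e i) (MvPowerSeries.rename e f) =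
      MvPowerSeries.rename e (MvPowerSeries.pderiv ℂ_[p] i f) := by
  ext J
  rw [MvPowerSeries.coeff_pderiv]
  by_cases hJ : J ∈ Set.range (Finsupp.embDomain e)
  · obtain ⟨I, rfl⟩ := hJ
    rw [MvPowerSeries.coeff_embDomain_rename, MvPowerSeries.coeff_pderiv,
      ← Finsupp.embDomain_single, ← Finsupp.embDomain_add, MvPowerSeries.coeff_embDomain_rename,
      Finsupp.embDomain_apply_self]
  · have h1 : J ∉ Set.range (Finsupp.mapDomain e) := by
      rintro ⟨I, rfl⟩
      exact hJ ⟨I, Finsupp.embDomain_eq_mapDomain e I⟩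
    rw [MvPowerSeries.coeff_rename_eq_zero e _ h1, MvPowerSeries.coeff_rename_eq_zero, zero_mul]
    rintro ⟨I, hI⟩
    refine hJ ?_
    rw [Finsupp.mem_range_embDomain_iff]
    rw [← Finsupp.embDomain_eq_mapDomain] at hI
    have h2 : (J + Finsupp.single (e i) 1) ∈ Set.range (Finsupp.embDomain (M := ℕ) e) := ⟨I, hI⟩
    rw [Finsupp.mem_range_embDomain_iff] at h2
    refine subset_trans ?_ h2
    intro a ha
    simp only [SetLike.mem_coe, Finsupp.mem_support_iff, Finsupp.add_apply] at ha ⊢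
    omega

lemma pderiv_rename_of_notMem (e : ι ↪ κ) (k : κ) (hk : k ∉ Set.range e)
    (f : MvPowerSeries ι ℂ_[p]) :
    MvPowerSeries.pderiv ℂ_[p] k (MvPowerSeries.rename e f) = 0 := by
  ext J
  rw [MvPowerSeries.coeff_pderiv, MvPowerSeries.coeff_rename_eq_zero, zero_mul, map_zero]
  rintro ⟨I, hI⟩
  have h := DFunLike.congr_fun hI k
  rw [Finsupp.mapDomain_of_notMem_range _ _ hk] at h
  simp at h

lemma rename_mvExp (e : ι ↪ κ) {Q : MvPolynomial ι ℂ_[p]}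
    (hQ : MvPolynomial.constantCoeff Q = 0) :
    MvPowerSeries.rename e (mvExp Q) = mvExp (MvPolynomial.rename e Q) := by
  refine eq_mvExp (by rw [MvPolynomial.constantCoeff_rename, hQ]) ?_ fun k => ?_
  · rw [MvPowerSeries.constantCoeff_rename, constantCoeff_mvExp Q hQ]
  · by_cases hk : k ∈ Set.range e
    · obtain ⟨i, rfl⟩ := hk
      rw [pderiv_rename_emb, pderiv_mvExp Q hQ, map_mul, MvPolynomial.pderiv_rename e.injective,
        MvPowerSeries.rename_coe]
    · rw [pderiv_rename_of_notMem e k hk]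
      have : MvPolynomial.pderiv k (MvPolynomial.rename e Q) = 0 := by
        rw [← MvPolynomial.coe_inj (R := ℂ_[p]), ← MvPowerSeries.pderiv_coe,
          ← MvPowerSeries.rename_coe, pderiv_rename_of_notMem e k hk]
        rfl
      rw [this, MvPolynomial.coe_zero, zero_mul]

lemma CoeffBound.rename {C r : ℝ} (hC : 0 ≤ C) (hr : 0 ≤ r) (e : ι ↪ κ)
    {f : MvPowerSeries ι ℂ_[p]} (hf : CoeffBound C r f) :
    CoeffBound C r (MvPowerSeries.rename e f) := by
  intro J
  by_cases hJ : J ∈ Set.range (Finsupp.mapDomain e)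
  · obtain ⟨I, rfl⟩ := hJ
    rw [← Finsupp.embDomain_eq_mapDomain, MvPowerSeries.coeff_embDomain_rename]
    have : (Finsupp.embDomain e I).degree = I.degree := by
      rw [Finsupp.embDomain_eq_mapDomain, Finsupp.degree_mapDomain]
    rw [this]
    exact hf I
  · rw [MvPowerSeries.coeff_rename_eq_zero e _ hJ, norm_zero]
    positivity

lemma IsOverconvergent.rename {f : MvPowerSeries ι ℂ_[p]} (hf : IsOverconvergent f) (e : ι ↪ κ) :
    IsOverconvergent (MvPowerSeries.rename e f) := by
  obtain ⟨C, r, hC, hr, hr1, h⟩ := hf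
  exact ⟨C, r, hC, hr, hr1, CoeffBound.rename hC.le hr.le e h⟩

end Exponential

/-! ### Overconvergence of the Frobenius factor -/

section FrobeniusFactor

variable {p : ℕ} [Fact p.Prime] {ι : Type}

/-- `R(z ^ p) ≡ R(z) ^ p` modulo the maximal ideal, if the coefficients of `R` are fixed by the
Frobenius of the residue field. -/
lemma norm_coeff_expand_sub_pow_lt_one (R : MvPolynomial ι ℂ_[p]) (hR : ∀ m, ‖R.coeff m‖ ≤ 1)
    (hRp : ∀ m, ‖R.coeff m ^ p - R.coeff m‖ < 1) (m : ι →₀ ℕ) :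
    ‖(MvPolynomial.expand p R - R ^ p).coeff m‖ < 1 := by
  classical
  have hp : p.Prime := Fact.out
  have hsum : ∀ s : Finset (ι →₀ ℕ), ∀ m,
      ‖(MvPolynomial.expand p (∑ k ∈ s, MvPolynomial.monomial k (R.coeff k)) -
        (∑ k ∈ s, MvPolynomial.monomial k (R.coeff k)) ^ p).coeff m‖ < 1 := by
    intro s
    induction s using Finset.induction_on with
    | empty => intro m; simp [hp.ne_zero]
    | insert k s hk ih =>
      intro m
      rw [Finset.sum_insert hk]
      set A := MvPolynomial.monomial k (R.coeff k)
      set B := ∑ k ∈ s, MvPolynomial.monomial k (R.coeff k) with hB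
      have hA1 : CoeffBound 1 1 (A : MvPowerSeries ι ℂ_[p]) := by
        intro I
        rw [MvPolynomial.coeff_coe, MvPolynomial.coeff_monomial, one_pow, mul_one]
        split_ifs
        · exact hR k
        · simp
      have hB1 : CoeffBound 1 1 (B : MvPowerSeries ι ℂ_[p]) := by
        intro I
        rw [MvPolynomial.coeff_coe, one_pow, mul_one, hB, MvPolynomial.coeff_sum]
        refine IsUltrametricDist.norm_sum_le_of_forall_le_of_nonneg zero_le_one fun j _ => ?_
        rw [MvPolynomial.coeff_monomial]
        split_ifs
        · exact hR j
        · simp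
      set Z := ∑ j ∈ Finset.Ioo 0 p, A ^ j * B ^ (p - j) *
        ((p.choose j / p : ℕ) : MvPolynomial ι ℂ_[p]) with hZ
      have hZ1 : CoeffBound 1 1 (Z : MvPowerSeries ι ℂ_[p]) := by
        have : (Z : MvPowerSeries ι ℂ_[p]) = ∑ j ∈ Finset.Ioo 0 p, (p.choose j / p) •
            ((A : MvPowerSeries ι ℂ_[p]) ^ j * (B : MvPowerSeries ι ℂ_[p]) ^ (p - j)) := by
          rw [hZ, ← MvPolynomial.coeToMvPowerSeries.ringHom_apply, map_sum]
          refine Finset.sum_congr rfl fun j _ => ?_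
          rw [map_mul, map_mul, map_pow, map_pow, map_natCast, nsmul_eq_mul, mul_comm]
          rfl
        rw [this]
        refine CoeffBound.sum zero_le_one zero_le_one fun j _ => ?_
        have h1 := (hA1.pow zero_le_one zero_le_one j).mul (by positivity) zero_le_one
          (hB1.pow zero_le_one zero_le_one (p - j)) (by positivity)
        refine (h1.nsmul _).mono ?_ zero_le_one
        simpa using IsUltrametricDist.norm_natCast_le_one ℂ_[p] (p.choose j / p)
      have h1 : MvPolynomial.expand p (A + B) - (A + B) ^ p =
          (MvPolynomial.expand p A - A ^ p) + ((MvPolynomial.expand p B - B ^ p) -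
            MvPolynomial.C (p : ℂ_[p]) * Z) := by
        rw [add_pow_prime_eq' hp, map_add, ← hZ, map_natCast]
        ring
      have hA : MvPolynomial.expand p A - A ^ p =
          MvPolynomial.monomial (p • k) (R.coeff k - R.coeff k ^ p) := by
        rw [MvPolynomial.expand_monomial, MvPolynomial.monomial_pow, map_sub]
      rw [h1, hA, MvPolynomial.coeff_add, MvPolynomial.coeff_sub _ m (_ - _),
        MvPolynomial.coeff_C_mul]
      refine (PadicComplex.isNonarchimedean p _ _).trans_lt (max_lt ?_ ?_)
      · rw [MvPolynomial.coeff_monomial]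
        split_ifs
        · rw [norm_sub_rev]
          exact hRp k
        · simp
      · rw [sub_eq_add_neg]
        refine (PadicComplex.isNonarchimedean p _ _).trans_lt (max_lt (ih m) ?_)
        rw [norm_neg, norm_mul, norm_prime_padicComplex]
        have h2 : ‖Z.coeff m‖ ≤ 1 := by simpa [MvPolynomial.coeff_coe] using hZ1 m
        calc _ ≤ (p : ℝ)⁻¹ * 1 := by gcongr
          _ < 1 := by
            rw [mul_one]
            exact inv_lt_one_of_one_lt₀ (by exact_mod_cast hp.one_lt)
  have := hsum R.support m
  rwa [MvPolynomial.support_sum_monomial_coeff] at this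

lemma exists_lt_one_norm_coeff_le (F : MvPolynomial ι ℂ_[p]) (hF : ∀ m, ‖F.coeff m‖ < 1) :
    ∃ κ : ℝ, 0 < κ ∧ κ < 1 ∧ ∀ m, ‖F.coeff m‖ ≤ κ := by
  classical
  have : ∀ s : Finset (ι →₀ ℕ), ∃ κ : ℝ, 0 < κ ∧ κ < 1 ∧ ∀ m ∈ s, ‖F.coeff m‖ ≤ κ := by
    intro s
    induction s using Finset.induction_on with
    | empty => exact ⟨1 / 2, by norm_num, by norm_num, by simp⟩
    | insert k s hk ih =>
      obtain ⟨κ, h0, h1, h⟩ := ih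
      refine ⟨max κ ‖F.coeff k‖, lt_max_of_lt_left h0, max_lt h1 (hF k), fun m hm => ?_⟩
      rcases Finset.mem_insert.mp hm with rfl | hm
      · exact le_max_right _ _
      · exact (h m hm).trans (le_max_left _ _)
  obtain ⟨κ, h0, h1, h⟩ := this F.support
  refine ⟨κ, h0, h1, fun m => ?_⟩
  by_cases hm : m ∈ F.support
  · exact h m hm
  · rw [MvPolynomial.notMem_support_iff.mp hm, norm_zero]
    exact h0.le

/-- The exponential of a polynomial multiple of `p ϖ` agrees with its linear part to precision
`p ϖ`. -/
lemma coeffBound_mvExp_sub {ϖ : ℂ_[p]} (hϖ : ϖ ^ (p - 1) = -(p : ℂ_[p]))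
    (S : MvPolynomial ι ℂ_[p]) (hS0 : MvPolynomial.constantCoeff S = 0) {ρ r : ℝ} (hr : 0 < r)
    (hρ : 1 ≤ ρ) (hS : CoeffBound ρ r (S : MvPowerSeries ι ℂ_[p]))
    (hρp : ‖(p : ℂ_[p])‖ * ρ ^ 2 ≤ 1) :
    CoeffBound (‖(p : ℂ_[p])‖ * ‖ϖ‖) r (mvExp (MvPolynomial.C (p * ϖ) * S) - 1 -
      (p * ϖ : ℂ_[p]) • (S : MvPowerSeries ι ℂ_[p])) := by
  intro I
  have hpn : 0 < ‖(p : ℂ_[p])‖ := by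
    rw [norm_pos_iff]
    exact_mod_cast (Fact.out : p.Prime).ne_zero
  set Q := MvPolynomial.C (p * ϖ) * S with hQ
  have hQ0 : MvPolynomial.constantCoeff Q = 0 := by rw [hQ, map_mul, hS0, mul_zero]
  have hQc : (Q : MvPowerSeries ι ℂ_[p]) = (p * ϖ : ℂ_[p]) • (S : MvPowerSeries ι ℂ_[p]) := by
    rw [hQ, MvPolynomial.coe_mul, MvPolynomial.coe_C, MvPowerSeries.smul_eq_C_mul]
  rw [map_sub, map_sub, coeff_mvExp Q (constantCoeff_coe_eq_zero hQ0) I (I.degree + 2)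
    (by omega), Finset.sum_range_succ', Finset.sum_range_succ', map_add, map_add]
  simp only [Nat.factorial_zero, zero_add, Nat.factorial_one, pow_zero, pow_one, Nat.cast_one,
    div_one, map_one, one_smul, hQc]
  have h1 : ∀ a b c : ℂ_[p], a + b + c - c - b = a := fun a b c => by ring
  rw [h1]
  refine CoeffBound.sum (C := ‖(p : ℂ_[p])‖ * ‖ϖ‖) (by positivity) hr.le (fun k _ => ?_) I
  rw [smul_pow, smul_smul]
  have h2 := (hS.pow (zero_le_one.trans hρ) hr.le (k + 1 + 1)).smul
    (algebraMap ℚ ℂ_[p] (1 / (k + 1 + 1).factorial) * (p * ϖ) ^ (k + 1 + 1))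
  refine h2.mono ?_ hr.le
  have h3 : ‖algebraMap ℚ ℂ_[p] (1 / (k + 1 + 1).factorial) * (p * ϖ) ^ (k + 1 + 1)‖ ≤
      ‖(p : ℂ_[p])‖ ^ (k + 1 + 1) * ‖ϖ‖ := by
    have h4 := norm_root_pow_div_factorial_le hϖ (k := k + 1 + 1) (by omega)
    rw [norm_mul, map_div₀, map_one, map_natCast, norm_div, norm_one, norm_pow, norm_mul, mul_pow]
    calc _ = ‖(p : ℂ_[p])‖ ^ (k + 1 + 1) *
          (‖ϖ‖ ^ (k + 1 + 1) * ‖(((k + 1 + 1).factorial : ℕ) : ℂ_[p])‖⁻¹) := by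
          rw [one_div]; ring
      _ ≤ _ := by gcongr
  have h5 : (‖(p : ℂ_[p])‖ * ρ) ^ k ≤ 1 := by
    refine pow_le_one₀ (by positivity) (le_trans ?_ hρp)
    gcongr
    exact le_self_pow₀ hρ two_ne_zero
  calc _ ≤ ‖(p : ℂ_[p])‖ ^ (k + 1 + 1) * ‖ϖ‖ * ρ ^ (k + 1 + 1) := by gcongr
    _ = ((‖(p : ℂ_[p])‖ * ρ) ^ k * (‖(p : ℂ_[p])‖ * ρ ^ 2)) * (‖(p : ℂ_[p])‖ * ‖ϖ‖) := by ring
    _ ≤ (1 * 1) * (‖(p : ℂ_[p])‖ * ‖ϖ‖) := by gcongr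
    _ = _ := by ring

/-- The power series `e ^ (ϖ (R(z ^ p) - R(z)))` is overconvergent if the coefficients of `R` are
integral and fixed by the Frobenius of the residue field. The `p`-th power of its product `f` with
`1 + ϖ R` is `1` to precision `p ϖ` on a polydisc of radius greater than `1`, hence `f` is
overconvergent, and division by `1 + ϖ R` does not affect this. -/
theorem isOverconvergent_mvExp_frobExponent {ϖ : ℂ_[p]} (hϖ : ϖ ^ (p - 1) = -(p : ℂ_[p]))
    (R : MvPolynomial ι ℂ_[p]) (hR0 : MvPolynomial.constantCoeff R = 0)
    (hR : ∀ m, ‖R.coeff m‖ ≤ 1) (hRp : ∀ m, ‖R.coeff m ^ p - R.coeff m‖ < 1) :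
    IsOverconvergent (mvExp (frobExponent (MvPolynomial.C ϖ * R))) := by
  classical
  have hp : p.Prime := Fact.out
  have hpn : 0 < ‖(p : ℂ_[p])‖ := by
    rw [norm_pos_iff]
    exact_mod_cast hp.ne_zero
  have hϖ0 : 0 < ‖ϖ‖ := norm_pos_iff.mpr (root_ne_zero hϖ)
  have hϖ1 := norm_root_lt_one hϖ
  obtain ⟨κ, hκ0, hκ1, hκ⟩ := exists_lt_one_norm_coeff_le _
    (norm_coeff_expand_sub_pow_lt_one R hR hRp)
  -- the radius is so close to `1` that polynomials of degree at most `d` hardly grow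
  set d := p * R.totalDegree + 1 with hd
  set μ := max κ ‖ϖ‖ with hμ
  have hμ0 : 0 < μ := lt_max_of_lt_left hκ0
  have hμ1 : μ < 1 := max_lt hκ1 hϖ1
  set r : ℝ := μ ^ ((2 * d : ℕ) : ℝ)⁻¹ with hr
  have hd0 : (2 * d : ℕ) ≠ 0 := by omega
  have hr0 : 0 < r := by positivity
  have hr1 : r < 1 := Real.rpow_lt_one hμ0.le hμ1 (by positivity)
  have hrd : r ^ (2 * d) = μ := Real.rpow_inv_natCast_pow hμ0.le hd0
  set ρ : ℝ := (r ^ d)⁻¹ with hρ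
  have hρ1 : 1 ≤ ρ := (one_le_inv₀ (by positivity)).mpr (pow_le_one₀ hr0.le hr1.le)
  have hρ0 : 0 < ρ := by positivity
  have hρμ : μ * ρ ^ 2 = 1 := by
    rw [hρ, inv_pow, ← pow_mul, mul_comm d, hrd, mul_inv_cancel₀ hμ0.ne']
  have hρϖ2 : ‖ϖ‖ * ρ ^ 2 ≤ 1 := by
    rw [← hρμ]
    gcongr
    exact le_max_right _ _
  have hρp2 : ‖(p : ℂ_[p])‖ * ρ ^ 2 ≤ 1 := by
    refine le_trans ?_ hρϖ2
    gcongr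
    exact norm_prime_le_root hϖ
  have hρϖ : ‖ϖ‖ * ρ ≤ 1 := by
    refine le_trans ?_ hρϖ2
    gcongr
    exact le_self_pow₀ hρ1 two_ne_zero
  have hρκ : κ * ρ ≤ 1 := by
    rw [← hρμ]
    gcongr
    · exact le_max_left _ _
    · exact le_self_pow₀ hρ1 two_ne_zero
  set Rs : MvPowerSeries ι ℂ_[p] := (R : MvPowerSeries ι ℂ_[p]) with hRs
  -- bounds for the polynomials involved
  have hRpow : ∀ k ≤ p, CoeffBound ρ r (Rs ^ k) := by
    intro k hk
    have h1 : CoeffBound 1 1 (Rs ^ k) := by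
      have : CoeffBound 1 1 Rs := fun I => by
        simpa [hRs, MvPolynomial.coeff_coe] using hR I
      simpa using this.pow zero_le_one zero_le_one k
    rw [hRs, ← MvPolynomial.coe_pow, ← one_mul ρ]
    refine CoeffBound.coe (fun m => ?_) ?_ hr0 hr1.le
    · simpa [hRs, ← MvPolynomial.coe_pow, MvPolynomial.coeff_coe] using h1 m
    · exact (MvPolynomial.totalDegree_pow R k).trans
        ((Nat.mul_le_mul_right _ hk).trans (Nat.le_succ _))
  have hexpand : CoeffBound ρ r
      ((MvPolynomial.expand p R : MvPolynomial ι ℂ_[p]) : MvPowerSeries ι ℂ_[p]) := by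
    rw [← one_mul ρ]
    refine CoeffBound.coe (fun m => ?_) ?_ hr0 hr1.le
    · have h1 := hκ m
      have h2 := hRpow p le_rfl
      have h3 : ‖(R ^ p).coeff m‖ ≤ 1 := by
        have h4 : CoeffBound 1 1 (Rs ^ p) := by
          have : CoeffBound 1 1 Rs := fun I => by
            simpa [hRs, MvPolynomial.coeff_coe] using hR I
          simpa using this.pow zero_le_one zero_le_one p
        simpa [hRs, ← MvPolynomial.coe_pow, MvPolynomial.coeff_coe] using h4 m
      have h5 : (MvPolynomial.expand p R).coeff m =
          (MvPolynomial.expand p R - R ^ p).coeff m + (R ^ p).coeff m := by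
        rw [MvPolynomial.coeff_sub, sub_add_cancel]
      rw [h5]
      exact (PadicComplex.isNonarchimedean p _ _).trans (max_le (h1.trans hκ1.le) h3)
    · rw [MvPolynomial.totalDegree_expand, mul_comm]
      exact Nat.le_succ _
  set S := MvPolynomial.expand p R - R with hS
  have hS0 : MvPolynomial.constantCoeff S = 0 := by
    rw [hS, map_sub, hR0, sub_zero, ← hR0, MvPolynomial.constantCoeff_eq,
      MvPolynomial.coeff_expand_zero _ hp.ne_zero]
  have hSc : (S : MvPowerSeries ι ℂ_[p]) =
      ((MvPolynomial.expand p R : MvPolynomial ι ℂ_[p]) : MvPowerSeries ι ℂ_[p]) - Rs := by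
    rw [hS, eq_sub_iff_add_eq, hRs, ← MvPolynomial.coe_add, sub_add_cancel]
  have hSb : CoeffBound ρ r (S : MvPowerSeries ι ℂ_[p]) := by
    rw [hSc]
    have := hRpow 1 hp.one_le
    rw [pow_one] at this
    exact hexpand.sub this
  have hQ : frobExponent (MvPolynomial.C ϖ * R) = MvPolynomial.C ϖ * S := by
    rw [frobExponent, map_mul, MvPolynomial.expand_C, hS, mul_sub]
  have hQ0 : MvPolynomial.constantCoeff (MvPolynomial.C ϖ * S) = 0 := by
    rw [map_mul, hS0, mul_zero]
  rw [hQ]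
  set E := mvExp (MvPolynomial.C ϖ * S) with hE
  have hEp : E ^ p = mvExp (MvPolynomial.C (p * ϖ) * S) := by
    rw [hE, ← mvExp_nsmul hQ0]
    congr 1
    rw [nsmul_eq_mul, map_mul, map_natCast, mul_assoc]
  have hRs0 : MvPowerSeries.constantCoeff Rs = 0 := constantCoeff_coe_eq_zero hR0
  set g := E * (1 + ϖ • Rs) - 1 with hg
  have hg0 : MvPowerSeries.constantCoeff g = 0 := by
    rw [hg, map_sub, map_mul, hE, constantCoeff_mvExp _ hQ0, map_add, map_one,
      MvPowerSeries.constantCoeff_smul, hRs0, smul_zero]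
    ring
  set h₁ := mvExp (MvPolynomial.C (p * ϖ) * S) - 1 - (p * ϖ : ℂ_[p]) • (S : MvPowerSeries ι ℂ_[p])
    with hh₁
  have hh₁b : CoeffBound (‖(p : ℂ_[p])‖ * ‖ϖ‖) r h₁ :=
    coeffBound_mvExp_sub hϖ S hS0 hr0 hρ1 hSb hρp2
  set h₂ := ∑ j ∈ Finset.range (p - 2), p.choose (j + 2) • (ϖ • Rs) ^ (j + 2) with hh₂
  have hh₂b : CoeffBound (‖(p : ℂ_[p])‖ * ‖ϖ‖) r h₂ := by
    refine CoeffBound.sum (by positivity) hr0.le fun j hj => ?_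
    rw [Finset.mem_range] at hj
    obtain ⟨c, hc⟩ := hp.dvd_choose_self (k := j + 2) (by omega) (by omega)
    have h1 := (((hRpow (j + 2) (by omega)).smul (ϖ ^ (j + 2))).nsmul c).nsmul p
    rw [hc, mul_smul, smul_pow]
    refine h1.mono ?_ hr0.le
    have h2 := IsUltrametricDist.norm_natCast_le_one ℂ_[p] c
    have h3 : ‖ϖ ^ (j + 2)‖ ≤ ‖ϖ‖ ^ 2 := by
      rw [norm_pow]
      exact pow_le_pow_of_le_one hϖ0.le hϖ1.le (by omega)
    calc _ ≤ ‖(p : ℂ_[p])‖ * (1 * (‖ϖ‖ ^ 2 * ρ)) := by gcongr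
      _ = ‖(p : ℂ_[p])‖ * (‖ϖ‖ * (‖ϖ‖ * ρ)) := by ring
      _ ≤ ‖(p : ℂ_[p])‖ * (‖ϖ‖ * 1) := by gcongr
      _ = _ := by ring
  -- `ϖ ^ p = - p ϖ` turns the last term of the binomial expansion into a multiple of `p ϖ`
  have hϖp : ϖ ^ p = -(p * ϖ) := by
    have : ϖ ^ p = ϖ ^ (p - 1) * ϖ := by rw [← pow_succ, Nat.sub_add_cancel hp.one_le]
    rw [this, hϖ, neg_mul]
  have hbin : (1 + ϖ • Rs) ^ p = 1 + ((p * ϖ) • (Rs - Rs ^ p) + h₂) := by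
    have hp2 := hp.two_le
    have h2 : p - 1 = p - 2 + 1 := by omega
    have h3 : p - 2 + 2 = p := by omega
    rw [one_add_pow_eq_add_sum _ hp.pos, h2, Finset.sum_range_succ, ← hh₂, h3, Nat.choose_self,
      one_smul, smul_pow, hϖp, smul_sub, neg_smul, ← Nat.cast_smul_eq_nsmul ℂ_[p], smul_smul]
    abel
  set a := (p * ϖ : ℂ_[p]) • (S : MvPowerSeries ι ℂ_[p]) + h₁ with ha
  set b := (p * ϖ : ℂ_[p]) • (Rs - Rs ^ p) + h₂ with hb
  have hRb : CoeffBound ρ r (Rs - Rs ^ p) := by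
    have := hRpow 1 hp.one_le
    rw [pow_one] at this
    exact this.sub (hRpow p le_rfl)
  have hab : CoeffBound (‖(p : ℂ_[p])‖ * ‖ϖ‖ * ρ) r a := by
    refine CoeffBound.add ((hSb.smul _).mono ?_ hr0.le) (hh₁b.mono ?_ hr0.le)
    · rw [norm_mul]
    · exact le_mul_of_one_le_right (by positivity) hρ1
  have hbb : CoeffBound (‖(p : ℂ_[p])‖ * ‖ϖ‖ * ρ) r b := by
    refine CoeffBound.add ((hRb.smul _).mono ?_ hr0.le) (hh₂b.mono ?_ hr0.le)
    · rw [norm_mul]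
    · exact le_mul_of_one_le_right (by positivity) hρ1
  have hcongr : CoeffBound (‖(p : ℂ_[p])‖ * ‖ϖ‖) r ((p * ϖ : ℂ_[p]) •
      ((S : MvPowerSeries ι ℂ_[p]) + (Rs - Rs ^ p))) := by
    have h1 : (S : MvPowerSeries ι ℂ_[p]) + (Rs - Rs ^ p) =
        ((MvPolynomial.expand p R - R ^ p : MvPolynomial ι ℂ_[p]) : MvPowerSeries ι ℂ_[p]) := by
      rw [hSc, sub_add_sub_cancel, sub_eq_iff_eq_add, hRs, ← MvPolynomial.coe_pow,
        ← MvPolynomial.coe_add, sub_add_cancel]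
    rw [h1]
    refine ((CoeffBound.coe hκ (d := d) ?_ hr0 hr1.le).smul _).mono ?_ hr0.le
    · refine (MvPolynomial.totalDegree_sub _ _).trans (max_le ?_ ?_)
      · rw [MvPolynomial.totalDegree_expand, mul_comm]
        exact Nat.le_succ _
      · exact (MvPolynomial.totalDegree_pow R p).trans (Nat.le_succ _)
    · rw [norm_mul]
      exact mul_le_of_le_one_right (by positivity) hρκ
  have hpow : (1 + g) ^ p = 1 + ((p * ϖ : ℂ_[p]) • ((S : MvPowerSeries ι ℂ_[p]) + (Rs - Rs ^ p)) +
      (h₁ + h₂) + a * b) := by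
    have h1 : E ^ p = 1 + a := by
      rw [hEp, ha, hh₁]
      abel
    rw [hg, add_sub_cancel, mul_pow, h1, hbin, smul_add]
    ring
  have hgb : CoeffBound ‖ϖ‖ r g := by
    refine CoeffBound.of_pow_prime hr0 hϖ0 hϖ1.le ?_ hg0 hpow ?_
    · rw [norm_root_pow hϖ, norm_prime_padicComplex]
    · refine (hcongr.add (hh₁b.add hh₂b)).add ?_
      refine (hab.mul (by positivity) hr0.le hbb (by positivity)).mono ?_ hr0.le
      calc _ = ‖(p : ℂ_[p])‖ * ‖ϖ‖ * (‖(p : ℂ_[p])‖ * ρ ^ 2) * ‖ϖ‖ := by ring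
        _ ≤ ‖(p : ℂ_[p])‖ * ‖ϖ‖ * 1 * 1 := by gcongr
        _ = _ := by ring
  -- division by `1 + ϖ R`
  refine ⟨1, r, zero_lt_one, hr0, hr1, ?_⟩
  suffices H : ∀ n, ∀ I : ι →₀ ℕ, I.degree < n → ‖MvPowerSeries.coeff I E‖ ≤ 1 * r ^ I.degree from
    fun I => H _ I (Nat.lt_succ_self _)
  intro n
  induction n with
  | zero => intro I hI; omega
  | succ n ih =>
    intro I hI
    have h1 : E = 1 + g - (ϖ • Rs) * E := by
      rw [hg]
      ring
    rw [h1, map_sub, sub_eq_add_neg]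
    refine (PadicComplex.isNonarchimedean p _ _).trans (max_le ?_ ?_)
    · exact (CoeffBound.one hr0.le).add (hgb.mono hϖ1.le hr0.le) I
    · rw [norm_neg, MvPowerSeries.coeff_mul]
      refine IsUltrametricDist.norm_sum_le_of_forall_le_of_nonneg (by positivity) fun x hx => ?_
      have hdeg : x.1.degree + x.2.degree = I.degree := by
        rw [← map_add, Finset.HasAntidiagonal.mem_antidiagonal.mp hx]
      by_cases h2 : x.1.degree = 0
      · rw [(Finsupp.degree_eq_zero_iff x.1).mp h2, MvPowerSeries.coeff_zero_eq_constantCoeff,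
          MvPowerSeries.constantCoeff_smul, hRs0, smul_zero, zero_mul, norm_zero]
        positivity
      · have h3 := hRpow 1 hp.one_le
        rw [pow_one] at h3
        rw [norm_mul, ← hdeg, pow_add]
        calc _ ≤ (‖ϖ‖ * ρ * r ^ x.1.degree) * (1 * r ^ x.2.degree) :=
              mul_le_mul (h3.smul ϖ _) (ih _ (by omega)) (norm_nonneg _) (by positivity)
          _ ≤ (1 * r ^ x.1.degree) * (1 * r ^ x.2.degree) := by gcongr
          _ = _ := by ring

lemma constantCoeff_mul_X (R : MvPolynomial ι ℂ_[p]) (i : ι) :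
    MvPolynomial.constantCoeff (R * MvPolynomial.X i) = 0 := by
  simp

theorem isOverconvergent_frobSeries {n : ℕ} {ϖ : ℂ_[p]} (hϖ : ϖ ^ (p - 1) = -(p : ℂ_[p]))
    (P : MvPolynomial (Fin n) ℂ_[p]) (hP : ∀ m, ‖P.coeff m‖ ≤ 1)
    (hPp : ∀ m, ‖P.coeff m ^ p - P.coeff m‖ < 1) : IsOverconvergent (frobSeries ϖ P) := by
  classical
  have hp : p.Prime := Fact.out
  have key : ∀ m, (MvPolynomial.rename Fin.castSucc P * MvPolynomial.X (Fin.last n)).coeff m = 0 ∨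
      ∃ m', (MvPolynomial.rename Fin.castSucc P * MvPolynomial.X (Fin.last n)).coeff m =
        P.coeff m' := by
    intro m
    rw [MvPolynomial.coeff_mul_X']
    split_ifs
    · by_cases h : ∃ u, Finsupp.mapDomain Fin.castSucc u = m - Finsupp.single (Fin.last n) 1
      · obtain ⟨u, hu⟩ := h
        rw [← hu, MvPolynomial.coeff_rename_mapDomain _ (Fin.castSucc_injective n)]
        exact Or.inr ⟨u, rfl⟩
      · left
        refine MvPolynomial.coeff_rename_eq_zero _ _ _ fun u hu => absurd ⟨u, hu⟩ h
    · exact Or.inl rfl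
  refine isOverconvergent_mvExp_frobExponent hϖ _ (constantCoeff_mul_X _ _) (fun m => ?_)
    fun m => ?_
  · rcases key m with h | ⟨m', h⟩ <;> rw [h]
    · simp
    · exact hP m'
  · rcases key m with h | ⟨m', h⟩ <;> rw [h]
    · simp [hp.ne_zero]
    · exact hPp m'

end FrobeniusFactor

/-! ### Operators on power series -/

section Operators

variable {p : ℕ} [Fact p.Prime] {ι κ : Type}

lemma coeff_X_mul_eq (i : ι) (f : MvPowerSeries ι ℂ_[p]) (J : ι →₀ ℕ) :
    MvPowerSeries.coeff J (MvPowerSeries.X i * f) =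
      if J i = 0 then 0 else MvPowerSeries.coeff (J - Finsupp.single i 1) f := by
  classical
  rw [MvPowerSeries.X, MvPowerSeries.coeff_monomial_mul, one_mul]
  by_cases h : J i = 0
  · rw [if_pos h, if_neg]
    rw [Finsupp.single_le_iff]
    omega
  · rw [if_neg h, if_pos]
    rw [Finsupp.single_le_iff]
    omega

lemma coeff_add_single_X_mul (i : ι) (f : MvPowerSeries ι ℂ_[p]) (J : ι →₀ ℕ) :
    MvPowerSeries.coeff (J + Finsupp.single i 1) (MvPowerSeries.X i * f) =
      MvPowerSeries.coeff J f := by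
  rw [coeff_X_mul_eq, if_neg (by simp), add_tsub_cancel_right]

lemma sub_single_add_single {J : ι →₀ ℕ} {i : ι} (h : J i ≠ 0) :
    J - Finsupp.single i 1 + Finsupp.single i 1 = J := by
  rw [tsub_add_cancel_of_le]
  rw [Finsupp.single_le_iff]
  omega

lemma coeff_X_mul_pderiv (i : ι) (f : MvPowerSeries ι ℂ_[p]) (J : ι →₀ ℕ) :
    MvPowerSeries.coeff J (MvPowerSeries.X i * MvPowerSeries.pderiv ℂ_[p] i f) =
      J i * MvPowerSeries.coeff J f := by
  rw [coeff_X_mul_eq]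
  split_ifs with h
  · rw [h, Nat.cast_zero, zero_mul]
  · rw [MvPowerSeries.coeff_pderiv, sub_single_add_single h, mul_comm, Finsupp.tsub_apply,
      Finsupp.single_eq_same, Nat.cast_sub (Nat.one_le_iff_ne_zero.mpr h)]
    ring

lemma X_mul_injective (i : ι) :
    Function.Injective fun f : MvPowerSeries ι ℂ_[p] => MvPowerSeries.X i * f := by
  intro f g h
  ext J
  have := congrArg (MvPowerSeries.coeff (J + Finsupp.single i 1)) h
  simpa only [coeff_add_single_X_mul] using this

/-- The quotient in the division by the variable `z i`. -/
def shiftX (i : ι) : MvPowerSeries ι ℂ_[p] →ₗ[ℂ_[p]] MvPowerSeries ι ℂ_[p] where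
  toFun f := fun J => MvPowerSeries.coeff (J + Finsupp.single i 1) f
  map_add' _ _ := rfl
  map_smul' _ _ := rfl

lemma coeff_shiftX (i : ι) (f : MvPowerSeries ι ℂ_[p]) (J : ι →₀ ℕ) :
    MvPowerSeries.coeff J (shiftX i f) = MvPowerSeries.coeff (J + Finsupp.single i 1) f := rfl

lemma shiftX_X_mul (i : ι) (f : MvPowerSeries ι ℂ_[p]) :
    shiftX i (MvPowerSeries.X i * f) = f := by
  ext J
  rw [coeff_shiftX, coeff_add_single_X_mul]

lemma shiftX_X_mul_of_ne {i k : ι} (h : k ≠ i) (f : MvPowerSeries ι ℂ_[p]) :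
    shiftX i (MvPowerSeries.X k * f) = MvPowerSeries.X k * shiftX i f := by
  classical
  ext J
  have h1 : (J + Finsupp.single i 1 : ι →₀ ℕ) k = J k := by simp [h]
  rw [coeff_shiftX, coeff_X_mul_eq, coeff_X_mul_eq, h1]
  split_ifs with hJ
  · rfl
  · rw [coeff_shiftX, tsub_add_eq_add_tsub]
    rw [Finsupp.single_le_iff]
    omega

lemma shiftX_pderiv_of_ne {i k : ι} (h : k ≠ i) (f : MvPowerSeries ι ℂ_[p]) :
    shiftX i (MvPowerSeries.pderiv ℂ_[p] k f) = MvPowerSeries.pderiv ℂ_[p] k (shiftX i f) := by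
  classical
  ext J
  rw [coeff_shiftX, MvPowerSeries.coeff_pderiv, MvPowerSeries.coeff_pderiv, coeff_shiftX,
    add_right_comm]
  simp [Ne.symm h]

lemma CoeffBound.shiftX {C r : ℝ} {f : MvPowerSeries ι ℂ_[p]} (hf : CoeffBound C r f) (i : ι) :
    CoeffBound (C * r) r (shiftX i f) := by
  intro J
  rw [coeff_shiftX]
  refine (hf _).trans_eq ?_
  rw [map_add, Finsupp.degree_single]
  ring

lemma IsOverconvergent.shiftX {f : MvPowerSeries ι ℂ_[p]} (hf : IsOverconvergent f) (i : ι) :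
    IsOverconvergent (shiftX i f) := by
  obtain ⟨C, r, hC, hr, hr1, h⟩ := hf
  exact ⟨C * r, r, by positivity, hr, hr1, CoeffBound.shiftX h i⟩

lemma IsOverconvergent.killCompl {f : MvPowerSeries κ ℂ_[p]} (hf : IsOverconvergent f)
    (e : ι ↪ κ) : IsOverconvergent (MvPowerSeries.killCompl e f) := by
  obtain ⟨C, r, hC, hr, hr1, h⟩ := hf
  refine ⟨C, r, hC, hr, hr1, fun I => ?_⟩
  rw [MvPowerSeries.coeff_killCompl]
  refine (h _).trans_eq ?_
  rw [Finsupp.embDomain_eq_mapDomain, Finsupp.degree_mapDomain]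

lemma killCompl_pderiv (e : ι ↪ κ) (i : ι) (f : MvPowerSeries κ ℂ_[p]) :
    MvPowerSeries.killCompl e (MvPowerSeries.pderiv ℂ_[p] (e i) f) =
      MvPowerSeries.pderiv ℂ_[p] i (MvPowerSeries.killCompl e f) := by
  ext I
  rw [MvPowerSeries.coeff_killCompl, MvPowerSeries.coeff_pderiv, MvPowerSeries.coeff_pderiv,
    MvPowerSeries.coeff_killCompl, Finsupp.embDomain_apply_self, Finsupp.embDomain_add,
    Finsupp.embDomain_single]

lemma killCompl_coe_rename_mul (e : ι ↪ κ) (Q : MvPolynomial ι ℂ_[p]) (f : MvPowerSeries κ ℂ_[p]) :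
    MvPowerSeries.killCompl e
        (((MvPolynomial.rename e Q : MvPolynomial κ ℂ_[p]) : MvPowerSeries κ ℂ_[p]) * f) =
      (Q : MvPowerSeries ι ℂ_[p]) * MvPowerSeries.killCompl e f := by
  rw [map_mul, ← MvPowerSeries.rename_coe, MvPowerSeries.killCompl_rename_app]

/-- Division with remainder by the variable `z i`. -/
lemma rename_killCompl_add_X_mul_shiftX {m : ℕ} (i : Fin (m + 1))
    (f : MvPowerSeries (Fin (m + 1)) ℂ_[p]) :
    MvPowerSeries.rename i.succAboveEmb (MvPowerSeries.killCompl i.succAboveEmb f) +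
      MvPowerSeries.X i * shiftX i f = f := by
  classical
  ext J
  rw [map_add, coeff_X_mul_eq]
  by_cases h : J i = 0
  · rw [if_pos h, add_zero]
    have h1 : J ∈ Set.range (Finsupp.embDomain (M := ℕ) i.succAboveEmb) := by
      rw [Finsupp.mem_range_embDomain_iff]
      intro k hk
      have hki : k ≠ i := by
        rintro rfl
        simp [h] at hk
      obtain ⟨l, rfl⟩ := Fin.exists_succAbove_eq hki
      exact ⟨l, rfl⟩
    obtain ⟨I, rfl⟩ := h1
    rw [MvPowerSeries.coeff_embDomain_rename, MvPowerSeries.coeff_killCompl]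
  · rw [if_neg h, coeff_shiftX, sub_single_add_single h, MvPowerSeries.coeff_rename_eq_zero,
      zero_add]
    rintro ⟨I, rfl⟩
    refine h (Finsupp.mapDomain_of_notMem_range _ _ ?_)
    rintro ⟨l, hl⟩
    exact Fin.succAbove_ne i l hl

lemma shiftX_rename {m : ℕ} (i : Fin (m + 1)) (f : MvPowerSeries (Fin m) ℂ_[p]) :
    shiftX i (MvPowerSeries.rename i.succAboveEmb f) = 0 := by
  ext J
  rw [coeff_shiftX, MvPowerSeries.coeff_rename_eq_zero, map_zero]
  rintro ⟨I, hI⟩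
  have h := DFunLike.congr_fun hI i
  rw [Finsupp.mapDomain_of_notMem_range] at h
  · simp at h
  · rintro ⟨l, hl⟩
    exact Fin.succAbove_ne i l hl

/-- A linear map that commutes with the multiplication by variables commutes with the
multiplication by polynomials in these variables. -/
lemma map_coe_rename_mul {ι κ κ' : Type} (e : ι ↪ κ) (e' : ι ↪ κ')
    (φ : MvPowerSeries κ ℂ_[p] →ₗ[ℂ_[p]] MvPowerSeries κ' ℂ_[p])
    (h : ∀ i f, φ (MvPowerSeries.X (e i) * f) = MvPowerSeries.X (e' i) * φ f)
    (Q : MvPolynomial ι ℂ_[p]) (f : MvPowerSeries κ ℂ_[p]) :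
    φ (((MvPolynomial.rename e Q : MvPolynomial κ ℂ_[p]) : MvPowerSeries κ ℂ_[p]) * f) =
      ((MvPolynomial.rename e' Q : MvPolynomial κ' ℂ_[p]) : MvPowerSeries κ' ℂ_[p]) * φ f := by
  induction Q using MvPolynomial.induction_on generalizing f with
  | C a =>
    rw [MvPolynomial.rename_C, MvPolynomial.rename_C, MvPolynomial.coe_C, MvPolynomial.coe_C,
      ← MvPowerSeries.smul_eq_C_mul, ← MvPowerSeries.smul_eq_C_mul, map_smul]
  | add P Q hP hQ =>
    rw [map_add, map_add, MvPolynomial.coe_add, MvPolynomial.coe_add, add_mul, add_mul, map_add,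
      hP, hQ]
  | mul_X P i hP =>
    rw [map_mul (MvPolynomial.rename e), map_mul (MvPolynomial.rename e'), MvPolynomial.coe_mul,
      MvPolynomial.coe_mul, MvPolynomial.rename_X,
      MvPolynomial.rename_X, MvPolynomial.coe_X, MvPolynomial.coe_X, mul_assoc, mul_assoc, hP, h]

end Operators

/-! ### The substitution of a product of two variables -/

section Diagonal

variable {p : ℕ} [Fact p.Prime] {m : ℕ}

/-- The exponent of the monomial obtained from `z ^ I` by the substitution
`z σ = z ξ * z (ξ.succAbove σ)`. -/
def diagExp (ξ : Fin (m + 1)) (σ : Fin m) (I : Fin m →₀ ℕ) : Fin (m + 1) →₀ ℕ :=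
  Finsupp.embDomain ξ.succAboveEmb I + Finsupp.single ξ (I σ)

/-- The exponents of the variables other than `z ξ`. -/
def dropExp (ξ : Fin (m + 1)) (J : Fin (m + 1) →₀ ℕ) : Fin m →₀ ℕ :=
  Finsupp.equivFunOnFinite.symm fun k => J (ξ.succAbove k)

lemma dropExp_apply (ξ : Fin (m + 1)) (J : Fin (m + 1) →₀ ℕ) (k : Fin m) :
    dropExp ξ J k = J (ξ.succAbove k) := rfl

lemma diagExp_apply_self (ξ : Fin (m + 1)) (σ : Fin m) (I : Fin m →₀ ℕ) :
    diagExp ξ σ I ξ = I σ := by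
  rw [diagExp, Finsupp.add_apply, Finsupp.single_eq_same, Finsupp.embDomain_of_notMem_range, zero_add]
  rintro ⟨k, hk⟩
  exact Fin.succAbove_ne ξ k hk

lemma diagExp_apply_succAbove (ξ : Fin (m + 1)) (σ : Fin m) (I : Fin m →₀ ℕ) (k : Fin m) :
    diagExp ξ σ I (ξ.succAbove k) = I k := by
  have h := Finsupp.embDomain_apply_self ξ.succAboveEmb I k
  rw [Fin.succAboveEmb_apply] at h
  rw [diagExp, Finsupp.add_apply, h, Finsupp.single_eq_of_ne (Fin.succAbove_ne ξ k), add_zero]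

lemma dropExp_diagExp (ξ : Fin (m + 1)) (σ : Fin m) (I : Fin m →₀ ℕ) :
    dropExp ξ (diagExp ξ σ I) = I := by
  ext k
  rw [dropExp_apply, diagExp_apply_succAbove]

lemma diagExp_dropExp {ξ : Fin (m + 1)} {σ : Fin m} {J : Fin (m + 1) →₀ ℕ}
    (h : J ξ = J (ξ.succAbove σ)) : diagExp ξ σ (dropExp ξ J) = J := by
  ext k
  rcases eq_or_ne k ξ with rfl | hk
  · rw [diagExp_apply_self, dropExp_apply, h]
  · obtain ⟨l, rfl⟩ := Fin.exists_succAbove_eq hk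
    rw [diagExp_apply_succAbove, dropExp_apply]

lemma diagExp_add_single_of_ne (ξ : Fin (m + 1)) {σ k : Fin m} (h : k ≠ σ) (I : Fin m →₀ ℕ) :
    diagExp ξ σ (I + Finsupp.single k 1) =
      diagExp ξ σ I + Finsupp.single (ξ.succAbove k) 1 := by
  classical
  ext l
  rw [Finsupp.add_apply]
  rcases eq_or_ne l ξ with rfl | hl
  · simp [diagExp_apply_self, h]
  · obtain ⟨l, rfl⟩ := Fin.exists_succAbove_eq hl
    simp [diagExp_apply_succAbove, Finsupp.single_apply]

lemma diagExp_add_single_self (ξ : Fin (m + 1)) (σ : Fin m) (I : Fin m →₀ ℕ) :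
    diagExp ξ σ (I + Finsupp.single σ 1) =
      diagExp ξ σ I + Finsupp.single (ξ.succAbove σ) 1 + Finsupp.single ξ 1 := by
  classical
  ext l
  rw [Finsupp.add_apply, Finsupp.add_apply]
  rcases eq_or_ne l ξ with rfl | hl
  · simp [diagExp_apply_self]
  · obtain ⟨l, rfl⟩ := Fin.exists_succAbove_eq hl
    simp [diagExp_apply_succAbove, Finsupp.single_apply, Fin.succAbove_ne]

lemma degree_diagExp (ξ : Fin (m + 1)) (σ : Fin m) (I : Fin m →₀ ℕ) :
    (diagExp ξ σ I).degree = I.degree + I σ := by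
  rw [diagExp, map_add, Finsupp.degree_single, Finsupp.embDomain_eq_mapDomain,
    Finsupp.degree_mapDomain]

/-- The substitution `z σ = z ξ * z (ξ.succAbove σ)`. -/
def diagSub (ξ : Fin (m + 1)) (σ : Fin m) :
    MvPowerSeries (Fin m) ℂ_[p] →ₗ[ℂ_[p]] MvPowerSeries (Fin (m + 1)) ℂ_[p] where
  toFun f := fun J => if J ξ = J (ξ.succAbove σ) then MvPowerSeries.coeff (dropExp ξ J) f else 0
  map_add' f g := by
    funext J
    change (if J ξ = J (ξ.succAbove σ) then MvPowerSeries.coeff (dropExp ξ J) (f + g) else 0) =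
      (if J ξ = J (ξ.succAbove σ) then MvPowerSeries.coeff (dropExp ξ J) f else 0) +
      (if J ξ = J (ξ.succAbove σ) then MvPowerSeries.coeff (dropExp ξ J) g else 0)
    split_ifs <;> simp
  map_smul' a f := by
    funext J
    change (if J ξ = J (ξ.succAbove σ) then MvPowerSeries.coeff (dropExp ξ J) (a • f) else 0) =
      a * (if J ξ = J (ξ.succAbove σ) then MvPowerSeries.coeff (dropExp ξ J) f else 0)
    split_ifs <;> simp

/-- The coefficients of the monomials in the variables other than `z ξ`, `z (ξ.succAbove σ)` and
the product of these two. -/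
def diagPart (ξ : Fin (m + 1)) (σ : Fin m) :
    MvPowerSeries (Fin (m + 1)) ℂ_[p] →ₗ[ℂ_[p]] MvPowerSeries (Fin m) ℂ_[p] where
  toFun f := fun I => MvPowerSeries.coeff (diagExp ξ σ I) f
  map_add' _ _ := rfl
  map_smul' _ _ := rfl

lemma coeff_diagSub (ξ : Fin (m + 1)) (σ : Fin m) (f : MvPowerSeries (Fin m) ℂ_[p])
    (J : Fin (m + 1) →₀ ℕ) : MvPowerSeries.coeff J (diagSub ξ σ f) =
      if J ξ = J (ξ.succAbove σ) then MvPowerSeries.coeff (dropExp ξ J) f else 0 := rfl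

lemma coeff_diagPart (ξ : Fin (m + 1)) (σ : Fin m) (f : MvPowerSeries (Fin (m + 1)) ℂ_[p])
    (I : Fin m →₀ ℕ) : MvPowerSeries.coeff I (diagPart ξ σ f) =
      MvPowerSeries.coeff (diagExp ξ σ I) f := rfl

lemma coeff_diagExp_diagSub (ξ : Fin (m + 1)) (σ : Fin m) (f : MvPowerSeries (Fin m) ℂ_[p])
    (I : Fin m →₀ ℕ) : MvPowerSeries.coeff (diagExp ξ σ I) (diagSub ξ σ f) =
      MvPowerSeries.coeff I f := by
  rw [coeff_diagSub, if_pos (by rw [diagExp_apply_self, diagExp_apply_succAbove]),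
    dropExp_diagExp]

lemma diagPart_diagSub (ξ : Fin (m + 1)) (σ : Fin m) (f : MvPowerSeries (Fin m) ℂ_[p]) :
    diagPart ξ σ (diagSub ξ σ f) = f := by
  ext I
  rw [coeff_diagPart, coeff_diagExp_diagSub]

lemma coeff_diagSub_diagPart (ξ : Fin (m + 1)) (σ : Fin m)
    (f : MvPowerSeries (Fin (m + 1)) ℂ_[p]) (J : Fin (m + 1) →₀ ℕ) :
    MvPowerSeries.coeff J (diagSub ξ σ (diagPart ξ σ f)) =
      if J ξ = J (ξ.succAbove σ) then MvPowerSeries.coeff J f else 0 := by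
  rw [coeff_diagSub]
  split_ifs with h
  · rw [coeff_diagPart, diagExp_dropExp h]
  · rfl

/-- Power series in the image of the substitution are determined by their diagonal part. -/
lemma diagSub_eq_of_diagPart (ξ : Fin (m + 1)) (σ : Fin m) {f : MvPowerSeries (Fin m) ℂ_[p]}
    {g : MvPowerSeries (Fin (m + 1)) ℂ_[p]} (h : diagPart ξ σ g = f)
    (h0 : ∀ J : Fin (m + 1) →₀ ℕ, J ξ ≠ J (ξ.succAbove σ) → MvPowerSeries.coeff J g = 0) :
    diagSub ξ σ f = g := by
  ext J
  rw [← h, coeff_diagSub_diagPart]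
  split_ifs with hJ
  · rfl
  · rw [h0 J hJ]

lemma coeff_diagSub_of_ne {ξ : Fin (m + 1)} {σ : Fin m} (f : MvPowerSeries (Fin m) ℂ_[p])
    {J : Fin (m + 1) →₀ ℕ} (h : J ξ ≠ J (ξ.succAbove σ)) :
    MvPowerSeries.coeff J (diagSub ξ σ f) = 0 := by
  rw [coeff_diagSub, if_neg h]

lemma diagSub_X_mul_of_ne (ξ : Fin (m + 1)) {σ k : Fin m} (h : k ≠ σ)
    (f : MvPowerSeries (Fin m) ℂ_[p]) : diagSub ξ σ (MvPowerSeries.X k * f) =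
      MvPowerSeries.X (ξ.succAbove k) * diagSub ξ σ f := by
  classical
  refine diagSub_eq_of_diagPart ξ σ ?_ fun J hJ => ?_
  · ext I
    rw [coeff_diagPart, coeff_X_mul_eq, coeff_X_mul_eq, diagExp_apply_succAbove]
    split_ifs with hI
    · rfl
    · obtain ⟨I', rfl⟩ : ∃ I', I = I' + Finsupp.single k 1 := ⟨_, (sub_single_add_single hI).symm⟩
      rw [diagExp_add_single_of_ne ξ h, add_tsub_cancel_right, add_tsub_cancel_right,
        coeff_diagExp_diagSub]
  · rw [coeff_X_mul_eq]
    split_ifs with hI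
    · rfl
    · refine coeff_diagSub_of_ne _ ?_
      have h1 : ξ.succAbove σ ≠ ξ.succAbove k := fun hc => h (Fin.succAbove_right_injective hc).symm
      simpa [Finsupp.single_apply, Fin.succAbove_ne, h, Ne.symm h] using hJ

lemma diagSub_X_mul_self (ξ : Fin (m + 1)) (σ : Fin m) (f : MvPowerSeries (Fin m) ℂ_[p]) :
    diagSub ξ σ (MvPowerSeries.X σ * f) =
      MvPowerSeries.X ξ * (MvPowerSeries.X (ξ.succAbove σ) * diagSub ξ σ f) := by
  classical
  refine diagSub_eq_of_diagPart ξ σ ?_ fun J hJ => ?_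
  · ext I
    rw [coeff_diagPart, coeff_X_mul_eq, coeff_X_mul_eq σ, diagExp_apply_self]
    split_ifs with hI
    · rfl
    · obtain ⟨I', rfl⟩ : ∃ I', I = I' + Finsupp.single σ 1 := ⟨_, (sub_single_add_single hI).symm⟩
      rw [diagExp_add_single_self, add_tsub_cancel_right, add_tsub_cancel_right,
        coeff_add_single_X_mul, coeff_diagExp_diagSub]
  · rw [coeff_X_mul_eq]
    split_ifs with hI
    · rfl
    · rw [coeff_X_mul_eq]
      split_ifs with hI'
      · rfl
      · refine coeff_diagSub_of_ne _ ?_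
        simp [Fin.succAbove_ne] at hJ hI' ⊢
        omega

lemma pderiv_diagSub_of_ne (ξ : Fin (m + 1)) {σ k : Fin m} (h : k ≠ σ)
    (f : MvPowerSeries (Fin m) ℂ_[p]) :
    MvPowerSeries.pderiv ℂ_[p] (ξ.succAbove k) (diagSub ξ σ f) =
      diagSub ξ σ (MvPowerSeries.pderiv ℂ_[p] k f) := by
  classical
  refine (diagSub_eq_of_diagPart ξ σ ?_ fun J hJ => ?_).symm
  · ext I
    rw [coeff_diagPart, MvPowerSeries.coeff_pderiv, MvPowerSeries.coeff_pderiv,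
      ← diagExp_add_single_of_ne ξ h, coeff_diagExp_diagSub, diagExp_apply_succAbove]
  · rw [MvPowerSeries.coeff_pderiv, coeff_diagSub_of_ne, zero_mul]
    simpa [Finsupp.single_apply, Fin.succAbove_ne, h, Ne.symm h] using hJ

lemma pderiv_self_diagSub (ξ : Fin (m + 1)) (σ : Fin m) (f : MvPowerSeries (Fin m) ℂ_[p]) :
    MvPowerSeries.pderiv ℂ_[p] ξ (diagSub ξ σ f) =
      MvPowerSeries.X (ξ.succAbove σ) * diagSub ξ σ (MvPowerSeries.pderiv ℂ_[p] σ f) := by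
  classical
  ext J
  rw [MvPowerSeries.coeff_pderiv, coeff_X_mul_eq]
  by_cases h : J (ξ.succAbove σ) = J ξ + 1
  · rw [if_neg (by omega)]
    obtain ⟨J', rfl⟩ : ∃ J', J = J' + Finsupp.single (ξ.succAbove σ) 1 :=
      ⟨_, (sub_single_add_single (by omega)).symm⟩
    have h1 : J' ξ = J' (ξ.succAbove σ) := by
      simp at h
      omega
    obtain ⟨I, rfl⟩ : ∃ I, J' = diagExp ξ σ I := ⟨_, (diagExp_dropExp h1).symm⟩
    rw [add_tsub_cancel_right, ← diagExp_add_single_self, coeff_diagExp_diagSub,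
      coeff_diagExp_diagSub, MvPowerSeries.coeff_pderiv]
    simp [diagExp_apply_self]
  · rw [coeff_diagSub_of_ne, zero_mul]
    · split_ifs with h0
      · rfl
      · rw [coeff_diagSub_of_ne]
        simp at h ⊢
        omega
    · simp at h ⊢
      omega

lemma pderiv_succAbove_diagSub (ξ : Fin (m + 1)) (σ : Fin m) (f : MvPowerSeries (Fin m) ℂ_[p]) :
    MvPowerSeries.pderiv ℂ_[p] (ξ.succAbove σ) (diagSub ξ σ f) =
      MvPowerSeries.X ξ * diagSub ξ σ (MvPowerSeries.pderiv ℂ_[p] σ f) := by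
  classical
  ext J
  rw [MvPowerSeries.coeff_pderiv, coeff_X_mul_eq]
  by_cases h : J ξ = J (ξ.succAbove σ) + 1
  · rw [if_neg (by omega)]
    obtain ⟨J', rfl⟩ : ∃ J', J = J' + Finsupp.single ξ 1 :=
      ⟨_, (sub_single_add_single (by omega)).symm⟩
    have h1 : J' ξ = J' (ξ.succAbove σ) := by
      simp at h
      omega
    obtain ⟨I, rfl⟩ : ∃ I, J' = diagExp ξ σ I := ⟨_, (diagExp_dropExp h1).symm⟩
    rw [add_tsub_cancel_right, add_right_comm, ← diagExp_add_single_self, coeff_diagExp_diagSub,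
      coeff_diagExp_diagSub, MvPowerSeries.coeff_pderiv]
    simp [diagExp_apply_succAbove]
  · rw [coeff_diagSub_of_ne, zero_mul]
    · split_ifs with h0
      · rfl
      · rw [coeff_diagSub_of_ne]
        simp at h ⊢
        omega
    · simp at h ⊢
      omega

lemma IsOverconvergent.diagSub {f : MvPowerSeries (Fin m) ℂ_[p]} (hf : IsOverconvergent f)
    (ξ : Fin (m + 1)) (σ : Fin m) : IsOverconvergent (diagSub ξ σ f) := by
  obtain ⟨C, r, hC, hr, hr1, h⟩ := hf
  -- the substitution at most doubles the degree of a monomial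
  refine ⟨C, Real.sqrt r, hC, Real.sqrt_pos.mpr hr, ?_, fun J => ?_⟩
  · rw [Real.sqrt_lt' one_pos]
    simpa using hr1
  by_cases hJ : J ξ = J (ξ.succAbove σ)
  · obtain ⟨I, rfl⟩ : ∃ I, J = diagExp ξ σ I := ⟨_, (diagExp_dropExp hJ).symm⟩
    rw [coeff_diagExp_diagSub, degree_diagExp]
    refine (h I).trans ?_
    gcongr
    have h1 : I σ ≤ I.degree := Finsupp.le_degree σ I
    have h2 : r ^ I.degree = Real.sqrt r ^ (2 * I.degree) := by
      rw [pow_mul, Real.sq_sqrt hr.le]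
    rw [h2]
    refine pow_le_pow_of_le_one (Real.sqrt_nonneg r) ?_ (by omega)
    exact Real.sqrt_le_one.mpr hr1.le
  · rw [coeff_diagSub_of_ne _ hJ, norm_zero]
    positivity

lemma IsOverconvergent.diagPart {f : MvPowerSeries (Fin (m + 1)) ℂ_[p]} (hf : IsOverconvergent f)
    (ξ : Fin (m + 1)) (σ : Fin m) : IsOverconvergent (diagPart ξ σ f) := by
  obtain ⟨C, r, hC, hr, hr1, h⟩ := hf
  refine ⟨C, r, hC, hr, hr1, fun I => (h _).trans ?_⟩
  rw [degree_diagExp]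
  exact mul_le_mul_of_nonneg_left (pow_le_pow_of_le_one hr.le hr1.le (Nat.le_add_right _ _)) hC.le

end Diagonal

/-! ### Division by weights -/

section Weight

variable {p : ℕ} [Fact p.Prime] {m : ℕ}

/-- The weight of a monomial for the vector field `x ∂_x - y ∂_y`, where `x` and `y` are the
variables `z ξ` and `z η`. -/
def weightExp (ξ η : Fin m) (J : Fin m →₀ ℕ) : ℤ := J ξ - J η

/-- Division of the part of weight `w` by `w + c`; the part of weight `-c` is annihilated. -/
def weightDiv (ξ η : Fin m) (c : ℤ) :
    MvPowerSeries (Fin m) ℂ_[p] →ₗ[ℂ_[p]] MvPowerSeries (Fin m) ℂ_[p] where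
  toFun f := fun J => ((weightExp ξ η J + c : ℤ) : ℂ_[p])⁻¹ * MvPowerSeries.coeff J f
  map_add' f g := by
    funext J
    change _ * MvPowerSeries.coeff J (f + g) = _ * _ + _ * _
    rw [map_add, mul_add]
  map_smul' a f := by
    funext J
    change _ * MvPowerSeries.coeff J (a • f) = a * (_ * _)
    rw [MvPowerSeries.coeff_smul]
    ring

lemma coeff_weightDiv (ξ η : Fin m) (c : ℤ) (f : MvPowerSeries (Fin m) ℂ_[p])
    (J : Fin m →₀ ℕ) : MvPowerSeries.coeff J (weightDiv ξ η c f) =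
      ((weightExp ξ η J + c : ℤ) : ℂ_[p])⁻¹ * MvPowerSeries.coeff J f := rfl

lemma weightDiv_X_mul {ξ η : Fin m} {c c' : ℤ} {i : Fin m}
    (h : c = c' + weightExp ξ η (Finsupp.single i 1)) (f : MvPowerSeries (Fin m) ℂ_[p]) :
    weightDiv ξ η c' (MvPowerSeries.X i * f) = MvPowerSeries.X i * weightDiv ξ η c f := by
  ext J
  rw [coeff_weightDiv, coeff_X_mul_eq, coeff_X_mul_eq]
  split_ifs with hJ
  · rw [mul_zero]
  · obtain ⟨J', rfl⟩ : ∃ J', J = J' + Finsupp.single i 1 := ⟨_, (sub_single_add_single hJ).symm⟩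
    rw [add_tsub_cancel_right, coeff_weightDiv]
    congr 3
    rw [h]
    simp only [weightExp, Finsupp.add_apply]
    push_cast
    ring

lemma pderiv_weightDiv {ξ η : Fin m} {c c' : ℤ} {i : Fin m}
    (h : c' = c + weightExp ξ η (Finsupp.single i 1)) (f : MvPowerSeries (Fin m) ℂ_[p]) :
    MvPowerSeries.pderiv ℂ_[p] i (weightDiv ξ η c f) =
      weightDiv ξ η c' (MvPowerSeries.pderiv ℂ_[p] i f) := by
  ext J
  rw [MvPowerSeries.coeff_pderiv, coeff_weightDiv, coeff_weightDiv, MvPowerSeries.coeff_pderiv,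
    mul_assoc]
  congr 3
  rw [h]
  simp only [weightExp, Finsupp.add_apply]
  push_cast
  ring

lemma exists_forall_mul_pow_le {r s : ℝ} (hr : 0 < r) (hrs : r < s) :
    ∃ B : ℝ, 0 < B ∧ ∀ k : ℕ, (k + 1 : ℝ) * r ^ k ≤ B * s ^ k := by
  have hs : 0 < s := hr.trans hrs
  have h1 : r / s < 1 := (div_lt_one hs).mpr hrs
  have h2 := (tendsto_self_mul_const_pow_of_lt_one (r := r / s) (by positivity) h1).add
    (tendsto_pow_atTop_nhds_zero_of_lt_one (r := r / s) (by positivity) h1)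
  obtain ⟨B, hB⟩ := h2.bddAbove_range
  refine ⟨max B 1, by positivity, fun k => ?_⟩
  have h3 : (k : ℝ) * (r / s) ^ k + (r / s) ^ k ≤ B := hB ⟨k, rfl⟩
  have h4 : (k + 1 : ℝ) * r ^ k = ((k : ℝ) * (r / s) ^ k + (r / s) ^ k) * s ^ k := by
    rw [div_pow]
    field_simp
  rw [h4]
  gcongr
  exact h3.trans (le_max_left _ _)

/-- The inverses of nonzero integers grow at most linearly. -/
lemma norm_inv_intCast_le (k : ℤ) : ‖((k : ℤ) : ℂ_[p])⁻¹‖ ≤ |(k : ℝ)| := by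
  rcases eq_or_ne k 0 with rfl | hk
  · simp
  · have h1 := inv_le_norm_natCast (p := p) (n := k.natAbs) (Int.natAbs_ne_zero.mpr hk)
    have h2 : ‖((k.natAbs : ℕ) : ℂ_[p])‖ = ‖(k : ℂ_[p])‖ := by
      rcases Int.natAbs_eq k with h | h
      · conv_rhs => rw [h]
        simp
      · conv_rhs => rw [h]
        simp
    rw [norm_inv, ← h2]
    refine h1.trans_eq ?_
    rw [Nat.cast_natAbs, Int.cast_abs]

lemma IsOverconvergent.of_mul_degree {ι : Type} {f : MvPowerSeries ι ℂ_[p]}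
    (hf : IsOverconvergent f) {g : MvPowerSeries ι ℂ_[p]} {A : ℝ} (hA : 0 < A)
    (h : ∀ J, ‖MvPowerSeries.coeff J g‖ ≤ A * (J.degree + 1) * ‖MvPowerSeries.coeff J f‖) :
    IsOverconvergent g := by
  obtain ⟨C, r, hC, hr, hr1, hb⟩ := hf
  obtain ⟨s, hs, hs1⟩ := exists_between hr1
  obtain ⟨B, hB, hBk⟩ := exists_forall_mul_pow_le hr hs
  refine ⟨A * C * B, s, by positivity, hr.trans hs, hs1, fun J => (h J).trans ?_⟩
  calc _ ≤ A * (J.degree + 1) * (C * r ^ J.degree) := by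
        gcongr
        exact hb J
    _ = A * C * ((J.degree + 1) * r ^ J.degree) := by ring
    _ ≤ A * C * (B * s ^ J.degree) :=
        mul_le_mul_of_nonneg_left (hBk _) (by positivity)
    _ = _ := by ring

lemma IsOverconvergent.weightDiv {f : MvPowerSeries (Fin m) ℂ_[p]} (hf : IsOverconvergent f)
    (ξ η : Fin m) (c : ℤ) : IsOverconvergent (weightDiv ξ η c f) := by
  refine hf.of_mul_degree (A := 1 + |(c : ℝ)|) (by positivity) fun J => ?_
  rw [coeff_weightDiv, norm_mul]
  gcongr
  refine (norm_inv_intCast_le _).trans ?_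
  have h1 : (J ξ : ℝ) ≤ J.degree := by exact_mod_cast Finsupp.le_degree ξ J
  have h2 : (J η : ℝ) ≤ J.degree := by exact_mod_cast Finsupp.le_degree η J
  have h3 : |((weightExp ξ η J : ℤ) : ℝ)| ≤ J.degree := by
    rw [weightExp]
    push_cast
    rw [abs_le]
    constructor
    · have : (0 : ℝ) ≤ J ξ := by positivity
      linarith
    · have : (0 : ℝ) ≤ J η := by positivity
      linarith
  push_cast
  have h4 := abs_add_le ((weightExp ξ η J : ℤ) : ℝ) c
  have h5 : (0 : ℝ) ≤ J.degree := by positivity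
  nlinarith [abs_nonneg (c : ℝ)]

/-- The Euler operator inverts the division by weights, up to the part of weight zero. -/
lemma euler_weightDiv (ξ η : Fin m) (c : ℤ) (f : MvPowerSeries (Fin m) ℂ_[p]) (J : Fin m →₀ ℕ) :
    MvPowerSeries.coeff J (MvPowerSeries.X ξ * MvPowerSeries.pderiv ℂ_[p] ξ (weightDiv ξ η c f) -
      MvPowerSeries.X η * MvPowerSeries.pderiv ℂ_[p] η (weightDiv ξ η c f) +
        (c : ℂ_[p]) • weightDiv ξ η c f) =
      if weightExp ξ η J + c = 0 then 0 else MvPowerSeries.coeff J f := by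
  rw [map_add, map_sub, coeff_X_mul_pderiv, coeff_X_mul_pderiv, MvPowerSeries.coeff_smul,
    coeff_weightDiv]
  have h : (J ξ : ℂ_[p]) * (((weightExp ξ η J + c : ℤ) : ℂ_[p])⁻¹ * MvPowerSeries.coeff J f) -
      J η * (((weightExp ξ η J + c : ℤ) : ℂ_[p])⁻¹ * MvPowerSeries.coeff J f) +
      (c : ℂ_[p]) * (((weightExp ξ η J + c : ℤ) : ℂ_[p])⁻¹ * MvPowerSeries.coeff J f) =
      ((weightExp ξ η J + c : ℤ) : ℂ_[p]) * ((weightExp ξ η J + c : ℤ) : ℂ_[p])⁻¹ *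
        MvPowerSeries.coeff J f := by
    conv_rhs => rw [weightExp]
    push_cast
    simp only [weightExp]
    push_cast
    ring
  rw [h]
  split_ifs with h0
  · rw [h0]
    simp
  · rw [mul_inv_cancel₀ (by exact_mod_cast h0), one_mul]

end Weight

/-! ### Division by `∂_t + ϖ (P + s)` -/

section Neumann

variable {p : ℕ} [Fact p.Prime] {ι : Type}

lemma eq_zero_of_forall_coeffBound {f : MvPowerSeries ι ℂ_[p]} {r : ℝ} {β : ℕ → ℝ}
    (hβ : Filter.Tendsto β Filter.atTop (nhds 0)) (h : ∀ j, CoeffBound (β j) r f) : f = 0 := by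
  ext J
  have h1 : ‖MvPowerSeries.coeff J f‖ ≤ 0 := by
    have h2 := hβ.mul_const (r ^ J.degree)
    rw [zero_mul] at h2
    exact ge_of_tendsto' h2 fun j => h j J
  rw [map_zero, norm_le_zero_iff.mp h1]

/-- The Neumann series of an operator whose powers tend to zero coefficientwise, uniformly with
respect to some radius. -/
lemma exists_sub_map_eq (N : MvPowerSeries ι ℂ_[p] →ₗ[ℂ_[p]] MvPowerSeries ι ℂ_[p]) {r K : ℝ}
    (hr : 0 < r)
    (hN : ∀ C g, 0 ≤ C → CoeffBound C r g → CoeffBound (K * C) r (N g))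
    {β : ℕ → ℝ} (hβ0 : ∀ j, 0 ≤ β j) (hβ : Filter.Tendsto β Filter.atTop (nhds 0))
    {f : MvPowerSeries ι ℂ_[p]} (h : ∀ j, CoeffBound (β j) r ((N ^ j) f)) :
    ∃ B g, 0 < B ∧ CoeffBound B r g ∧ g - N g = f := by
  obtain ⟨B, hB⟩ := hβ.bddAbove_range
  have hB' : ∀ j, β j ≤ max B 1 := fun j => (hB ⟨j, rfl⟩).trans (le_max_left _ _)
  have hsum : ∀ J, Summable fun j => MvPowerSeries.coeff J ((N ^ j) f) := by
    intro J
    refine NonarchimedeanAddGroup.summable_of_tendsto_cofinite_zero ?_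
    rw [Nat.cofinite_eq_atTop]
    have h2 := hβ.mul_const (r ^ J.degree)
    rw [zero_mul] at h2
    exact squeeze_zero_norm (fun j => h j J) h2
  let g : MvPowerSeries ι ℂ_[p] := fun J => ∑' j, MvPowerSeries.coeff J ((N ^ j) f)
  have hg : ∀ J, MvPowerSeries.coeff J g = ∑' j, MvPowerSeries.coeff J ((N ^ j) f) := fun _ => rfl
  let S : ℕ → MvPowerSeries ι ℂ_[p] := fun k => ∑ j ∈ Finset.range k, (N ^ j) f
  have hR : ∀ k ε, (∀ j, k ≤ j → β j ≤ ε) → CoeffBound ε r (g - S k) := by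
    intro k ε hε J
    have h1 : MvPowerSeries.coeff J (g - S k) =
        ∑' j, MvPowerSeries.coeff J ((N ^ (j + k)) f) := by
      rw [map_sub, hg, map_sum, ← (hsum J).sum_add_tsum_nat_add k, add_sub_cancel_left]
    have hε0 : 0 ≤ ε := (hβ0 k).trans (hε k le_rfl)
    rw [h1]
    refine IsUltrametricDist.norm_tsum_le_of_forall_le_of_nonneg (by positivity) fun j => ?_
    refine (h (j + k) J).trans ?_
    exact mul_le_mul_of_nonneg_right (hε _ (Nat.le_add_left _ _)) (by positivity)
  have hS : ∀ k, S k - N (S k) = f - (N ^ k) f := by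
    intro k
    induction k with
    | zero => simp [S]
    | succ k ih =>
      have h1 : S (k + 1) = S k + (N ^ k) f := Finset.sum_range_succ _ _
      have h2 : N ((N ^ k) f) = (N ^ (k + 1)) f := by
        rw [pow_succ']
        rfl
      rw [h1, map_add, h2, add_sub_add_comm, ih]
      abel
  refine ⟨max B 1, g, by positivity, ?_, ?_⟩
  · have := hR 0 _ fun j _ => hB' j
    simpa [S] using this
  · rw [← sub_eq_zero]
    ext J
    rw [map_zero, ← norm_le_zero_iff]
    refine le_of_forall_pos_le_add fun ε hε => ?_
    have hε' : 0 < ε / ((max 1 K) * r ^ J.degree) := by positivity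
    obtain ⟨k, hk⟩ := (hβ.eventually (gt_mem_nhds hε')).exists_forall_of_atTop
    have hk' : ∀ j, k ≤ j → β j ≤ ε / ((max 1 K) * r ^ J.degree) := fun j hj => (hk j hj).le
    have h1 := hR k _ hk'
    have h2 := hN _ _ hε'.le h1
    have h3 : g - N g - f = (g - S k) - N (g - S k) - (N ^ k) f := by
      rw [map_sub]
      have := hS k
      have h4 : f = S k - N (S k) + (N ^ k) f := by rw [this]; abel
      conv_lhs => rw [h4]
      abel
    have hle : ε / ((max 1 K) * r ^ J.degree) ≤ max 1 K * (ε / ((max 1 K) * r ^ J.degree)) :=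
      le_mul_of_one_le_left hε'.le (le_max_left _ _)
    have h5 : CoeffBound (max 1 K * (ε / ((max 1 K) * r ^ J.degree))) r (g - N g - f) := by
      rw [h3]
      refine ((h1.mono hle hr.le).sub (h2.mono ?_ hr.le)).sub
        ((h k).mono ((hk' k le_rfl).trans hle) hr.le)
      exact mul_le_mul_of_nonneg_right (le_max_right _ _) hε'.le
    refine (h5 J).trans_eq ?_
    rw [zero_add]
    field_simp

lemma coeff_iterate_pderiv (i : ι) (k : ℕ) (f : MvPowerSeries ι ℂ_[p]) (J : ι →₀ ℕ) :
    MvPowerSeries.coeff J (((MvPowerSeries.pderiv ℂ_[p] i).toLinearMap ^ k) f) =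
      ((J i + 1).ascFactorial k : ℕ) * MvPowerSeries.coeff (J + Finsupp.single i k) f := by
  induction k generalizing f with
  | zero => simp
  | succ k ih =>
    rw [pow_succ, Module.End.mul_apply, ih, Nat.ascFactorial_succ, Derivation.coeFn_coe,
      MvPowerSeries.coeff_pderiv, add_assoc, ← Finsupp.single_add,
      Finsupp.add_apply, Finsupp.single_eq_same]
    push_cast
    ring

lemma CoeffBound.iterate_pderiv {C r : ℝ} (hC : 0 ≤ C) (hr : 0 ≤ r) (hr1 : r ≤ 1)
    {f : MvPowerSeries ι ℂ_[p]} (hf : CoeffBound C r f) {ϖ c : ℂ_[p]}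
    (hϖ : ϖ ^ (p - 1) = -(p : ℂ_[p])) (hc : ‖c‖ = ‖ϖ⁻¹‖) (i : ι) (k : ℕ) :
    CoeffBound (p * (k + 1) * C) r
      (((c • (MvPowerSeries.pderiv ℂ_[p] i).toLinearMap) ^ k) f) := by
  intro J
  rw [smul_pow, LinearMap.smul_apply, MvPowerSeries.coeff_smul, coeff_iterate_pderiv,
    Nat.ascFactorial_eq_factorial_mul_choose, Nat.cast_mul, ← mul_assoc, ← mul_assoc, norm_mul,
    norm_mul, mul_comm (_ ^ k), norm_mul, norm_pow, hc, ← norm_pow, ← norm_mul]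
  have h1 := norm_factorial_div_root_pow_le hϖ k
  have h2 := IsUltrametricDist.norm_natCast_le_one ℂ_[p] ((J i + k).choose k)
  have h3 : ‖MvPowerSeries.coeff (J + Finsupp.single i k) f‖ ≤ C * r ^ J.degree := by
    refine (hf _).trans (mul_le_mul_of_nonneg_left (pow_le_pow_of_le_one hr hr1 ?_) hC)
    rw [map_add]
    exact Nat.le_add_right _ _
  calc _ ≤ (p * (k + 1) : ℝ) * 1 * (C * r ^ J.degree) := by gcongr
    _ = _ := by ring

lemma CoeffBound.iterate_shiftX {C r : ℝ} {f : MvPowerSeries ι ℂ_[p]} (hf : CoeffBound C r f)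
    (i : ι) (k : ℕ) : CoeffBound (C * r ^ k) r ((_root_.shiftX i ^ k) f) := by
  induction k with
  | zero => simpa using hf
  | succ k ih =>
    rw [pow_succ' (_root_.shiftX i), Module.End.mul_apply, pow_succ, ← mul_assoc]
    exact ih.shiftX i

/-- The operator `f ↦ (c ∂_t + Q) (f / s)`, with `f / s` the quotient in the division by the
variable `s`. -/
def divOp (c : ℂ_[p]) (Q : MvPowerSeries ι ℂ_[p]) (τ σ : ι) :
    MvPowerSeries ι ℂ_[p] →ₗ[ℂ_[p]] MvPowerSeries ι ℂ_[p] :=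
  (c • (MvPowerSeries.pderiv ℂ_[p] τ).toLinearMap + LinearMap.mulLeft ℂ_[p] Q) * shiftX σ

variable {ϖ c : ℂ_[p]} {Q : MvPowerSeries ι ℂ_[p]} {τ σ : ι}

lemma divOp_apply (f : MvPowerSeries ι ℂ_[p]) : divOp c Q τ σ f =
    c • MvPowerSeries.pderiv ℂ_[p] τ (shiftX σ f) + Q * shiftX σ f := rfl

lemma CoeffBound.divOp {K r : ℝ} (hK : 0 ≤ K) (hr : 0 ≤ r) (hr1 : r ≤ 1)
    (hϖ : ϖ ^ (p - 1) = -(p : ℂ_[p])) (hc : ‖c‖ = ‖ϖ⁻¹‖) (hQ : CoeffBound K r Q) {C : ℝ} (hC : 0 ≤ C)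
    {f : MvPowerSeries ι ℂ_[p]} (hf : CoeffBound C r f) :
    CoeffBound ((p * 2 + K) * C) r (divOp c Q τ σ f) := by
  rw [divOp_apply]
  have h0 : CoeffBound C r (_root_.shiftX σ f) :=
    (hf.shiftX σ).mono (mul_le_of_le_one_right hC hr1) hr
  have h1 := h0.iterate_pderiv hC hr hr1 hϖ hc τ 1
  rw [pow_one] at h1
  have h2 := CoeffBound.mul hK hr hQ h0 hC
  refine CoeffBound.add (h1.mono ?_ hr) (h2.mono ?_ hr)
  · rw [add_mul, Nat.cast_one, one_add_one_eq_two]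
    exact le_add_of_nonneg_right (by positivity)
  · rw [add_mul]
    exact le_add_of_nonneg_left (by positivity)

lemma divOp_pow (hτσ : τ ≠ σ) (hQτ : MvPowerSeries.pderiv ℂ_[p] τ Q = 0)
    (hQσ : ∀ f, shiftX σ (Q * f) = Q * shiftX σ f) (j : ℕ) (f : MvPowerSeries ι ℂ_[p]) :
    (divOp c Q τ σ ^ j) f = ∑ i ∈ Finset.range (j + 1),
      ((c • (MvPowerSeries.pderiv ℂ_[p] τ).toLinearMap) ^ i)
        (Q ^ (j - i) * (j.choose i • (shiftX σ ^ j) f)) := by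
  set T := c • (MvPowerSeries.pderiv ℂ_[p] τ).toLinearMap with hT
  have hTQ : Commute T (LinearMap.mulLeft ℂ_[p] Q) := by
    refine LinearMap.ext fun g => ?_
    change c • MvPowerSeries.pderiv ℂ_[p] τ (Q * g) = Q * c • MvPowerSeries.pderiv ℂ_[p] τ g
    rw [Derivation.leibniz, hQτ, smul_zero, add_zero, smul_eq_mul, mul_smul_comm]
  have hTS : Commute T (shiftX σ) := by
    refine LinearMap.ext fun g => ?_
    change c • MvPowerSeries.pderiv ℂ_[p] τ (shiftX σ g) =
      shiftX σ (c • MvPowerSeries.pderiv ℂ_[p] τ g)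
    rw [map_smul, shiftX_pderiv_of_ne hτσ]
  have hQS : Commute (LinearMap.mulLeft ℂ_[p] Q) (shiftX σ) :=
    LinearMap.ext fun g => (hQσ g).symm
  have h1 : divOp c Q τ σ ^ j =
      (∑ i ∈ Finset.range (j + 1), T ^ i * LinearMap.mulLeft ℂ_[p] Q ^ (j - i) *
        (j.choose i : Module.End ℂ_[p] (MvPowerSeries ι ℂ_[p]))) * shiftX σ ^ j := by
    rw [divOp, (hTS.add_left hQS).mul_pow, hTQ.add_pow]
  rw [h1, Module.End.mul_apply, LinearMap.sum_apply]
  refine Finset.sum_congr rfl fun i _ => ?_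
  rw [Module.End.mul_apply, Module.End.mul_apply, LinearMap.pow_mulLeft, LinearMap.mulLeft_apply,
    Module.End.natCast_apply]

/-- The powers of `divOp` tend to zero on an overconvergent power series: the quotient by the `j`-th
power of `s` gains a geometric factor, which outweighs the growth of `Q ^ j` and of `∂_t ^ i / ϖ ^ i`
for `i ≤ j`. -/
lemma exists_coeffBound_divOp_pow (hϖ : ϖ ^ (p - 1) = -(p : ℂ_[p])) (hc : ‖c‖ = ‖ϖ⁻¹‖) (hτσ : τ ≠ σ)
    {Q : MvPolynomial ι ℂ_[p]} (hint : ∀ m, ‖Q.coeff m‖ ≤ 1)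
    (hQτ : MvPowerSeries.pderiv ℂ_[p] τ (Q : MvPowerSeries ι ℂ_[p]) = 0)
    (hQσ : ∀ f, shiftX σ ((Q : MvPowerSeries ι ℂ_[p]) * f) =
      (Q : MvPowerSeries ι ℂ_[p]) * shiftX σ f)
    {f : MvPowerSeries ι ℂ_[p]} (hf : IsOverconvergent f) :
    ∃ K r : ℝ, ∃ β : ℕ → ℝ, 0 < r ∧ r < 1 ∧ 0 ≤ K ∧ CoeffBound K r (Q : MvPowerSeries ι ℂ_[p]) ∧
      (∀ j, 0 ≤ β j) ∧ Filter.Tendsto β Filter.atTop (nhds 0) ∧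
      ∀ j, CoeffBound (β j) r ((divOp c (Q : MvPowerSeries ι ℂ_[p]) τ σ ^ j) f) := by
  obtain ⟨C, r₀, hC, hr₀, hr₀1, hf⟩ := isOverconvergent_iff.mp hf
  set d := Q.totalDegree with hd
  -- the radius is so close to one that the growth of `Q ^ j` is dominated by the decay of the
  -- quotient by the `j`-th power of the variable
  obtain ⟨r, hr, hr1, hrr⟩ : ∃ r : ℝ, 0 < r ∧ r < 1 ∧ r ^ (d + 2) = r₀ :=
    ⟨r₀ ^ ((d + 2 : ℕ) : ℝ)⁻¹, by positivity, Real.rpow_lt_one hr₀.le hr₀1 (by positivity),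
      Real.rpow_inv_natCast_pow hr₀.le (by omega)⟩
  have hQ : CoeffBound (r ^ d)⁻¹ r (Q : MvPowerSeries ι ℂ_[p]) := by
    have := CoeffBound.coe hint (d := d) le_rfl hr hr1.le
    rwa [one_mul] at this
  have hK1 : 1 ≤ (r ^ d)⁻¹ := (one_le_inv₀ (by positivity)).mpr (pow_le_one₀ hr.le hr1.le)
  have hr₀r : r₀ ≤ r := by
    rw [← hrr, pow_succ]
    exact mul_le_of_le_one_left hr.le (pow_le_one₀ hr.le hr1.le)
  refine ⟨(r ^ d)⁻¹, r, fun j => p * C * ((j : ℝ) * (r ^ 2) ^ j + (r ^ 2) ^ j), hr, hr1,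
    by positivity, hQ, fun j => by positivity, ?_, fun j => ?_⟩
  · have h1 : r ^ 2 < 1 := pow_lt_one₀ hr.le hr1 (by norm_num)
    have h2 := (tendsto_self_mul_const_pow_of_lt_one (by positivity) h1).add
      (tendsto_pow_atTop_nhds_zero_of_lt_one (by positivity) h1)
    simpa using h2.const_mul (p * C : ℝ)
  · rw [divOp_pow hτσ hQτ hQσ]
    have h1 : CoeffBound (C * r₀ ^ j) r ((shiftX σ ^ j) f) :=
      (hf.iterate_shiftX σ j).mono_radius (by positivity) hr₀.le hr₀r
    have h2 : ∀ i ∈ Finset.range (j + 1), CoeffBound (p * C * ((j : ℝ) * (r ^ 2) ^ j + (r ^ 2) ^ j)) r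
        (((c • (MvPowerSeries.pderiv ℂ_[p] τ).toLinearMap) ^ i)
          ((Q : MvPowerSeries ι ℂ_[p]) ^ (j - i) * (j.choose i • (shiftX σ ^ j) f))) := by
      intro i hi
      have hij : i ≤ j := Nat.lt_succ_iff.mp (Finset.mem_range.mp hi)
      have h3 := (h1.nsmul (j.choose i)).mono (C' := C * r₀ ^ j)
        (mul_le_of_le_one_left (by positivity)
          (IsUltrametricDist.norm_natCast_le_one ℂ_[p] _)) hr.le
      have h4 := CoeffBound.mul (by positivity) hr.le (CoeffBound.pow (by positivity) hr.le hQ (j - i))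
        h3 (by positivity)
      refine (h4.iterate_pderiv (by positivity) hr.le hr1.le hϖ hc τ i).mono ?_ hr.le
      calc (p * (i + 1) * ((r ^ d)⁻¹ ^ (j - i) * (C * r₀ ^ j)) : ℝ)
          ≤ p * (j + 1) * ((r ^ d)⁻¹ ^ j * (C * r₀ ^ j)) := by
            gcongr
            omega
        _ = p * C * ((j : ℝ) * (r ^ 2) ^ j + (r ^ 2) ^ j) := by
            rw [← hrr, pow_add, mul_pow, inv_pow]
            field_simp
    exact CoeffBound.sum (by positivity) hr.le h2

end Neumann

section Division

variable {p : ℕ} [Fact p.Prime] {ι κ : Type}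

/-- The restriction to overconvergent power series of a linear map that preserves
overconvergence. -/
def ocMap (φ : MvPowerSeries ι ℂ_[p] →ₗ[ℂ_[p]] MvPowerSeries κ ℂ_[p])
    (h : ∀ f, IsOverconvergent f → IsOverconvergent (φ f)) :
    Overconvergent p ι →ₗ[ℂ_[p]] Overconvergent p κ where
  toFun f := ⟨φ f.1, h f.1 f.2⟩
  map_add' f g := Subtype.ext (map_add φ f.1 g.1)
  map_smul' a f := Subtype.ext (map_smul φ a f.1)

@[simp] lemma coe_ocMap (φ : MvPowerSeries ι ℂ_[p] →ₗ[ℂ_[p]] MvPowerSeries κ ℂ_[p])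
    (h : ∀ f, IsOverconvergent f → IsOverconvergent (φ f)) (f : Overconvergent p ι) :
    (ocMap φ h f : MvPowerSeries κ ℂ_[p]) = φ f := rfl

/-- An overconvergent power series in some of the variables as one in all variables. -/
def ocRename (e : ι ↪ κ) : Overconvergent p ι →ₗ[ℂ_[p]] Overconvergent p κ :=
  ocMap (MvPowerSeries.rename e).toLinearMap fun _ hf => hf.rename e

/-- The substitution of zero for the variables outside the range of `e`. -/
def ocKill (e : ι ↪ κ) : Overconvergent p κ →ₗ[ℂ_[p]] Overconvergent p ι :=
  ocMap (MvPowerSeries.killCompl e).toLinearMap fun _ hf => hf.killCompl e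

/-- The quotient in the division of overconvergent power series by the variable `z i`. -/
def ocShift (i : ι) : Overconvergent p ι →ₗ[ℂ_[p]] Overconvergent p ι :=
  ocMap (shiftX i) fun _ hf => hf.shiftX i

/-- The multiplication of overconvergent power series by the variable `z i`. -/
def ocX (i : ι) : Overconvergent p ι →ₗ[ℂ_[p]] Overconvergent p ι :=
  LinearMap.mulLeft ℂ_[p] (ocPoly (MvPolynomial.X i))

@[simp] lemma coe_ocRename (e : ι ↪ κ) (f : Overconvergent p ι) :
    (ocRename e f : MvPowerSeries κ ℂ_[p]) = MvPowerSeries.rename e f := rfl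

@[simp] lemma coe_ocKill (e : ι ↪ κ) (f : Overconvergent p κ) :
    (ocKill e f : MvPowerSeries ι ℂ_[p]) = MvPowerSeries.killCompl e f := rfl

@[simp] lemma coe_ocShift (i : ι) (f : Overconvergent p ι) :
    (ocShift i f : MvPowerSeries ι ℂ_[p]) = shiftX i f := rfl

@[simp] lemma coe_ocX (i : ι) (f : Overconvergent p ι) :
    (ocX i f : MvPowerSeries ι ℂ_[p]) = MvPowerSeries.X i * f.1 := by
  rw [ocX, LinearMap.mulLeft_apply]
  change ((MvPolynomial.X i : MvPolynomial ι ℂ_[p]) : MvPowerSeries ι ℂ_[p]) * f.1 = _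
  rw [MvPolynomial.coe_X]

@[simp] lemma coe_ocPderiv (i : ι) (f : Overconvergent p ι) :
    (ocPderiv i f : MvPowerSeries ι ℂ_[p]) = MvPowerSeries.pderiv ℂ_[p] i f := rfl

lemma ocKill_ocRename (e : ι ↪ κ) (f : Overconvergent p ι) : ocKill e (ocRename e f) = f :=
  Subtype.ext (MvPowerSeries.killCompl_rename_app f.1)

lemma ocKill_surjective (e : ι ↪ κ) :
    Function.Surjective (ocKill (p := p) e) := fun f => ⟨_, ocKill_ocRename e f⟩

lemma ocX_injective (i : ι) : Function.Injective (ocX (p := p) i) := by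
  intro f g h
  refine Subtype.ext (X_mul_injective i ?_)
  have h1 := congrArg Subtype.val h
  rwa [coe_ocX, coe_ocX] at h1

lemma exists_ocX_eq_of_ocKill_eq_zero {m : ℕ} (i : Fin (m + 1))
    {f : Overconvergent p (Fin (m + 1))} (h : ocKill i.succAboveEmb f = 0) :
    ocX i (ocShift i f) = f := by
  refine Subtype.ext ?_
  have h1 := rename_killCompl_add_X_mul_shiftX i f.1
  have h2 : MvPowerSeries.killCompl i.succAboveEmb f.1 = 0 := congrArg Subtype.val h
  rwa [h2, map_zero, zero_add, ← coe_ocShift, ← coe_ocX] at h1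

lemma ocRename_ocKill_add {m : ℕ} (i : Fin (m + 1)) (f : Overconvergent p (Fin (m + 1))) :
    ocRename i.succAboveEmb (ocKill i.succAboveEmb f) + ocX i (ocShift i f) = f := by
  refine Subtype.ext ?_
  have h1 := rename_killCompl_add_X_mul_shiftX i f.1
  rwa [← coe_ocShift, ← coe_ocX] at h1

lemma ocShift_ocRename {m : ℕ} (i : Fin (m + 1)) (f : Overconvergent p (Fin m)) :
    ocShift i (ocRename i.succAboveEmb f) = 0 :=
  Subtype.ext (shiftX_rename i f.1)

lemma ocKill_ocX {m : ℕ} (i : Fin (m + 1)) (f : Overconvergent p (Fin (m + 1))) :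
    ocKill i.succAboveEmb (ocX i f) = 0 := by
  have h := ocRename_ocKill_add i (ocX i f)
  have h1 : ocShift i (ocX i f) = f := Subtype.ext (by simp [shiftX_X_mul])
  rw [h1, add_eq_right] at h
  rw [← ocKill_ocRename i.succAboveEmb (ocKill i.succAboveEmb (ocX i f)), h, map_zero]

variable {ϖ : ℂ_[p]} {τ σ : ι} {Q W : MvPolynomial ι ℂ_[p]}

lemma shiftX_twistedPderiv (hϖ0 : ϖ ≠ 0) (hτσ : τ ≠ σ)
    (hQσ : ∀ f, shiftX σ ((Q : MvPowerSeries ι ℂ_[p]) * f) =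
      (Q : MvPowerSeries ι ℂ_[p]) * shiftX σ f)
    (hW : MvPolynomial.pderiv τ W = MvPolynomial.C ϖ * (Q + MvPolynomial.X σ))
    (f : Overconvergent p ι) : (ocShift σ (twistedPderiv W τ f) : MvPowerSeries ι ℂ_[p]) =
      ϖ • (f.1 - divOp (-ϖ⁻¹) ((-Q : MvPolynomial ι ℂ_[p]) : MvPowerSeries ι ℂ_[p]) τ σ f.1) := by
  have hn : ((-Q : MvPolynomial ι ℂ_[p]) : MvPowerSeries ι ℂ_[p]) = -(Q : MvPowerSeries ι ℂ_[p]) :=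
    map_neg MvPolynomial.coeToMvPowerSeries.ringHom Q
  rw [coe_ocShift, coe_twistedPderiv, hW, map_add, shiftX_pderiv_of_ne hτσ, MvPolynomial.coe_mul,
    MvPolynomial.coe_C, mul_assoc, ← MvPowerSeries.smul_eq_C_mul, map_smul, MvPolynomial.coe_add,
    add_mul, map_add, hQσ, MvPolynomial.coe_X, shiftX_X_mul, divOp_apply, hn, smul_sub, smul_add,
    smul_add, smul_smul, mul_neg, mul_inv_cancel₀ hϖ0, neg_one_smul, neg_mul, smul_neg]
  abel

/-- The division by `∂_t + ϖ (Q + s)`: the composition of this operator with the quotient in the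
division by `s` is bijective on overconvergent power series. -/
lemma bijective_shift_twistedPderiv (hϖ : ϖ ^ (p - 1) = -(p : ℂ_[p])) (hτσ : τ ≠ σ)
    (hint : ∀ m, ‖Q.coeff m‖ ≤ 1) (hQτ : MvPolynomial.pderiv τ Q = 0)
    (hQσ : ∀ f, shiftX σ ((Q : MvPowerSeries ι ℂ_[p]) * f) =
      (Q : MvPowerSeries ι ℂ_[p]) * shiftX σ f)
    (hW : MvPolynomial.pderiv τ W = MvPolynomial.C ϖ * (Q + MvPolynomial.X σ)) :
    Function.Bijective (ocShift σ ∘ₗ twistedPderiv W τ) := by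
  have hϖ0 := root_ne_zero hϖ
  have hc : ‖-ϖ⁻¹‖ = ‖ϖ⁻¹‖ := norm_neg _
  have hn : ((-Q : MvPolynomial ι ℂ_[p]) : MvPowerSeries ι ℂ_[p]) = -(Q : MvPowerSeries ι ℂ_[p]) :=
    map_neg MvPolynomial.coeToMvPowerSeries.ringHom Q
  have hint' : ∀ m, ‖(-Q).coeff m‖ ≤ 1 := fun m => by
    rw [MvPolynomial.coeff_neg, norm_neg]
    exact hint m
  have hQτ' : MvPowerSeries.pderiv ℂ_[p] τ ((-Q : MvPolynomial ι ℂ_[p]) : MvPowerSeries ι ℂ_[p]) =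
      0 := by
    rw [MvPowerSeries.pderiv_coe, map_neg, hQτ, neg_zero, MvPolynomial.coe_zero]
  have hQσ' : ∀ f, shiftX σ (((-Q : MvPolynomial ι ℂ_[p]) : MvPowerSeries ι ℂ_[p]) * f) =
      ((-Q : MvPolynomial ι ℂ_[p]) : MvPowerSeries ι ℂ_[p]) * shiftX σ f := fun f => by
    rw [hn, neg_mul, map_neg, hQσ, neg_mul]
  constructor
  · rw [injective_iff_map_eq_zero]
    intro f hf
    have h1 := shiftX_twistedPderiv hϖ0 hτσ hQσ hW f
    rw [← LinearMap.comp_apply, hf] at h1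
    have h2 := (smul_eq_zero.mp h1.symm).resolve_left hϖ0
    rw [sub_eq_zero] at h2
    obtain ⟨K, r, β, hr, hr1, hK, hQ, hβ0, hβ, h⟩ :=
      exists_coeffBound_divOp_pow hϖ hc hτσ hint' hQτ' hQσ' f.2
    have h3 : ∀ j, (divOp (-ϖ⁻¹) ((-Q : MvPolynomial ι ℂ_[p]) : MvPowerSeries ι ℂ_[p]) τ σ ^ j) f.1 =
        f.1 := by
      intro j
      induction j with
      | zero => rfl
      | succ j ih => rw [pow_succ, Module.End.mul_apply, ← h2, ih]
    refine Subtype.ext (eq_zero_of_forall_coeffBound (r := r) hβ fun j => ?_)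
    rw [← h3 j]
    exact h j
  · intro f
    obtain ⟨K, r, β, hr, hr1, hK, hQ, hβ0, hβ, h⟩ :=
      exists_coeffBound_divOp_pow hϖ hc hτσ hint' hQτ' hQσ' (ϖ⁻¹ • f).2
    obtain ⟨B, g, hB, hg, hgf⟩ := exists_sub_map_eq _ hr
      (fun C g hC hg => CoeffBound.divOp hK hr.le hr1.le hϖ hc hQ hC hg) hβ0 hβ h
    refine ⟨⟨g, B, r, hB, hr, hr1, hg⟩, Subtype.ext ?_⟩
    rw [LinearMap.comp_apply, shiftX_twistedPderiv hϖ0 hτσ hQσ hW]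
    change ϖ • (g - _) = _
    rw [hgf]
    change ϖ • ϖ⁻¹ • f.1 = f.1
    rw [smul_smul, mul_inv_cancel₀ hϖ0, one_smul]

/-- The cokernel of `∂_t + ϖ (Q + s)` consists of the power series that do not involve `s`. -/
lemma exists_retraction_twistedPderiv {m : ℕ} {τ σ : Fin (m + 1)}
    {Q W : MvPolynomial (Fin (m + 1)) ℂ_[p]}
    (hϖ : ϖ ^ (p - 1) = -(p : ℂ_[p])) (hτσ : τ ≠ σ)
    (hint : ∀ m, ‖Q.coeff m‖ ≤ 1) (hQτ : MvPolynomial.pderiv τ Q = 0)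
    (hQσ : ∀ f, shiftX σ ((Q : MvPowerSeries (Fin (m + 1)) ℂ_[p]) * f) =
      (Q : MvPowerSeries (Fin (m + 1)) ℂ_[p]) * shiftX σ f)
    (hW : MvPolynomial.pderiv τ W = MvPolynomial.C ϖ * (Q + MvPolynomial.X σ)) :
    ∃ π : Overconvergent p (Fin (m + 1)) →ₗ[ℂ_[p]] Overconvergent p (Fin m),
      (∀ a, π (ocRename σ.succAboveEmb a) = a) ∧ (∀ g, π (twistedPderiv W τ g) = 0) ∧
      ∀ f, π f = 0 → ∃ g, twistedPderiv W τ g = f := by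
  let U := LinearEquiv.ofBijective _ (bijective_shift_twistedPderiv hϖ hτσ hint hQτ hQσ hW)
  have hU : ∀ f, ocShift σ (twistedPderiv W τ (U.symm f)) = f := fun f => U.apply_symm_apply f
  have hU' : ∀ f, U.symm (ocShift σ (twistedPderiv W τ f)) = f := fun f => U.symm_apply_apply f
  refine ⟨ocKill σ.succAboveEmb ∘ₗ
    (LinearMap.id - twistedPderiv W τ ∘ₗ U.symm.toLinearMap ∘ₗ ocShift σ), fun a => ?_, fun g => ?_,
    fun f hf => ⟨U.symm (ocShift σ f), ?_⟩⟩
  · simp [ocShift_ocRename, ocKill_ocRename]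
  · simp [hU']
  · have h1 : ocKill σ.succAboveEmb (f - twistedPderiv W τ (U.symm (ocShift σ f))) = 0 := hf
    have h2 := exists_ocX_eq_of_ocKill_eq_zero σ h1
    rw [map_sub, hU, sub_self, map_zero] at h2
    exact (sub_eq_zero.mp h2.symm).symm

lemma injective_twistedPderiv
    (hϖ : ϖ ^ (p - 1) = -(p : ℂ_[p])) (hτσ : τ ≠ σ)
    (hint : ∀ m, ‖Q.coeff m‖ ≤ 1) (hQτ : MvPolynomial.pderiv τ Q = 0)
    (hQσ : ∀ f, shiftX σ ((Q : MvPowerSeries ι ℂ_[p]) * f) =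
      (Q : MvPowerSeries ι ℂ_[p]) * shiftX σ f)
    (hW : MvPolynomial.pderiv τ W = MvPolynomial.C ϖ * (Q + MvPolynomial.X σ)) :
    Function.Injective (twistedPderiv W τ) := by
  have h := (bijective_shift_twistedPderiv hϖ hτσ hint hQτ hQσ hW).1
  rw [LinearMap.coe_comp] at h
  exact Function.Injective.of_comp h

end Division

/-! ### The Poincaré lemma -/

section Poincare

variable {p : ℕ} [Fact p.Prime] {ι : Type}

/-- The primitive with respect to `z i`, divided by `z i`. -/
def primitiveQuot (i : ι) : MvPowerSeries ι ℂ_[p] →ₗ[ℂ_[p]] MvPowerSeries ι ℂ_[p] where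
  toFun f := fun J => ((J i : ℂ_[p]) + 1)⁻¹ * MvPowerSeries.coeff J f
  map_add' f g := by
    funext J
    change _ * MvPowerSeries.coeff J (f + g) = _ * _ + _ * _
    rw [map_add, mul_add]
  map_smul' a f := by
    funext J
    change _ * MvPowerSeries.coeff J (a • f) = a * (_ * _)
    rw [MvPowerSeries.coeff_smul]
    ring

lemma coeff_primitiveQuot (i : ι) (f : MvPowerSeries ι ℂ_[p]) (J : ι →₀ ℕ) :
    MvPowerSeries.coeff J (primitiveQuot i f) =
      ((J i : ℂ_[p]) + 1)⁻¹ * MvPowerSeries.coeff J f := rfl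

lemma IsOverconvergent.primitiveQuot {f : MvPowerSeries ι ℂ_[p]} (hf : IsOverconvergent f) (i : ι) :
    IsOverconvergent (primitiveQuot i f) := by
  refine hf.of_mul_degree one_pos fun J => ?_
  rw [coeff_primitiveQuot, norm_mul, one_mul, norm_inv]
  have h1 := inv_le_norm_natCast (p := p) (n := J i + 1) (Nat.succ_ne_zero _)
  have h2 : ((J i + 1 : ℕ) : ℝ) ≤ J.degree + 1 := by
    exact_mod_cast Nat.succ_le_succ (Finsupp.le_degree i J)
  push_cast at h1 h2
  exact mul_le_mul_of_nonneg_right (h1.trans h2) (norm_nonneg _)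

lemma pderiv_X_mul_primitiveQuot (i : ι) (f : MvPowerSeries ι ℂ_[p]) :
    MvPowerSeries.pderiv ℂ_[p] i (MvPowerSeries.X i * primitiveQuot i f) = f := by
  ext J
  rw [MvPowerSeries.coeff_pderiv, coeff_add_single_X_mul, coeff_primitiveQuot, mul_comm, ← mul_assoc,
    mul_inv_cancel₀ (by exact_mod_cast Nat.succ_ne_zero (J i)), one_mul]

lemma ocPderiv_surjective (i : ι) : Function.Surjective (ocPderiv (p := p) i) := fun f =>
  ⟨ocX i (ocMap (primitiveQuot i) (fun _ hf => hf.primitiveQuot i) f),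
    Subtype.ext (by
      rw [coe_ocPderiv, coe_ocX, coe_ocMap, pderiv_X_mul_primitiveQuot])⟩

lemma ocRename_ocKill_of_ocPderiv_eq_zero {m : ℕ} (i : Fin (m + 1))
    {f : Overconvergent p (Fin (m + 1))} (h : ocPderiv i f = 0) :
    ocRename i.succAboveEmb (ocKill i.succAboveEmb f) = f := by
  have h1 : ocShift i f = 0 := by
    refine Subtype.ext (MvPowerSeries.ext fun J => ?_)
    have h2 := congrArg (fun g : Overconvergent p (Fin (m + 1)) => MvPowerSeries.coeff J g.1) h
    simp only [coe_ocPderiv, MvPowerSeries.coeff_pderiv] at h2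
    have h3 : ((J i : ℂ_[p]) + 1) ≠ 0 := by exact_mod_cast Nat.succ_ne_zero (J i)
    exact (mul_eq_zero.mp h2).resolve_right h3
  have h2 := ocRename_ocKill_add i f
  rwa [h1, map_zero, add_zero] at h2

lemma ocPderiv_comm (i j : ι) (f : Overconvergent p ι) :
    ocPderiv i (ocPderiv j f) = ocPderiv j (ocPderiv i f) :=
  Subtype.ext (mvPowerSeries_pderiv_comm i j f.1)

/-- The Poincaré lemma: the de Rham complex of the ring of overconvergent power series is exact in
positive degrees. -/
lemma exactFrom_ocPderiv (n : ℕ) :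
    ExactFrom (fun i : Fin n => ocPderiv (p := p) i) 1 := by
  induction n with
  | zero =>
    intro ω hω _
    refine ⟨0, ?_⟩
    rw [map_zero]
    ext1 s
    refine (hω s ?_).symm
    rw [Finset.eq_empty_of_isEmpty s]
    simp
  | succ n ih =>
    refine ExactFrom.of_surjective (Fin.last n) _ (fun j k f => ocPderiv_comm j k f)
      (ocPderiv_surjective _) (ocRename (Fin.last n).succAboveEmb) ?_
      (fun f hf => ⟨_, ocRename_ocKill_of_ocPderiv_eq_zero _ hf⟩) (fun i => ocPderiv i) ?_ ?_ ih
    · exact Function.LeftInverse.injective fun f => ocKill_ocRename _ f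
    · exact fun j f => Subtype.ext (pderiv_rename_emb (Fin.last n).succAboveEmb j f.1)
    · refine fun g => Subtype.ext (pderiv_rename_of_notMem (Fin.last n).succAboveEmb _ ?_ g.1)
      rintro ⟨k, hk⟩
      exact Fin.succAbove_ne _ k hk

end Poincare

/-! ### Exactness of the de Rham complex of the graph -/

section Graph

variable {p : ℕ} [Fact p.Prime] {n : ℕ}

/-- The potential `ϖ (P + s) t` of the graph of `-P`, in the variables `z`, `s`, `t`. -/
def graphPotential (ϖ : ℂ_[p]) (P : MvPolynomial (Fin n) ℂ_[p]) :
    MvPolynomial (Fin (n + 2)) ℂ_[p] :=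
  dworkPotential ϖ (MvPolynomial.rename Fin.castSucc P + MvPolynomial.X (Fin.last n))

/-- The position of the variable `s` among `z`, `s`, `t`. -/
def sIdx (n : ℕ) : Fin (n + 2) := (Fin.last n).castSucc

lemma sIdx_succAbove_last : (sIdx n).succAbove (Fin.last n) = Fin.last (n + 1) := by
  rw [sIdx, Fin.succAbove_castSucc_of_le _ _ le_rfl, Fin.succ_last]

lemma sIdx_succAbove_castSucc (i : Fin n) :
    (sIdx n).succAbove i.castSucc = i.castSucc.castSucc := by
  rw [sIdx, Fin.succAbove_castSucc_of_lt _ _ (Fin.castSucc_lt_last i)]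

lemma last_ne_sIdx : Fin.last (n + 1) ≠ sIdx n := by
  rw [← sIdx_succAbove_last]
  exact Fin.succAbove_ne _ _

lemma graphPotential_eq (ϖ : ℂ_[p]) (P : MvPolynomial (Fin n) ℂ_[p]) :
    graphPotential ϖ P = MvPolynomial.rename (sIdx n).succAbove (dworkPotential ϖ P) +
      MvPolynomial.C ϖ * (MvPolynomial.X (sIdx n) * MvPolynomial.X (Fin.last (n + 1))) := by
  have h : (sIdx n).succAbove ∘ Fin.castSucc = Fin.castSucc ∘ Fin.castSucc :=
    funext sIdx_succAbove_castSucc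
  simp only [graphPotential, dworkPotential, map_add, map_mul, MvPolynomial.rename_rename,
    MvPolynomial.rename_X, MvPolynomial.rename_C, h, sIdx_succAbove_last]
  rw [sIdx]
  ring

lemma pderiv_dworkPotential_last (ϖ : ℂ_[p]) (P : MvPolynomial (Fin n) ℂ_[p]) :
    MvPolynomial.pderiv (Fin.last n) (dworkPotential ϖ P) =
      MvPolynomial.C ϖ * MvPolynomial.rename Fin.castSucc P := by
  have h : MvPolynomial.pderiv (Fin.last n) (MvPolynomial.rename Fin.castSucc P) = 0 := by
    refine MvPolynomial.pderiv_eq_zero_of_notMem_vars fun hc => ?_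
    obtain ⟨k, _, hk⟩ := MvPolynomial.mem_vars_rename _ _ hc
    exact (Fin.castSucc_lt_last k).ne hk
  rw [dworkPotential, MvPolynomial.pderiv_C_mul, MvPolynomial.pderiv_mul, h,
    MvPolynomial.pderiv_X_self, zero_mul, zero_add, mul_one]

lemma pderiv_dworkPotential_castSucc (ϖ : ℂ_[p]) (P : MvPolynomial (Fin n) ℂ_[p]) (i : Fin n) :
    MvPolynomial.pderiv i.castSucc (dworkPotential ϖ P) = MvPolynomial.C ϖ *
      (MvPolynomial.rename Fin.castSucc (MvPolynomial.pderiv i P) *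
        MvPolynomial.X (Fin.last n)) := by
  rw [dworkPotential, MvPolynomial.pderiv_C_mul, MvPolynomial.pderiv_mul,
    MvPolynomial.pderiv_X_of_ne (Fin.castSucc_lt_last i).ne', mul_zero, add_zero,
    MvPolynomial.pderiv_rename (Fin.castSucc_injective n)]

lemma pderiv_sIdx_rename (Q : MvPolynomial (Fin (n + 1)) ℂ_[p]) :
    MvPolynomial.pderiv (sIdx n) (MvPolynomial.rename (sIdx n).succAbove Q) = 0 := by
  refine MvPolynomial.pderiv_eq_zero_of_notMem_vars fun hc => ?_
  obtain ⟨k, _, hk⟩ := MvPolynomial.mem_vars_rename _ _ hc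
  exact Fin.succAbove_ne _ _ hk

lemma pderiv_sIdx_graphPotential (ϖ : ℂ_[p]) (P : MvPolynomial (Fin n) ℂ_[p]) :
    MvPolynomial.pderiv (sIdx n) (graphPotential ϖ P) =
      MvPolynomial.C ϖ * MvPolynomial.X (Fin.last (n + 1)) := by
  rw [graphPotential_eq, map_add, pderiv_sIdx_rename, zero_add, MvPolynomial.pderiv_C_mul,
    MvPolynomial.pderiv_mul, MvPolynomial.pderiv_X_self, MvPolynomial.pderiv_X_of_ne last_ne_sIdx,
    mul_zero, add_zero, one_mul]

lemma pderiv_last_graphPotential (ϖ : ℂ_[p]) (P : MvPolynomial (Fin n) ℂ_[p]) :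
    MvPolynomial.pderiv (Fin.last (n + 1)) (graphPotential ϖ P) =
      MvPolynomial.rename (sIdx n).succAbove
        (MvPolynomial.pderiv (Fin.last n) (dworkPotential ϖ P)) +
      MvPolynomial.C ϖ * MvPolynomial.X (sIdx n) := by
  rw [graphPotential_eq, map_add, ← sIdx_succAbove_last,
    MvPolynomial.pderiv_rename Fin.succAbove_right_injective, MvPolynomial.pderiv_C_mul,
    MvPolynomial.pderiv_mul, MvPolynomial.pderiv_X_self,
    MvPolynomial.pderiv_X_of_ne (Fin.succAbove_ne _ _).symm, zero_mul, zero_add, mul_one]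

lemma pderiv_castSucc_graphPotential (ϖ : ℂ_[p]) (P : MvPolynomial (Fin n) ℂ_[p]) (i : Fin n) :
    MvPolynomial.pderiv ((sIdx n).succAbove i.castSucc) (graphPotential ϖ P) =
      MvPolynomial.rename (sIdx n).succAbove
        (MvPolynomial.pderiv i.castSucc (dworkPotential ϖ P)) := by
  have h : Fin.last (n + 1) ≠ (sIdx n).succAbove i.castSucc := by
    rw [← sIdx_succAbove_last]
    exact fun hc => (Fin.castSucc_lt_last i).ne' (Fin.succAbove_right_injective hc)
  rw [graphPotential_eq, map_add, MvPolynomial.pderiv_rename Fin.succAbove_right_injective,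
    MvPolynomial.pderiv_C_mul, MvPolynomial.pderiv_mul,
    MvPolynomial.pderiv_X_of_ne (Fin.succAbove_ne _ _).symm,
    MvPolynomial.pderiv_X_of_ne h, zero_mul, mul_zero, add_zero, mul_zero, add_zero]

lemma twistedPderiv_ocRename {ι κ : Type} (e : ι ↪ κ) {W : MvPolynomial ι ℂ_[p]}
    {W' : MvPolynomial κ ℂ_[p]} {i : ι}
    (h : MvPolynomial.pderiv (e i) W' = MvPolynomial.rename e (MvPolynomial.pderiv i W))
    (f : Overconvergent p ι) :
    twistedPderiv W' (e i) (ocRename e f) = ocRename e (twistedPderiv W i f) := by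
  refine Subtype.ext ?_
  rw [coe_twistedPderiv, coe_ocRename, coe_ocRename, coe_twistedPderiv, h, pderiv_rename_emb, map_add,
    map_mul, MvPowerSeries.rename_coe]

lemma twistedPderiv_sIdx_ocRename (ϖ : ℂ_[p]) (P : MvPolynomial (Fin n) ℂ_[p])
    (f : Overconvergent p (Fin (n + 1))) :
    twistedPderiv (graphPotential ϖ P) (sIdx n) (ocRename (sIdx n).succAboveEmb f) =
      ocRename (sIdx n).succAboveEmb (ϖ • ocX (Fin.last n) f) := by
  refine Subtype.ext ?_
  have h1 : sIdx n ∉ Set.range (sIdx n).succAboveEmb := by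
    rintro ⟨k, hk⟩
    exact Fin.succAbove_ne _ k hk
  have h2 : (sIdx n).succAboveEmb (Fin.last n) = Fin.last (n + 1) := sIdx_succAbove_last
  rw [coe_twistedPderiv, coe_ocRename, coe_ocRename, pderiv_sIdx_graphPotential,
    pderiv_rename_of_notMem _ _ h1, zero_add]
  change _ = MvPowerSeries.rename (sIdx n).succAboveEmb (ϖ • (ocX (Fin.last n) f).1)
  rw [map_smul, coe_ocX, map_mul, MvPowerSeries.rename_X, h2, MvPolynomial.coe_mul,
    MvPolynomial.coe_C, MvPolynomial.coe_X, mul_assoc, ← MvPowerSeries.smul_eq_C_mul]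

lemma ocKill_twistedPderiv_castSucc (ϖ : ℂ_[p]) (P : MvPolynomial (Fin n) ℂ_[p]) (i : Fin n)
    (f : Overconvergent p (Fin (n + 1))) :
    ocKill (Fin.last n).succAboveEmb (twistedPderiv (dworkPotential ϖ P) i.castSucc f) =
      ocPderiv i (ocKill (Fin.last n).succAboveEmb f) := by
  have h : (Fin.last n).succAboveEmb i = i.castSucc := Fin.succAbove_last_apply i
  have h2 : twistedPderiv (dworkPotential ϖ P) i.castSucc f = ocPderiv i.castSucc f +
      ocX (Fin.last n) (ocPoly (MvPolynomial.C ϖ *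
        MvPolynomial.rename Fin.castSucc (MvPolynomial.pderiv i P)) * f) := by
    refine Subtype.ext ?_
    rw [coe_twistedPderiv, pderiv_dworkPotential_castSucc]
    change _ = MvPowerSeries.pderiv ℂ_[p] i.castSucc f.1 + (ocX (Fin.last n) _).1
    rw [coe_ocX]
    change _ = _ + _ * (((MvPolynomial.C ϖ * MvPolynomial.rename Fin.castSucc
      (MvPolynomial.pderiv i P) : MvPolynomial (Fin (n + 1)) ℂ_[p]) :
        MvPowerSeries (Fin (n + 1)) ℂ_[p]) * f.1)
    simp only [MvPolynomial.coe_mul, MvPolynomial.coe_X]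
    ring
  rw [h2, map_add, ocKill_ocX, add_zero]
  refine Subtype.ext ?_
  rw [coe_ocKill, coe_ocPderiv, ← h, killCompl_pderiv]
  rfl

/-- The polynomial `P` in the variables `z`, `s`, `t`. -/
def graphPoly (P : MvPolynomial (Fin n) ℂ_[p]) : MvPolynomial (Fin (n + 2)) ℂ_[p] :=
  MvPolynomial.rename (sIdx n).succAboveEmb (MvPolynomial.rename Fin.castSucc P)

lemma pderiv_last_graphPotential_eq (ϖ : ℂ_[p]) (P : MvPolynomial (Fin n) ℂ_[p]) :
    MvPolynomial.pderiv (Fin.last (n + 1)) (graphPotential ϖ P) =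
      MvPolynomial.C ϖ * (graphPoly P + MvPolynomial.X (sIdx n)) := by
  rw [pderiv_last_graphPotential, pderiv_dworkPotential_last, map_mul, MvPolynomial.rename_C,
    mul_add]
  rfl

lemma norm_coeff_graphPoly_le {P : MvPolynomial (Fin n) ℂ_[p]} (hint : ∀ m, ‖P.coeff m‖ ≤ 1)
    (m : Fin (n + 2) →₀ ℕ) : ‖(graphPoly P).coeff m‖ ≤ 1 := by
  rw [graphPoly, MvPolynomial.rename_rename]
  by_cases hm : ∃ m', Finsupp.mapDomain ((sIdx n).succAboveEmb ∘ Fin.castSucc) m' = m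
  · obtain ⟨m', rfl⟩ := hm
    rw [MvPolynomial.coeff_rename_mapDomain _
      ((sIdx n).succAboveEmb.injective.comp (Fin.castSucc_injective n))]
    exact hint m'
  · rw [MvPolynomial.coeff_rename_eq_zero _ _ _ fun u hu => absurd ⟨u, hu⟩ hm, norm_zero]
    exact zero_le_one

lemma pderiv_last_graphPoly (P : MvPolynomial (Fin n) ℂ_[p]) :
    MvPolynomial.pderiv (Fin.last (n + 1)) (graphPoly P) = 0 := by
  have h1 : (sIdx n).succAboveEmb (Fin.last n) = Fin.last (n + 1) := sIdx_succAbove_last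
  rw [graphPoly, ← h1, MvPolynomial.pderiv_rename (sIdx n).succAboveEmb.injective,
    MvPolynomial.pderiv_eq_zero_of_notMem_vars, map_zero]
  intro hc
  obtain ⟨k, _, hk⟩ := MvPolynomial.mem_vars_rename _ _ hc
  exact (Fin.castSucc_lt_last k).ne hk

lemma shiftX_graphPoly_mul (P : MvPolynomial (Fin n) ℂ_[p])
    (f : MvPowerSeries (Fin (n + 2)) ℂ_[p]) :
    shiftX (sIdx n) ((graphPoly P : MvPowerSeries (Fin (n + 2)) ℂ_[p]) * f) =
      (graphPoly P : MvPowerSeries (Fin (n + 2)) ℂ_[p]) * shiftX (sIdx n) f :=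
  map_coe_rename_mul (sIdx n).succAboveEmb (sIdx n).succAboveEmb (shiftX (sIdx n))
    (fun _ f => shiftX_X_mul_of_ne (Fin.succAbove_ne _ _) f) _ f

lemma twistedPderiv_comm_apply {ι : Type} (W : MvPolynomial ι ℂ_[p]) (j k : ι)
    (f : Overconvergent p ι) :
    twistedPderiv W j (twistedPderiv W k f) = twistedPderiv W k (twistedPderiv W j f) :=
  LinearMap.congr_fun (twistedPderiv_comm W j k) f

/-- The operators of `z` and `s` induced on the cokernel of the operator of `t` for the graph. -/
def graphReduced (ϖ : ℂ_[p]) (P : MvPolynomial (Fin n) ℂ_[p]) :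
    Fin (n + 1) → Overconvergent p (Fin (n + 1)) →ₗ[ℂ_[p]] Overconvergent p (Fin (n + 1)) :=
  Fin.lastCases (ϖ • ocX (p := p) (Fin.last n)) fun i => twistedPderiv (dworkPotential ϖ P) i.castSucc

lemma graphReduced_last (ϖ : ℂ_[p]) (P : MvPolynomial (Fin n) ℂ_[p]) :
    graphReduced ϖ P (Fin.last n) = ϖ • ocX (p := p) (Fin.last n) := Fin.lastCases_last

lemma graphReduced_castSucc (ϖ : ℂ_[p]) (P : MvPolynomial (Fin n) ℂ_[p]) (i : Fin n) :
    graphReduced ϖ P i.castSucc = twistedPderiv (dworkPotential ϖ P) i.castSucc :=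
  Fin.lastCases_castSucc i

lemma twistedPderiv_graphPotential_ocRename (ϖ : ℂ_[p]) (P : MvPolynomial (Fin n) ℂ_[p])
    (j : Fin (n + 1)) (f : Overconvergent p (Fin (n + 1))) :
    twistedPderiv (graphPotential ϖ P) ((Fin.last (n + 1)).succAbove j)
        (ocRename (sIdx n).succAboveEmb f) =
      ocRename (sIdx n).succAboveEmb (graphReduced ϖ P j f) := by
  rw [Fin.succAbove_last]
  refine Fin.lastCases ?_ (fun i => ?_) j
  · rw [graphReduced_last]
    exact twistedPderiv_sIdx_ocRename ϖ P f
  · rw [graphReduced_castSucc]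
    have h1 := pderiv_castSucc_graphPotential ϖ P i
    have h2 := twistedPderiv_ocRename (sIdx n).succAboveEmb (i := i.castSucc) h1 f
    have h3 : (sIdx n).succAboveEmb i.castSucc = i.castSucc.castSucc := sIdx_succAbove_castSucc i
    rwa [h3] at h2

/-- The operators on the cokernel of the operator of `t`: that of `s` is the multiplication by `ϖ t`,
and its cokernel carries the partial derivatives in `z`. -/
lemma exactFrom_graphReduced {ϖ : ℂ_[p]} (hϖ0 : ϖ ≠ 0) (P : MvPolynomial (Fin n) ℂ_[p])
    (hcomm : ∀ j k f, graphReduced ϖ P j (graphReduced ϖ P k f) =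
      graphReduced ϖ P k (graphReduced ϖ P j f)) : ExactFrom (graphReduced ϖ P) 2 := by
  refine ExactFrom.of_injective (Fin.last n) (graphReduced ϖ P) hcomm ?_
    (ocKill (Fin.last n).succAboveEmb) (ocKill_surjective _) ?_ ?_ (fun i => ocPderiv i) ?_
    (exactFrom_ocPderiv n)
  · rw [graphReduced_last]
    intro f g h
    exact ocX_injective _ (smul_right_injective _ hϖ0 h)
  · intro f hf
    refine ⟨ϖ⁻¹ • ocShift (Fin.last n) f, ?_⟩
    rw [graphReduced_last, LinearMap.smul_apply, map_smul, smul_smul, mul_inv_cancel₀ hϖ0, one_smul,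
      exists_ocX_eq_of_ocKill_eq_zero _ hf]
  · intro g
    rw [graphReduced_last, LinearMap.smul_apply, map_smul, ocKill_ocX, smul_zero]
  · intro j f
    rw [Fin.succAbove_last, graphReduced_castSucc, ocKill_twistedPderiv_castSucc]

/-- The de Rham complex of the `D`-module of the graph of a polynomial is exact in degrees at
least three: the operators of `t` and then of `s` can be eliminated, and this leaves the de Rham
complex of affine space. -/
lemma exactFrom_graphPotential {ϖ : ℂ_[p]} (hϖ : ϖ ^ (p - 1) = -(p : ℂ_[p]))
    (P : MvPolynomial (Fin n) ℂ_[p]) (hint : ∀ m, ‖P.coeff m‖ ≤ 1) :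
    ExactFrom (twistedPderiv (graphPotential ϖ P)) 3 := by
  have hW := pderiv_last_graphPotential_eq ϖ P
  obtain ⟨π, hπc, hπD, hπk⟩ := exists_retraction_twistedPderiv hϖ last_ne_sIdx
    (norm_coeff_graphPoly_le hint) (pderiv_last_graphPoly P) (shiftX_graphPoly_mul P) hW
  have hπs : Function.Surjective π := fun a => ⟨_, hπc a⟩
  -- an operator that commutes with the one of `t` can be computed on series without `s`
  have hD' : ∀ j f, graphReduced ϖ P j (π f) =
      π (twistedPderiv (graphPotential ϖ P) ((Fin.last (n + 1)).succAbove j) f) := by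
    intro j f
    obtain ⟨g, hg⟩ := hπk (f - ocRename (sIdx n).succAboveEmb (π f)) (by
      rw [map_sub, hπc, sub_self])
    have h1 : f = ocRename (sIdx n).succAboveEmb (π f) +
        twistedPderiv (graphPotential ϖ P) (Fin.last (n + 1)) g := by rw [hg]; abel
    conv_rhs => rw [h1]
    rw [map_add, map_add, twistedPderiv_comm_apply, hπD, add_zero,
      twistedPderiv_graphPotential_ocRename, hπc]
  have hcomm : ∀ j k f, graphReduced ϖ P j (graphReduced ϖ P k f) =
      graphReduced ϖ P k (graphReduced ϖ P j f) := by
    intro j k f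
    obtain ⟨f, rfl⟩ := hπs f
    rw [hD', hD', hD', hD', twistedPderiv_comm_apply]
  exact ExactFrom.of_injective (Fin.last (n + 1)) _ (twistedPderiv_comm_apply _)
    (injective_twistedPderiv hϖ last_ne_sIdx (norm_coeff_graphPoly_le hint)
      (pderiv_last_graphPoly P) (shiftX_graphPoly_mul P) hW) π hπs hπk hπD _ hD'
    (exactFrom_graphReduced (root_ne_zero hϖ) P hcomm)

end Graph

/-! ### The operators of the suspension -/

section Operators

variable {p : ℕ} [Fact p.Prime] {n : ℕ} {ι κ κ' : Type}

/-- The position of the variable `x` among `z`, `x`, `y`, `t`. -/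
def xIdx (n : ℕ) : Fin (n + 2 + 1) := (Fin.natAdd n (0 : Fin 2)).castSucc

/-- The position of the variable `y` among `z`, `x`, `y`, `t`. -/
def yIdx (n : ℕ) : Fin (n + 2 + 1) := (Fin.natAdd n (1 : Fin 2)).castSucc

lemma xIdx_succAbove_sIdx : (xIdx n).succAbove (sIdx n) = yIdx n := by
  refine Fin.ext ?_
  simp [xIdx, sIdx, yIdx, Fin.succAbove, Fin.lt_def]

lemma xIdx_succAbove_last : (xIdx n).succAbove (Fin.last (n + 1)) = Fin.last (n + 2) := by
  refine Fin.ext ?_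
  simp [xIdx, Fin.succAbove, Fin.lt_def]

lemma xIdx_succAbove_castSucc (i : Fin n) :
    (xIdx n).succAbove i.castSucc.castSucc = (Fin.castAdd 2 i).castSucc := by
  refine Fin.ext ?_
  simp [xIdx, Fin.succAbove, Fin.lt_def]

/-- The embedding of the variables `z`, `t` into `z`, `x`, `y`, `t`. -/
def ztEmb (n : ℕ) : Fin (n + 1) ↪ Fin (n + 2 + 1) :=
  (sIdx n).succAboveEmb.trans (xIdx n).succAboveEmb

lemma ztEmb_apply (i : Fin (n + 1)) :
    ztEmb n i = (xIdx n).succAbove ((sIdx n).succAbove i) := rfl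

lemma ztEmb_last : ztEmb n (Fin.last n) = Fin.last (n + 2) := by
  rw [ztEmb_apply, sIdx_succAbove_last, xIdx_succAbove_last]

lemma ztEmb_castSucc (i : Fin n) : ztEmb n i.castSucc = (Fin.castAdd 2 i).castSucc := by
  rw [ztEmb_apply, sIdx_succAbove_castSucc, xIdx_succAbove_castSucc]

lemma ztEmb_ne_xIdx (i : Fin (n + 1)) : ztEmb n i ≠ xIdx n := Fin.succAbove_ne _ _

lemma ztEmb_ne_yIdx (i : Fin (n + 1)) : ztEmb n i ≠ yIdx n := by
  rw [← xIdx_succAbove_sIdx, ztEmb_apply]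
  exact fun h => Fin.succAbove_ne _ _ (Fin.succAbove_right_injective h)

lemma yIdx_ne_xIdx : yIdx n ≠ xIdx n := by
  rw [← xIdx_succAbove_sIdx]
  exact Fin.succAbove_ne _ _

lemma last_ne_xIdx : Fin.last (n + 2) ≠ xIdx n := by
  rw [← ztEmb_last]
  exact ztEmb_ne_xIdx _

lemma last_ne_yIdx : Fin.last (n + 2) ≠ yIdx n := by
  rw [← ztEmb_last]
  exact ztEmb_ne_yIdx _

lemma dworkPotential_addXY (ϖ : ℂ_[p]) (P : MvPolynomial (Fin n) ℂ_[p]) :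
    dworkPotential ϖ (addXY P) = MvPolynomial.rename (ztEmb n) (dworkPotential ϖ P) +
      MvPolynomial.C ϖ * (MvPolynomial.X (xIdx n) * (MvPolynomial.X (yIdx n) *
        MvPolynomial.X (Fin.last (n + 2)))) := by
  have h : ztEmb n ∘ Fin.castSucc = Fin.castSucc ∘ Fin.castAdd 2 := funext ztEmb_castSucc
  simp only [addXY, dworkPotential, map_add, map_mul, MvPolynomial.rename_rename,
    MvPolynomial.rename_X, MvPolynomial.rename_C, h, ztEmb_last]
  rw [xIdx, yIdx]
  ring

lemma pderiv_rename_of_notMem_range (e : ι ↪ κ) {k : κ} (hk : ∀ i, e i ≠ k)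
    (Q : MvPolynomial ι ℂ_[p]) : MvPolynomial.pderiv k (MvPolynomial.rename e Q) = 0 := by
  refine MvPolynomial.pderiv_eq_zero_of_notMem_vars fun hc => ?_
  obtain ⟨i, _, hi⟩ := MvPolynomial.mem_vars_rename _ _ hc
  exact hk i hi

lemma pderiv_xIdx_dworkPotential (ϖ : ℂ_[p]) (P : MvPolynomial (Fin n) ℂ_[p]) :
    MvPolynomial.pderiv (xIdx n) (dworkPotential ϖ (addXY P)) = MvPolynomial.C ϖ *
      (MvPolynomial.X (yIdx n) * MvPolynomial.X (Fin.last (n + 2))) := by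
  rw [dworkPotential_addXY, map_add, pderiv_rename_of_notMem_range _ ztEmb_ne_xIdx, zero_add,
    MvPolynomial.pderiv_C_mul, MvPolynomial.pderiv_mul, MvPolynomial.pderiv_mul,
    MvPolynomial.pderiv_X_self, MvPolynomial.pderiv_X_of_ne yIdx_ne_xIdx,
    MvPolynomial.pderiv_X_of_ne last_ne_xIdx]
  ring

lemma pderiv_yIdx_dworkPotential (ϖ : ℂ_[p]) (P : MvPolynomial (Fin n) ℂ_[p]) :
    MvPolynomial.pderiv (yIdx n) (dworkPotential ϖ (addXY P)) = MvPolynomial.C ϖ *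
      (MvPolynomial.X (xIdx n) * MvPolynomial.X (Fin.last (n + 2))) := by
  rw [dworkPotential_addXY, map_add, pderiv_rename_of_notMem_range _ ztEmb_ne_yIdx, zero_add,
    MvPolynomial.pderiv_C_mul, MvPolynomial.pderiv_mul, MvPolynomial.pderiv_mul,
    MvPolynomial.pderiv_X_self, MvPolynomial.pderiv_X_of_ne yIdx_ne_xIdx.symm,
    MvPolynomial.pderiv_X_of_ne last_ne_yIdx]
  ring

lemma pderiv_ztEmb_dworkPotential (ϖ : ℂ_[p]) (P : MvPolynomial (Fin n) ℂ_[p]) (i : Fin (n + 1)) :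
    MvPolynomial.pderiv (ztEmb n i) (dworkPotential ϖ (addXY P)) =
      MvPolynomial.pderiv (ztEmb n i) (MvPolynomial.rename (ztEmb n) (dworkPotential ϖ P)) +
      if i = Fin.last n then
        MvPolynomial.C ϖ * (MvPolynomial.X (xIdx n) * MvPolynomial.X (yIdx n)) else 0 := by
  rw [dworkPotential_addXY, map_add, MvPolynomial.pderiv_C_mul, MvPolynomial.pderiv_mul,
    MvPolynomial.pderiv_mul, MvPolynomial.pderiv_X_of_ne (ztEmb_ne_xIdx i).symm,
    MvPolynomial.pderiv_X_of_ne (ztEmb_ne_yIdx i).symm, ← ztEmb_last]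
  congr 1
  split_ifs with h
  · rw [h, MvPolynomial.pderiv_X_self]
    ring
  · rw [MvPolynomial.pderiv_X_of_ne fun hc => h ((ztEmb n).injective hc).symm]
    ring

lemma pderiv_succAbove_graphPotential (ϖ : ℂ_[p]) (P : MvPolynomial (Fin n) ℂ_[p])
    (i : Fin (n + 1)) :
    MvPolynomial.pderiv ((sIdx n).succAboveEmb i) (graphPotential ϖ P) =
      MvPolynomial.pderiv ((sIdx n).succAboveEmb i)
        (MvPolynomial.rename (sIdx n).succAboveEmb (dworkPotential ϖ P)) +
      if i = Fin.last n then MvPolynomial.C ϖ * MvPolynomial.X (sIdx n) else 0 := by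
  rw [MvPolynomial.pderiv_rename (sIdx n).succAboveEmb.injective]
  refine Fin.lastCases ?_ (fun i => ?_) i
  · rw [if_pos rfl]
    have h := pderiv_last_graphPotential ϖ P
    rwa [← sIdx_succAbove_last] at h
  · rw [if_neg (Fin.castSucc_lt_last i).ne, add_zero]
    exact pderiv_castSucc_graphPotential ϖ P i

/-- Addition of a term to the potential. -/
lemma twistedPderiv_apply_of_eq {W W' Q : MvPolynomial ι ℂ_[p]} {i : ι}
    (h : MvPolynomial.pderiv i W = MvPolynomial.pderiv i W' + Q) (f : Overconvergent p ι) :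
    twistedPderiv W i f = twistedPderiv W' i f + ocPoly Q * f := by
  refine Subtype.ext ?_
  change (twistedPderiv W i f).1 = (twistedPderiv W' i f).1 + (Q : MvPowerSeries ι ℂ_[p]) * f.1
  rw [coe_twistedPderiv, coe_twistedPderiv, h, MvPolynomial.coe_add]
  ring

lemma ocPoly_C_mul (a : ℂ_[p]) (Q : MvPolynomial ι ℂ_[p]) (f : Overconvergent p ι) :
    ocPoly (MvPolynomial.C a * Q) * f = a • (ocPoly Q * f) := by
  refine Subtype.ext ?_
  change ((MvPolynomial.C a * Q : MvPolynomial ι ℂ_[p]) : MvPowerSeries ι ℂ_[p]) * f.1 =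
    a • ((Q : MvPowerSeries ι ℂ_[p]) * f.1)
  rw [MvPolynomial.coe_mul, MvPolynomial.coe_C, mul_assoc, MvPowerSeries.smul_eq_C_mul]

lemma ocPoly_mul (Q Q' : MvPolynomial ι ℂ_[p]) :
    (ocPoly (Q * Q') : Overconvergent p ι) = ocPoly Q * ocPoly Q' :=
  Subtype.ext (MvPolynomial.coe_mul Q Q')

lemma ocX_apply (i : ι) (f : Overconvergent p ι) : ocX i f = ocPoly (MvPolynomial.X i) * f := rfl

lemma ocX_comm (i j : ι) (f : Overconvergent p ι) : ocX i (ocX j f) = ocX j (ocX i f) :=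
  mul_left_comm _ _ _

lemma twistedPderiv_ocX_of_ne (W : MvPolynomial ι ℂ_[p]) {i j : ι} (h : j ≠ i)
    (f : Overconvergent p ι) :
    twistedPderiv W i (ocX j f) = ocX j (twistedPderiv W i f) :=
  twistedPderiv_mul_of_pderiv_eq_zero W i _ (MvPolynomial.pderiv_X_of_ne h) f

lemma twistedPderiv_ocX_self (W : MvPolynomial ι ℂ_[p]) (i : ι) (f : Overconvergent p ι) :
    twistedPderiv W i (ocX i f) = ocX i (twistedPderiv W i f) + f := by
  refine Subtype.ext ?_
  change (twistedPderiv W i (ocX i f)).1 = (ocX i (twistedPderiv W i f)).1 + f.1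
  rw [coe_ocX, coe_twistedPderiv, coe_twistedPderiv, coe_ocX, Derivation.leibniz,
    MvPowerSeries.pderiv_X_self, smul_eq_mul, smul_eq_mul]
  ring

/-- A linear map that commutes with the derivatives and the multiplications with respect to some
of the variables commutes with the derivations twisted by polynomials in these variables. -/
lemma ocMap_twistedPderiv_rename (e : ι ↪ κ) (e' : ι ↪ κ')
    (φ : MvPowerSeries κ ℂ_[p] →ₗ[ℂ_[p]] MvPowerSeries κ' ℂ_[p])
    (h : ∀ f, IsOverconvergent f → IsOverconvergent (φ f))
    (hX : ∀ i f, φ (MvPowerSeries.X (e i) * f) = MvPowerSeries.X (e' i) * φ f)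
    {i : ι} (hD : ∀ f, φ (MvPowerSeries.pderiv ℂ_[p] (e i) f) =
      MvPowerSeries.pderiv ℂ_[p] (e' i) (φ f))
    (W : MvPolynomial ι ℂ_[p]) (f : Overconvergent p κ) :
    ocMap φ h (twistedPderiv (MvPolynomial.rename e W) (e i) f) =
      twistedPderiv (MvPolynomial.rename e' W) (e' i) (ocMap φ h f) := by
  refine Subtype.ext ?_
  rw [coe_ocMap, coe_twistedPderiv, coe_twistedPderiv, map_add, hD,
    MvPolynomial.pderiv_rename e.injective, MvPolynomial.pderiv_rename e'.injective,
    map_coe_rename_mul e e' φ hX]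
  rfl

variable (ϖ : ℂ_[p]) (P : MvPolynomial (Fin n) ℂ_[p])

lemma twistedPderiv_graph (i : Fin (n + 1)) (f : Overconvergent p (Fin (n + 2))) :
    twistedPderiv (graphPotential ϖ P) ((sIdx n).succAboveEmb i) f =
      twistedPderiv (MvPolynomial.rename (sIdx n).succAboveEmb (dworkPotential ϖ P))
        ((sIdx n).succAboveEmb i) f + if i = Fin.last n then ϖ • ocX (sIdx n) f else 0 := by
  rw [twistedPderiv_apply_of_eq (pderiv_succAbove_graphPotential ϖ P i)]
  congr 1
  split_ifs
  · rw [ocPoly_C_mul, ocX_apply]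
  · refine Subtype.ext ?_
    change ((0 : MvPolynomial (Fin (n + 2)) ℂ_[p]) : MvPowerSeries (Fin (n + 2)) ℂ_[p]) * f.1 = 0
    rw [MvPolynomial.coe_zero, zero_mul]

lemma twistedPderiv_addXY (i : Fin (n + 1)) (f : Overconvergent p (Fin (n + 2 + 1))) :
    twistedPderiv (dworkPotential ϖ (addXY P)) (ztEmb n i) f =
      twistedPderiv (MvPolynomial.rename (ztEmb n) (dworkPotential ϖ P)) (ztEmb n i) f +
      if i = Fin.last n then ϖ • ocX (xIdx n) (ocX (yIdx n) f) else 0 := by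
  rw [twistedPderiv_apply_of_eq (pderiv_ztEmb_dworkPotential ϖ P i)]
  congr 1
  split_ifs
  · rw [ocPoly_C_mul, ocX_apply, ocX_apply, ocPoly_mul, mul_assoc]
  · refine Subtype.ext ?_
    change ((0 : MvPolynomial (Fin (n + 2 + 1)) ℂ_[p]) :
      MvPowerSeries (Fin (n + 2 + 1)) ℂ_[p]) * f.1 = 0
    rw [MvPolynomial.coe_zero, zero_mul]

lemma twistedPderiv_of_pderiv_eq {W Q : MvPolynomial ι ℂ_[p]} {i : ι} {a : ℂ_[p]}
    (h : MvPolynomial.pderiv i W = MvPolynomial.C a * Q) (f : Overconvergent p ι) :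
    twistedPderiv W i f = ocPderiv i f + a • (ocPoly Q * f) := by
  rw [← ocPoly_C_mul, ← h]
  rfl

lemma twistedPderiv_sIdx (f : Overconvergent p (Fin (n + 2))) :
    twistedPderiv (graphPotential ϖ P) (sIdx n) f =
      ocPderiv (sIdx n) f + ϖ • ocX (Fin.last (n + 1)) f :=
  twistedPderiv_of_pderiv_eq (pderiv_sIdx_graphPotential ϖ P) f

lemma twistedPderiv_xIdx (f : Overconvergent p (Fin (n + 2 + 1))) :
    twistedPderiv (dworkPotential ϖ (addXY P)) (xIdx n) f =
      ocPderiv (xIdx n) f + ϖ • ocX (yIdx n) (ocX (Fin.last (n + 2)) f) := by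
  rw [twistedPderiv_of_pderiv_eq (pderiv_xIdx_dworkPotential ϖ P), ocPoly_mul, mul_assoc]
  rfl

lemma twistedPderiv_yIdx (f : Overconvergent p (Fin (n + 2 + 1))) :
    twistedPderiv (dworkPotential ϖ (addXY P)) (yIdx n) f =
      ocPderiv (yIdx n) f + ϖ • ocX (xIdx n) (ocX (Fin.last (n + 2)) f) := by
  rw [twistedPderiv_of_pderiv_eq (pderiv_yIdx_dworkPotential ϖ P), ocPoly_mul, mul_assoc]
  rfl

end Operators

section OperatorIdentities

variable {p : ℕ} [Fact p.Prime] {n : ℕ} (ϖ : ℂ_[p]) (P : MvPolynomial (Fin n) ℂ_[p])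

/-- The substitution `s = x y` on overconvergent power series. -/
def ocDiag (n : ℕ) : Overconvergent p (Fin (n + 2)) →ₗ[ℂ_[p]] Overconvergent p (Fin (n + 2 + 1)) :=
  ocMap (diagSub (xIdx n) (sIdx n)) fun _ hf => hf.diagSub _ _

/-- The part of weight zero for `x ∂_x - y ∂_y`, as a power series in `s = x y`. -/
def ocDiagPart (n : ℕ) :
    Overconvergent p (Fin (n + 2 + 1)) →ₗ[ℂ_[p]] Overconvergent p (Fin (n + 2)) :=
  ocMap (diagPart (xIdx n) (sIdx n)) fun _ hf => hf.diagPart _ _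

/-- The inverse of `x ∂_x - y ∂_y + c` on the parts of weight different from `-c`. -/
def ocWeight (n : ℕ) (c : ℤ) :
    Overconvergent p (Fin (n + 2 + 1)) →ₗ[ℂ_[p]] Overconvergent p (Fin (n + 2 + 1)) :=
  ocMap (weightDiv (xIdx n) (yIdx n) c) fun _ hf => hf.weightDiv _ _ _

lemma coe_ocDiag (f : Overconvergent p (Fin (n + 2))) :
    (ocDiag n f : MvPowerSeries (Fin (n + 2 + 1)) ℂ_[p]) = diagSub (xIdx n) (sIdx n) f.1 := rfl

lemma coe_ocWeight (c : ℤ) (f : Overconvergent p (Fin (n + 2 + 1))) :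
    (ocWeight n c f : MvPowerSeries (Fin (n + 2 + 1)) ℂ_[p]) =
      weightDiv (xIdx n) (yIdx n) c f.1 := rfl

lemma ocDiagPart_ocDiag (f : Overconvergent p (Fin (n + 2))) : ocDiagPart n (ocDiag n f) = f :=
  Subtype.ext (diagPart_diagSub _ _ f.1)

lemma ocDiag_injective : Function.Injective (ocDiag (p := p) n) :=
  Function.LeftInverse.injective ocDiagPart_ocDiag

lemma ocDiag_ocX_sIdx (f : Overconvergent p (Fin (n + 2))) :
    ocDiag n (ocX (sIdx n) f) = ocX (xIdx n) (ocX (yIdx n) (ocDiag n f)) := by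
  refine Subtype.ext ?_
  rw [coe_ocDiag, coe_ocX, coe_ocX, coe_ocX, diagSub_X_mul_self, xIdx_succAbove_sIdx, coe_ocDiag]

lemma ocDiag_ocX_last (f : Overconvergent p (Fin (n + 2))) :
    ocDiag n (ocX (Fin.last (n + 1)) f) = ocX (Fin.last (n + 2)) (ocDiag n f) := by
  refine Subtype.ext ?_
  rw [coe_ocDiag, coe_ocX, coe_ocX, diagSub_X_mul_of_ne _ last_ne_sIdx, xIdx_succAbove_last,
    coe_ocDiag]

lemma ocPderiv_xIdx_ocDiag (f : Overconvergent p (Fin (n + 2))) :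
    ocPderiv (xIdx n) (ocDiag n f) = ocX (yIdx n) (ocDiag n (ocPderiv (sIdx n) f)) := by
  refine Subtype.ext ?_
  rw [coe_ocPderiv, coe_ocDiag, pderiv_self_diagSub, coe_ocX, xIdx_succAbove_sIdx, coe_ocDiag,
    coe_ocPderiv]

lemma ocPderiv_yIdx_ocDiag (f : Overconvergent p (Fin (n + 2))) :
    ocPderiv (yIdx n) (ocDiag n f) = ocX (xIdx n) (ocDiag n (ocPderiv (sIdx n) f)) := by
  refine Subtype.ext ?_
  rw [coe_ocPderiv, coe_ocDiag, ← xIdx_succAbove_sIdx, pderiv_succAbove_diagSub, coe_ocX,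
    coe_ocDiag, coe_ocPderiv]

lemma twistedPderiv_xIdx_ocDiag (f : Overconvergent p (Fin (n + 2))) :
    twistedPderiv (dworkPotential ϖ (addXY P)) (xIdx n) (ocDiag n f) =
      ocX (yIdx n) (ocDiag n (twistedPderiv (graphPotential ϖ P) (sIdx n) f)) := by
  rw [twistedPderiv_xIdx, twistedPderiv_sIdx, ocPderiv_xIdx_ocDiag, map_add, map_add, map_smul,
    map_smul, ocDiag_ocX_last]

lemma twistedPderiv_yIdx_ocDiag (f : Overconvergent p (Fin (n + 2))) :
    twistedPderiv (dworkPotential ϖ (addXY P)) (yIdx n) (ocDiag n f) =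
      ocX (xIdx n) (ocDiag n (twistedPderiv (graphPotential ϖ P) (sIdx n) f)) := by
  rw [twistedPderiv_yIdx, twistedPderiv_sIdx, ocPderiv_yIdx_ocDiag, map_add, map_add, map_smul,
    map_smul, ocDiag_ocX_last]

lemma twistedPderiv_ztEmb_ocDiag (i : Fin (n + 1)) (f : Overconvergent p (Fin (n + 2))) :
    twistedPderiv (dworkPotential ϖ (addXY P)) (ztEmb n i) (ocDiag n f) =
      ocDiag n (twistedPderiv (graphPotential ϖ P) ((sIdx n).succAboveEmb i) f) := by
  have h := ocMap_twistedPderiv_rename (sIdx n).succAboveEmb (ztEmb n)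
    (diagSub (xIdx n) (sIdx n)) (fun _ hf => hf.diagSub _ _)
    (fun i f => diagSub_X_mul_of_ne _ (Fin.succAbove_ne _ _) f) (i := i)
    (fun f => (pderiv_diagSub_of_ne _ (Fin.succAbove_ne _ _) f).symm) (dworkPotential ϖ P) f
  rw [twistedPderiv_addXY, twistedPderiv_graph, map_add]
  refine congrArg₂ (· + ·) h.symm ?_
  split_ifs
  · rw [map_smul, ocDiag_ocX_sIdx]
  · rw [map_zero]

lemma weightExp_single_xIdx : weightExp (xIdx n) (yIdx n) (Finsupp.single (xIdx n) 1) = 1 := by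
  simp [weightExp, yIdx_ne_xIdx]

lemma weightExp_single_yIdx : weightExp (xIdx n) (yIdx n) (Finsupp.single (yIdx n) 1) = -1 := by
  simp [weightExp, yIdx_ne_xIdx.symm]

lemma weightExp_single_ztEmb (i : Fin (n + 1)) :
    weightExp (xIdx n) (yIdx n) (Finsupp.single (ztEmb n i) 1) = 0 := by
  simp [weightExp, (ztEmb_ne_xIdx i).symm, (ztEmb_ne_yIdx i).symm]

lemma ocWeight_ocX {c c' : ℤ} {i : Fin (n + 2 + 1)}
    (h : c = c' + weightExp (xIdx n) (yIdx n) (Finsupp.single i 1))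
    (f : Overconvergent p (Fin (n + 2 + 1))) :
    ocWeight n c' (ocX i f) = ocX i (ocWeight n c f) := by
  refine Subtype.ext ?_
  rw [coe_ocWeight, coe_ocX, coe_ocX, weightDiv_X_mul h, coe_ocWeight]

lemma ocWeight_ocX_last (c : ℤ) (f : Overconvergent p (Fin (n + 2 + 1))) :
    ocWeight n c (ocX (Fin.last (n + 2)) f) = ocX (Fin.last (n + 2)) (ocWeight n c f) := by
  refine ocWeight_ocX ?_ f
  rw [← ztEmb_last, weightExp_single_ztEmb, add_zero]

lemma twistedPderiv_ztEmb_ocWeight (c : ℤ) (i : Fin (n + 1))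
    (f : Overconvergent p (Fin (n + 2 + 1))) :
    twistedPderiv (dworkPotential ϖ (addXY P)) (ztEmb n i) (ocWeight n c f) =
      ocWeight n c (twistedPderiv (dworkPotential ϖ (addXY P)) (ztEmb n i) f) := by
  have h := ocMap_twistedPderiv_rename (ztEmb n) (ztEmb n)
    (weightDiv (xIdx n) (yIdx n) c) (fun _ hf => hf.weightDiv _ _ _)
    (fun i f => weightDiv_X_mul (by rw [weightExp_single_ztEmb, add_zero]) f) (i := i)
    (fun f => (pderiv_weightDiv (by rw [weightExp_single_ztEmb, add_zero]) f).symm)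
    (dworkPotential ϖ P) f
  rw [twistedPderiv_addXY, twistedPderiv_addXY, map_add]
  refine congrArg₂ (· + ·) h.symm ?_
  split_ifs
  · have h1 : c + 1 = c + weightExp (xIdx n) (yIdx n) (Finsupp.single (xIdx n) 1) := by
      rw [weightExp_single_xIdx]
    have h2 : c = c + 1 + weightExp (xIdx n) (yIdx n) (Finsupp.single (yIdx n) 1) := by
      rw [weightExp_single_yIdx]
      ring
    rw [map_smul, ocWeight_ocX h1, ocWeight_ocX h2]
  · rw [map_zero]

lemma twistedPderiv_xIdx_ocWeight {c c' : ℤ} (h : c' = c + 1)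
    (f : Overconvergent p (Fin (n + 2 + 1))) :
    twistedPderiv (dworkPotential ϖ (addXY P)) (xIdx n) (ocWeight n c f) =
      ocWeight n c' (twistedPderiv (dworkPotential ϖ (addXY P)) (xIdx n) f) := by
  have h1 : c' = c + weightExp (xIdx n) (yIdx n) (Finsupp.single (xIdx n) 1) := by
    rw [weightExp_single_xIdx, h]
  have h2 : c = c' + weightExp (xIdx n) (yIdx n) (Finsupp.single (yIdx n) 1) := by
    rw [weightExp_single_yIdx, h]
    ring
  have h3 : ocPderiv (xIdx n) (ocWeight n c f) = ocWeight n c' (ocPderiv (xIdx n) f) :=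
    Subtype.ext (pderiv_weightDiv h1 f.1)
  rw [twistedPderiv_xIdx, twistedPderiv_xIdx, map_add, map_smul, h3, ocWeight_ocX h2,
    ocWeight_ocX_last]

lemma twistedPderiv_yIdx_ocWeight {c c' : ℤ} (h : c = c' + 1)
    (f : Overconvergent p (Fin (n + 2 + 1))) :
    twistedPderiv (dworkPotential ϖ (addXY P)) (yIdx n) (ocWeight n c f) =
      ocWeight n c' (twistedPderiv (dworkPotential ϖ (addXY P)) (yIdx n) f) := by
  have h1 : c' = c + weightExp (xIdx n) (yIdx n) (Finsupp.single (yIdx n) 1) := by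
    rw [weightExp_single_yIdx, h]
    ring
  have h2 : c = c' + weightExp (xIdx n) (yIdx n) (Finsupp.single (xIdx n) 1) := by
    rw [weightExp_single_xIdx, h]
  have h3 : ocPderiv (yIdx n) (ocWeight n c f) = ocWeight n c' (ocPderiv (yIdx n) f) :=
    Subtype.ext (pderiv_weightDiv h1 f.1)
  rw [twistedPderiv_yIdx, twistedPderiv_yIdx, map_add, map_smul, h3, ocWeight_ocX h2,
    ocWeight_ocX_last]

lemma euler_twistedPderiv (f : Overconvergent p (Fin (n + 2 + 1))) :
    ocX (xIdx n) (twistedPderiv (dworkPotential ϖ (addXY P)) (xIdx n) f) -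
      ocX (yIdx n) (twistedPderiv (dworkPotential ϖ (addXY P)) (yIdx n) f) =
    ocX (xIdx n) (ocPderiv (xIdx n) f) - ocX (yIdx n) (ocPderiv (yIdx n) f) := by
  rw [twistedPderiv_xIdx, twistedPderiv_yIdx, map_add, map_add, map_smul, map_smul,
    ocX_comm (xIdx n) (yIdx n)]
  abel

lemma coeff_euler_ocWeight (c : ℤ) (f : Overconvergent p (Fin (n + 2 + 1)))
    (J : Fin (n + 2 + 1) →₀ ℕ) : MvPowerSeries.coeff J
      (ocX (xIdx n) (twistedPderiv (dworkPotential ϖ (addXY P)) (xIdx n) (ocWeight n c f)) -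
      ocX (yIdx n) (twistedPderiv (dworkPotential ϖ (addXY P)) (yIdx n) (ocWeight n c f)) +
      (c : ℂ_[p]) • ocWeight n c f).1 =
      if weightExp (xIdx n) (yIdx n) J + c = 0 then 0 else MvPowerSeries.coeff J f.1 := by
  rw [euler_twistedPderiv, ← euler_weightDiv]
  change MvPowerSeries.coeff J ((ocX (xIdx n) (ocPderiv (xIdx n) (ocWeight n c f))).1 -
    (ocX (yIdx n) (ocPderiv (yIdx n) (ocWeight n c f))).1 + (c : ℂ_[p]) • (ocWeight n c f).1) = _
  rw [coe_ocX, coe_ocX]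
  rfl

lemma eq_of_forall_coeff {ι : Type} {f g : Overconvergent p ι}
    (h : ∀ J, MvPowerSeries.coeff J f.1 = MvPowerSeries.coeff J g.1) : f = g :=
  Subtype.ext (MvPowerSeries.ext h)

lemma coeff_ocDiag_ocDiagPart (f : Overconvergent p (Fin (n + 2 + 1)))
    (J : Fin (n + 2 + 1) →₀ ℕ) : MvPowerSeries.coeff J (ocDiag n (ocDiagPart n f)).1 =
      if J (xIdx n) = J (yIdx n) then MvPowerSeries.coeff J f.1 else 0 := by
  rw [← xIdx_succAbove_sIdx]
  exact coeff_diagSub_diagPart _ _ _ _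

lemma sub_ocDiag_ocDiagPart (f : Overconvergent p (Fin (n + 2 + 1))) :
    f - ocDiag n (ocDiagPart n f) =
      ocX (xIdx n) (twistedPderiv (dworkPotential ϖ (addXY P)) (xIdx n) (ocWeight n 0 f)) -
      ocX (yIdx n) (twistedPderiv (dworkPotential ϖ (addXY P)) (yIdx n) (ocWeight n 0 f)) := by
  refine eq_of_forall_coeff fun J => ?_
  have h := coeff_euler_ocWeight ϖ P 0 f J
  rw [Int.cast_zero, zero_smul, add_zero] at h
  rw [h]
  change MvPowerSeries.coeff J (f.1 - (ocDiag n (ocDiagPart n f)).1) = _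
  rw [map_sub, coeff_ocDiag_ocDiagPart, weightExp]
  by_cases hJ : J (xIdx n) = J (yIdx n)
  · rw [if_pos hJ, if_pos (by omega), sub_self]
  · rw [if_neg hJ, if_neg (by omega), sub_zero]

lemma sub_ocX_xIdx_ocDiagPart (f : Overconvergent p (Fin (n + 2 + 1))) :
    f - ocX (xIdx n) (ocDiag n (ocDiagPart n (ocShift (xIdx n) f))) =
      ocX (xIdx n) (twistedPderiv (dworkPotential ϖ (addXY P)) (xIdx n) (ocWeight n (-1) f)) -
      twistedPderiv (dworkPotential ϖ (addXY P)) (yIdx n) (ocX (yIdx n) (ocWeight n (-1) f)) := by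
  refine eq_of_forall_coeff fun J => ?_
  have h := coeff_euler_ocWeight ϖ P (-1) f J
  rw [Int.cast_neg, Int.cast_one, neg_one_smul, ← sub_eq_add_neg, sub_sub,
    ← twistedPderiv_ocX_self] at h
  rw [h]
  change MvPowerSeries.coeff J (f.1 -
    (ocX (xIdx n) (ocDiag n (ocDiagPart n (ocShift (xIdx n) f)))).1) = _
  rw [map_sub, coe_ocX, coeff_X_mul_eq, coeff_ocDiag_ocDiagPart, weightExp, coe_ocShift,
    coeff_shiftX]
  by_cases hJ : J (xIdx n) = 0
  · rw [if_pos hJ, if_neg (by omega), sub_zero]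
  · have h1 : (J - Finsupp.single (xIdx n) 1 : Fin (n + 2 + 1) →₀ ℕ) (xIdx n) = J (xIdx n) - 1 := by
      simp
    have h2 : (J - Finsupp.single (xIdx n) 1 : Fin (n + 2 + 1) →₀ ℕ) (yIdx n) = J (yIdx n) := by
      simp [yIdx_ne_xIdx]
    rw [if_neg hJ, sub_single_add_single hJ, h1, h2]
    by_cases hJ' : J (xIdx n) - 1 = J (yIdx n)
    · rw [if_pos hJ', if_pos (by omega), sub_self]
    · rw [if_neg hJ', if_neg (by omega), sub_zero]

lemma sub_ocX_yIdx_ocDiagPart (f : Overconvergent p (Fin (n + 2 + 1))) :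
    f - ocX (yIdx n) (ocDiag n (ocDiagPart n (ocShift (yIdx n) f))) =
      twistedPderiv (dworkPotential ϖ (addXY P)) (xIdx n) (ocX (xIdx n) (ocWeight n 1 f)) -
      ocX (yIdx n) (twistedPderiv (dworkPotential ϖ (addXY P)) (yIdx n) (ocWeight n 1 f)) := by
  refine eq_of_forall_coeff fun J => ?_
  have h := coeff_euler_ocWeight ϖ P 1 f J
  rw [Int.cast_one, one_smul, sub_add_eq_add_sub, ← twistedPderiv_ocX_self] at h
  rw [h]
  change MvPowerSeries.coeff J (f.1 -
    (ocX (yIdx n) (ocDiag n (ocDiagPart n (ocShift (yIdx n) f)))).1) = _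
  rw [map_sub, coe_ocX, coeff_X_mul_eq, coeff_ocDiag_ocDiagPart, weightExp, coe_ocShift,
    coeff_shiftX]
  by_cases hJ : J (yIdx n) = 0
  · rw [if_pos hJ, if_neg (by omega), sub_zero]
  · have h1 : (J - Finsupp.single (yIdx n) 1 : Fin (n + 2 + 1) →₀ ℕ) (yIdx n) = J (yIdx n) - 1 := by
      simp
    have h2 : (J - Finsupp.single (yIdx n) 1 : Fin (n + 2 + 1) →₀ ℕ) (xIdx n) = J (xIdx n) := by
      simp [yIdx_ne_xIdx.symm]
    rw [if_neg hJ, sub_single_add_single hJ, h1, h2]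
    by_cases hJ' : J (xIdx n) = J (yIdx n) - 1
    · rw [if_pos hJ', if_pos (by omega), sub_self]
    · rw [if_neg hJ', if_neg (by omega), sub_zero]

lemma twistedPderiv_graph_ocRename (i : Fin (n + 1)) (f : Overconvergent p (Fin (n + 1))) :
    twistedPderiv (graphPotential ϖ P) ((sIdx n).succAboveEmb i)
        (ocRename (sIdx n).succAboveEmb f) =
      ocRename (sIdx n).succAboveEmb (twistedPderiv (dworkPotential ϖ P) i f) +
        if i = Fin.last n then ϖ • ocX (sIdx n) (ocRename (sIdx n).succAboveEmb f) else 0 := by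
  rw [twistedPderiv_graph, twistedPderiv_ocRename (sIdx n).succAboveEmb
    (MvPolynomial.pderiv_rename (sIdx n).succAboveEmb.injective _ _)]

lemma ocKill_twistedPderiv_graph (i : Fin (n + 1)) (f : Overconvergent p (Fin (n + 2))) :
    ocKill (sIdx n).succAboveEmb
        (twistedPderiv (graphPotential ϖ P) ((sIdx n).succAboveEmb i) f) =
      twistedPderiv (dworkPotential ϖ P) i (ocKill (sIdx n).succAboveEmb f) := by
  have h : ocKill (sIdx n).succAboveEmb
      (if i = Fin.last n then ϖ • ocX (sIdx n) f else 0) = 0 := by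
    split_ifs
    · rw [map_smul, ocKill_ocX, smul_zero]
    · rw [map_zero]
  rw [twistedPderiv_graph, map_add, h, add_zero]
  refine Subtype.ext ?_
  rw [coe_ocKill, coe_twistedPderiv, coe_twistedPderiv, map_add, killCompl_pderiv,
    MvPolynomial.pderiv_rename (sIdx n).succAboveEmb.injective, killCompl_coe_rename_mul, coe_ocKill]

lemma twistedPderiv_dworkPotential_ocX_last (i : Fin (n + 1)) (f : Overconvergent p (Fin (n + 1))) :
    twistedPderiv (dworkPotential ϖ P) i (ocX (Fin.last n) f) =
      ocX (Fin.last n) (twistedPderiv (dworkPotential ϖ P) i f) +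
        if i = Fin.last n then f else 0 := by
  split_ifs with h
  · rw [h, twistedPderiv_ocX_self]
  · rw [twistedPderiv_ocX_of_ne _ (Ne.symm h), add_zero]

end OperatorIdentities

/-! ### The suspension of a hypersurface -/

section Hypersurface

variable {p : ℕ} [Fact p.Prime] {n : ℕ}

/-- The differential in the directions `z`, `t` for the potential `ϖ t P`. -/
def hypD (ϖ : ℂ_[p]) (P : MvPolynomial (Fin n) ℂ_[p]) :
    (Finset (Fin (n + 1)) → Overconvergent p (Fin (n + 1))) →ₗ[ℂ_[p]]
      (Finset (Fin (n + 1)) → Overconvergent p (Fin (n + 1))) :=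
  totalD (twistedPderiv (dworkPotential ϖ P))

/-- The differential in the directions `z`, `t` for the potential `ϖ t (P + s)`. -/
def graphD (ϖ : ℂ_[p]) (P : MvPolynomial (Fin n) ℂ_[p]) :
    (Finset (Fin (n + 1)) → Overconvergent p (Fin (n + 2))) →ₗ[ℂ_[p]]
      (Finset (Fin (n + 1)) → Overconvergent p (Fin (n + 2))) :=
  totalD fun i => twistedPderiv (graphPotential ϖ P) ((sIdx n).succAboveEmb i)

/-- The differential in the directions `z`, `t` for the potential `ϖ t (P + x y)`. -/
def suspD (ϖ : ℂ_[p]) (P : MvPolynomial (Fin n) ℂ_[p]) :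
    (Finset (Fin (n + 1)) → Overconvergent p (Fin (n + 2 + 1))) →ₗ[ℂ_[p]]
      (Finset (Fin (n + 1)) → Overconvergent p (Fin (n + 2 + 1))) :=
  totalD fun i => twistedPderiv (dworkPotential ϖ (addXY P)) (ztEmb n i)

lemma ocDiagPart_ocShift_ocX_ocDiag (f : Overconvergent p (Fin (n + 2))) :
    ocDiagPart n (ocShift (xIdx n) (ocX (xIdx n) (ocDiag n f))) = f := by
  have h : ocShift (xIdx n) (ocX (xIdx n) (ocDiag n f)) = ocDiag n f :=
    Subtype.ext (by rw [coe_ocShift, coe_ocX, shiftX_X_mul])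
  rw [h, ocDiagPart_ocDiag]

lemma twistedPderiv_ocX_ocDiag (ϖ : ℂ_[p]) (P : MvPolynomial (Fin n) ℂ_[p])
    (f : Overconvergent p (Fin (n + 2))) :
    twistedPderiv (dworkPotential ϖ (addXY P)) (xIdx n) (ocX (xIdx n) (ocDiag n f)) =
      ocDiag n (twistedPderiv (graphPotential ϖ P) (sIdx n) (ocX (sIdx n) f)) := by
  rw [twistedPderiv_ocX_self, twistedPderiv_xIdx_ocDiag, twistedPderiv_ocX_self, map_add,
    ocDiag_ocX_sIdx]

lemma graphD_ocRename (ϖ : ℂ_[p]) (P : MvPolynomial (Fin n) ℂ_[p])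
    (a : Finset (Fin (n + 1)) → Overconvergent p (Fin (n + 1))) :
    graphD ϖ P ((ocRename (sIdx n).succAboveEmb).compLeft _ a) =
      (ocRename (sIdx n).succAboveEmb).compLeft _ (hypD ϖ P a) +
      ϖ • (ocX (sIdx n)).compLeft _ ((ocRename (sIdx n).succAboveEmb).compLeft _
        (extMul (R := ℂ_[p]) (Fin.last n) a)) := by
  refine (totalD_compLeft_add _ _ _ (ϖ • ocX (p := p) (sIdx n) ∘ₗ ocRename (sIdx n).succAboveEmb) _
    (twistedPderiv_graph_ocRename ϖ P) a).trans ?_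
  rw [extMul_compLeft]
  rfl

set_option maxHeartbeats 1000000 in
/-- The operators of the suspension of the hypersurface `P = 0`. -/
def suspensionData (ϖ : ℂ_[p]) (P : MvPolynomial (Fin n) ℂ_[p]) :
    SuspensionData ℂ_[p] (Finset (Fin (n + 1)) → Overconvergent p (Fin (n + 1)))
      (Finset (Fin (n + 1)) → Overconvergent p (Fin (n + 2)))
      (Finset (Fin (n + 1)) → Overconvergent p (Fin (n + 2 + 1))) where
  ϖ := ϖ
  dA := hypD ϖ P
  eA := extMul (Fin.last n)
  tA := (ocX (Fin.last n)).compLeft _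
  dA_eA := totalD_extMul _ _
  eA_eA := extMul_extMul _
  dA_tA := totalD_compLeft_add _ _ _ LinearMap.id _ (twistedPderiv_dworkPotential_ocX_last ϖ P)
  eA_tA := extMul_compLeft _ _
  dS := graphD ϖ P
  Ds := (twistedPderiv (graphPotential ϖ P) (sIdx n)).compLeft _
  Xs := (ocX (sIdx n)).compLeft _
  c := (ocRename (sIdx n).succAboveEmb).compLeft _
  ev := (ocKill (sIdx n).succAboveEmb).compLeft _
  sh := (ocShift (sIdx n)).compLeft _
  dS_c := graphD_ocRename ϖ P
  Ds_c a := funext fun s => by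
    exact (twistedPderiv_sIdx_ocRename ϖ P (a s)).trans (map_smul _ _ _)
  dS_Xs := totalD_compLeft _ _ _ fun i => twistedPderiv_ocX_of_ne _ (Fin.succAbove_ne _ _).symm
  Xs_inj f g h := funext fun s => ocX_injective _ (congrFun h s)
  ev_c a := funext fun s => ocKill_ocRename _ (a s)
  ev_Xs f := funext fun s => ocKill_ocX _ (f s)
  ev_dS f := (totalD_compLeft _ _ _ (fun i f => (ocKill_twistedPderiv_graph ϖ P i f).symm) f).symm
  c_ev_add f := funext fun s => ocRename_ocKill_add _ (f s)
  dM := suspD ϖ P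
  Dx := (twistedPderiv (dworkPotential ϖ (addXY P)) (xIdx n)).compLeft _
  Dy := (twistedPderiv (dworkPotential ϖ (addXY P)) (yIdx n)).compLeft _
  X := (ocX (xIdx n)).compLeft _
  Y := (ocX (yIdx n)).compLeft _
  j := (ocDiag n).compLeft _
  dM_dM := totalD_totalD _ fun _ _ => twistedPderiv_comm_apply _ _ _
  dM_Dx := totalD_compLeft _ _ _ fun i => twistedPderiv_comm_apply _ _ _
  dM_Dy := totalD_compLeft _ _ _ fun i => twistedPderiv_comm_apply _ _ _
  Dx_Dy f := funext fun s => twistedPderiv_comm_apply _ _ _ (f s)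
  dM_X := totalD_compLeft _ _ _ fun i => twistedPderiv_ocX_of_ne _ (ztEmb_ne_xIdx i).symm
  dM_Y := totalD_compLeft _ _ _ fun i => twistedPderiv_ocX_of_ne _ (ztEmb_ne_yIdx i).symm
  Dx_X f := funext fun s => twistedPderiv_ocX_self _ _ (f s)
  Dy_Y f := funext fun s => twistedPderiv_ocX_self _ _ (f s)
  Dx_Y f := funext fun s => twistedPderiv_ocX_of_ne _ yIdx_ne_xIdx (f s)
  Dy_X f := funext fun s => twistedPderiv_ocX_of_ne _ yIdx_ne_xIdx.symm (f s)
  X_Y f := funext fun s => ocX_comm _ _ (f s)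
  X_inj f g h := funext fun s => ocX_injective _ (congrFun h s)
  Y_inj f g h := funext fun s => ocX_injective _ (congrFun h s)
  j_inj f g h := funext fun s => ocDiag_injective (congrFun h s)
  dM_j := totalD_compLeft _ _ _ (twistedPderiv_ztEmb_ocDiag ϖ P)
  Dx_j f := funext fun s => twistedPderiv_xIdx_ocDiag ϖ P (f s)
  Dy_j f := funext fun s => twistedPderiv_yIdx_ocDiag ϖ P (f s)
  j_Xs f := funext fun s => ocDiag_ocX_sIdx (f s)
  Dx_X_j f := funext fun s => twistedPderiv_ocX_ocDiag ϖ P (f s)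
  Gz := (ocWeight n 0).compLeft _
  Gm := (ocWeight n (-1)).compLeft _
  Gp := (ocWeight n 1).compLeft _
  q := (ocDiagPart n).compLeft _
  qp := (ocDiagPart n ∘ₗ ocShift (xIdx n)).compLeft _
  qm := (ocDiagPart n ∘ₗ ocShift (yIdx n)).compLeft _
  Gz_spec f := funext fun s => sub_ocDiag_ocDiagPart ϖ P (f s)
  Gm_spec f := funext fun s => sub_ocX_xIdx_ocDiagPart ϖ P (f s)
  Gp_spec f := funext fun s => sub_ocX_yIdx_ocDiagPart ϖ P (f s)
  dM_Gz := totalD_compLeft _ _ _ (twistedPderiv_ztEmb_ocWeight ϖ P 0)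
  dM_Gm := totalD_compLeft _ _ _ (twistedPderiv_ztEmb_ocWeight ϖ P (-1))
  dM_Gp := totalD_compLeft _ _ _ (twistedPderiv_ztEmb_ocWeight ϖ P 1)
  Dy_Gz f := funext fun s => twistedPderiv_yIdx_ocWeight ϖ P (by norm_num) (f s)
  Dx_Gz f := funext fun s => twistedPderiv_xIdx_ocWeight ϖ P (by norm_num) (f s)
  Dx_Gm f := funext fun s => twistedPderiv_xIdx_ocWeight ϖ P (by norm_num) (f s)
  Dy_Gp f := funext fun s => twistedPderiv_yIdx_ocWeight ϖ P (by norm_num) (f s)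
  q_j f := funext fun s => ocDiagPart_ocDiag (f s)
  qp_X_j f := funext fun s => ocDiagPart_ocShift_ocX_ocDiag (f s)

end Hypersurface

section Quad

variable {M : Type*} [AddCommGroup M] {m n : ℕ}

lemma formMk_sub (i : Fin (m + 1)) (a b a' b' : Finset (Fin m) → M) :
    formMk i (a - a') (b - b') = formMk i a b - formMk i a' b' := by
  ext s
  simp only [formMk, Pi.sub_apply]
  split_ifs <;> simp [smul_sub]

lemma DegreeGE.formMk {k : ℕ} {i : Fin (m + 1)} {a b : Finset (Fin m) → M}
    (ha : DegreeGE (k + 1) a) (hb : DegreeGE k b) : DegreeGE (k + 1) (formMk i a b) := by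
  intro s hs
  rw [_root_.formMk]
  have h := card_pivotPreimage i s
  split_ifs with hi
  · rw [hb _ (by rw [h, Finset.card_erase_of_mem hi]; have := Finset.card_pos.mpr ⟨i, hi⟩; omega),
      smul_zero]
  · exact ha _ (by rw [h, Finset.erase_eq_of_notMem hi]; exact hs)

/-- The form `a₀ + dy a₁ + dx b₀ + dx dy b₁`. -/
def formQuad (a₀ a₁ b₀ b₁ : Finset (Fin (n + 1)) → M) : Finset (Fin (n + 2 + 1)) → M :=
  formMk (xIdx n) (formMk (sIdx n) a₀ a₁) (formMk (sIdx n) b₀ b₁)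

lemma formQuad_inj {a₀ a₁ b₀ b₁ a₀' a₁' b₀' b₁' : Finset (Fin (n + 1)) → M}
    (h : formQuad a₀ a₁ b₀ b₁ = formQuad a₀' a₁' b₀' b₁') :
    a₀ = a₀' ∧ a₁ = a₁' ∧ b₀ = b₀' ∧ b₁ = b₁' := by
  obtain ⟨h1, h2⟩ := formMk_inj _ h
  obtain ⟨h3, h4⟩ := formMk_inj _ h1
  obtain ⟨h5, h6⟩ := formMk_inj _ h2
  exact ⟨h3, h4, h5, h6⟩

lemma formQuad_zero : formQuad (0 : Finset (Fin (n + 1)) → M) 0 0 0 = 0 := by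
  rw [formQuad, formMk_zero, formMk_zero]

lemma formQuad_add (a₀ a₁ b₀ b₁ a₀' a₁' b₀' b₁' : Finset (Fin (n + 1)) → M) :
    formQuad (a₀ + a₀') (a₁ + a₁') (b₀ + b₀') (b₁ + b₁') =
      formQuad a₀ a₁ b₀ b₁ + formQuad a₀' a₁' b₀' b₁' := by
  rw [formQuad, formMk_add, formMk_add, formMk_add, formQuad, formQuad]

lemma formQuad_sub (a₀ a₁ b₀ b₁ a₀' a₁' b₀' b₁' : Finset (Fin (n + 1)) → M) :
    formQuad (a₀ - a₀') (a₁ - a₁') (b₀ - b₀') (b₁ - b₁') =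
      formQuad a₀ a₁ b₀ b₁ - formQuad a₀' a₁' b₀' b₁' := by
  rw [formQuad, formMk_sub, formMk_sub, formMk_sub, formQuad, formQuad]

lemma formQuad_smul {R : Type*} [CommRing R] [Module R M] (c : R)
    (a₀ a₁ b₀ b₁ : Finset (Fin (n + 1)) → M) :
    formQuad (c • a₀) (c • a₁) (c • b₀) (c • b₁) = c • formQuad a₀ a₁ b₀ b₁ := by
  rw [formQuad, formMk_smul, formMk_smul, formMk_smul, formQuad]

lemma degreePart_formQuad (k : ℕ) (a₀ a₁ b₀ b₁ : Finset (Fin (n + 1)) → M) :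
    formQuad (degreePart (k + 2) a₀) (degreePart (k + 1) a₁) (degreePart (k + 1) b₀)
      (degreePart k b₁) = degreePart (k + 2) (formQuad a₀ a₁ b₀ b₁) := by
  rw [formQuad, degreePart_formMk, degreePart_formMk, degreePart_formMk, formQuad]

lemma exists_formQuad_eq {k : ℕ} {ω : Finset (Fin (n + 2 + 1)) → M} (h : DegreeGE (k + 2) ω) :
    ∃ a₀ a₁ b₀ b₁ : Finset (Fin (n + 1)) → M, formQuad a₀ a₁ b₀ b₁ = ω ∧ DegreeGE (k + 2) a₀ ∧
      DegreeGE (k + 1) a₁ ∧ DegreeGE (k + 1) b₀ ∧ DegreeGE k b₁ := by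
  refine ⟨formRes (R := ℤ) (sIdx n) (formRes (R := ℤ) (xIdx n) ω),
    formCon (R := ℤ) (sIdx n) (formRes (R := ℤ) (xIdx n) ω),
    formRes (R := ℤ) (sIdx n) (formCon (R := ℤ) (xIdx n) ω),
    formCon (R := ℤ) (sIdx n) (formCon (R := ℤ) (xIdx n) ω), ?_, h.formRes.formRes,
    h.formRes.formCon, h.formCon.formRes, h.formCon.formCon⟩
  rw [formQuad, formMk_res_con, formMk_res_con, formMk_res_con]

lemma degreePart_eq_self {ι : Type} {k : ℕ} {ω : Finset ι → M} (h : ∀ s, s.card ≠ k → ω s = 0) :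
    degreePart k ω = ω := by
  ext s
  rw [degreePart]
  split_ifs with hs
  · rfl
  · exact (h s hs).symm

lemma degreePart_sub {ι : Type} (k : ℕ) (ω η : Finset ι → M) :
    degreePart k (ω - η) = degreePart k ω - degreePart k η := by
  ext s
  simp only [degreePart, Pi.sub_apply]
  split_ifs <;> simp

lemma degreeGE_degreePart {ι : Type} (k : ℕ) (ω : Finset ι → M) : DegreeGE k (degreePart k ω) :=
  fun _ hs => if_neg hs.ne

end Quad

section SuspensionMap

variable {p : ℕ} [Fact p.Prime] {n : ℕ} {ϖ : ℂ_[p]}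

lemma totalD_formQuad (ϖ : ℂ_[p]) (P : MvPolynomial (Fin n) ℂ_[p])
    (u₀ u₁ v₀ v₁ : Finset (Fin (n + 1)) → Overconvergent p (Fin (n + 2 + 1))) :
    totalD (twistedPderiv (dworkPotential ϖ (addXY P))) (formQuad u₀ u₁ v₀ v₁) =
      formQuad (suspD ϖ P u₀)
        ((twistedPderiv (dworkPotential ϖ (addXY P)) (yIdx n)).compLeft _ u₀ - suspD ϖ P u₁)
        ((twistedPderiv (dworkPotential ϖ (addXY P)) (xIdx n)).compLeft _ u₀ - suspD ϖ P v₀)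
        ((twistedPderiv (dworkPotential ϖ (addXY P)) (xIdx n)).compLeft _ u₁ -
          ((twistedPderiv (dworkPotential ϖ (addXY P)) (yIdx n)).compLeft _ v₀ -
            suspD ϖ P v₁)) := by
  rw [formQuad, totalD_formMk, totalD_formMk, totalD_formMk, formMk_compLeft, ← formMk_sub,
    xIdx_succAbove_sIdx]
  rfl

variable (ϖ) (P : MvPolynomial (Fin n) ℂ_[p])

lemma isD_iff {u₀ u₁ v₀ v₁ a₀ a₁ b₀ b₁ : Finset (Fin (n + 1)) → Overconvergent p (Fin (n + 2 + 1))} :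
    (suspensionData ϖ P).IsD u₀ u₁ v₀ v₁ a₀ a₁ b₀ b₁ ↔
      totalD (twistedPderiv (dworkPotential ϖ (addXY P))) (formQuad u₀ u₁ v₀ v₁) =
        formQuad a₀ a₁ b₀ b₁ := by
  rw [totalD_formQuad]
  refine ⟨?_, formQuad_inj⟩
  rintro ⟨rfl, rfl, rfl, rfl⟩
  rfl

lemma closed_iff {a₀ a₁ b₀ b₁ : Finset (Fin (n + 1)) → Overconvergent p (Fin (n + 2 + 1))} :
    (suspensionData ϖ P).Closed a₀ a₁ b₀ b₁ ↔
      totalD (twistedPderiv (dworkPotential ϖ (addXY P))) (formQuad a₀ a₁ b₀ b₁) = 0 := by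
  rw [totalD_formQuad, ← formQuad_zero]
  constructor
  · rintro ⟨h1, h2, h3, h4⟩
    have h4' : (suspensionData ϖ P).Dx a₁ - ((suspensionData ϖ P).Dy b₀ -
      (suspensionData ϖ P).dM b₁) = 0 := by
      rw [← h4]
      abel
    exact congr (congr (congrArg₂ formQuad h1 (sub_eq_zero.mpr h2)) (sub_eq_zero.mpr h3)) h4'
  · intro h
    obtain ⟨h1, h2, h3, h4⟩ := formQuad_inj h
    refine ⟨h1, sub_eq_zero.mp h2, sub_eq_zero.mp h3, ?_⟩
    rw [← h4]
    change _ = (suspensionData ϖ P).Dx a₁ - ((suspensionData ϖ P).Dy b₀ -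
      (suspensionData ϖ P).dM b₁)
    abel

/-- The suspension `ω ↦ d(x t) dy ω`, as a map from the forms in `z`, `t` to the forms in `z`, `x`,
`y`, `t`. -/
def suspMap : (Finset (Fin (n + 1)) → Overconvergent p (Fin (n + 1))) →ₗ[ℂ_[p]]
    (Finset (Fin (n + 2 + 1)) → Overconvergent p (Fin (n + 2 + 1))) where
  toFun ω := formQuad 0 ((suspensionData ϖ P).phiY ω) 0 ((suspensionData ϖ P).phiXY ω)
  map_add' ω η := by
    rw [map_add, map_add, ← formQuad_add, add_zero]
  map_smul' a ω := by
    rw [map_smul, map_smul, RingHom.id_apply, ← formQuad_smul, smul_zero]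

lemma suspMap_apply (ω : Finset (Fin (n + 1)) → Overconvergent p (Fin (n + 1))) :
    suspMap ϖ P ω =
      formQuad 0 ((suspensionData ϖ P).phiY ω) 0 ((suspensionData ϖ P).phiXY ω) := rfl

lemma totalD_suspMap (ω : Finset (Fin (n + 1)) → Overconvergent p (Fin (n + 1))) :
    totalD (twistedPderiv (dworkPotential ϖ (addXY P))) (suspMap ϖ P ω) =
      suspMap ϖ P (hypD ϖ P ω) := by
  rw [suspMap_apply, suspMap_apply, ← isD_iff]
  refine ⟨map_zero _, ?_, ?_, ?_⟩
  · rw [map_zero, zero_sub]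
    exact (suspensionData ϖ P).dM_phiY ω
  · rw [map_zero, map_zero, sub_zero]
  · rw [map_zero, zero_sub, sub_neg_eq_add]
    exact (suspensionData ϖ P).phi_commutes ω

lemma degreePart_suspMap (k : ℕ) (ω : Finset (Fin (n + 1)) → Overconvergent p (Fin (n + 1))) :
    degreePart (k + 2) (suspMap ϖ P ω) = suspMap ϖ P (degreePart k ω) := by
  have h0 : ∀ l, degreePart l (0 : Finset (Fin (n + 1)) → Overconvergent p (Fin (n + 2 + 1))) = 0 :=
    fun l => funext fun s => ite_self _
  have h1 : (suspensionData ϖ P).phiY (degreePart k ω) =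
      degreePart (k + 1) ((suspensionData ϖ P).phiY ω) := by
    have h2 : ∀ ω, (suspensionData ϖ P).phiY ω = (-(ocX (xIdx n) ∘ₗ ocDiag n ∘ₗ
        ocRename (p := p) (sIdx n).succAboveEmb)).compLeft _
          (extMul (R := ℂ_[p]) (Fin.last n) ω) := fun _ => rfl
    rw [h2, h2, degreePart_extMul, degreePart_compLeft]
  have h2 : (suspensionData ϖ P).phiXY (degreePart k ω) =
      degreePart k ((suspensionData ϖ P).phiXY ω) := by
    have h2 : ∀ ω, (suspensionData ϖ P).phiXY ω = (ocDiag n ∘ₗ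
        ocRename (p := p) (sIdx n).succAboveEmb ∘ₗ ocX (Fin.last n)).compLeft _ ω := fun _ => rfl
    rw [h2, h2, degreePart_compLeft]
  rw [suspMap_apply, suspMap_apply, ← degreePart_formQuad, h1, h2, h0, h0]

/-- Forms of degree at least `k`. -/
def degreeGESubmodule (M : Type*) [AddCommGroup M] [Module ℂ_[p] M] (m k : ℕ) :
    Submodule ℂ_[p] (Finset (Fin m) → M) where
  carrier := {ω | DegreeGE k ω}
  add_mem' h h' s hs := by rw [Pi.add_apply, h s hs, h' s hs, add_zero]
  zero_mem' _ _ := rfl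
  smul_mem' a ω h s hs := by rw [Pi.smul_apply, h s hs, smul_zero]

/-- The acyclicity of the forms in `z`, `s`, `t`, in terms of the components with respect to the
variable `s`. -/
lemma graph_acyclic (hϖ : ϖ ^ (p - 1) = -(p : ℂ_[p])) (hint : ∀ m, ‖P.coeff m‖ ≤ 1)
    (a b : Finset (Fin (n + 1)) → Overconvergent p (Fin (n + 2)))
    (ha : a ∈ degreeGESubmodule (p := p) (Overconvergent p (Fin (n + 2))) (n + 1) 3)
    (hb : b ∈ degreeGESubmodule (p := p) (Overconvergent p (Fin (n + 2))) (n + 1) 2)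
    (hda : (suspensionData ϖ P).dS a = 0)
    (hab : (suspensionData ϖ P).Ds a = (suspensionData ϖ P).dS b) :
    ∃ u v, (suspensionData ϖ P).dS u = a ∧
      (suspensionData ϖ P).Ds u - (suspensionData ϖ P).dS v = b := by
  have key : ∀ a b : Finset (Fin (n + 1)) → Overconvergent p (Fin (n + 2)),
      totalD (twistedPderiv (graphPotential ϖ P)) (formMk (sIdx n) a b) =
      formMk (sIdx n) ((suspensionData ϖ P).dS a)
        ((suspensionData ϖ P).Ds a - (suspensionData ϖ P).dS b) := fun a b => totalD_formMk _ _ a b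
  obtain ⟨η, hη⟩ := exactFrom_graphPotential hϖ P hint (formMk (sIdx n) a b)
    (DegreeGE.formMk ha hb) (by rw [key, hda, hab, sub_self, formMk_zero])
  rw [← formMk_res_con ℂ_[p] (sIdx n) η, key] at hη
  obtain ⟨h1, h2⟩ := formMk_inj _ hη
  exact ⟨_, _, h1, h2⟩

/-- Every closed form of degree `k + 2` is cohomologous to the suspension of a closed form of
degree `k`. -/
lemma exists_suspMap_of_closed (hϖ : ϖ ^ (p - 1) = -(p : ℂ_[p])) (hint : ∀ m, ‖P.coeff m‖ ≤ 1)
    {k : ℕ} (hk : 2 ≤ k) {η : Finset (Fin (n + 2 + 1)) → Overconvergent p (Fin (n + 2 + 1))}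
    (hη : degreePart (k + 2) η = η)
    (hdη : totalD (twistedPderiv (dworkPotential ϖ (addXY P))) η = 0) :
    ∃ ω θ, hypD ϖ P ω = 0 ∧ degreePart k ω = ω ∧ degreePart (k + 1) θ = θ ∧
      totalD (twistedPderiv (dworkPotential ϖ (addXY P))) θ = η - suspMap ϖ P ω := by
  have hdeg : DegreeGE (k + 2) η := hη ▸ degreeGE_degreePart _ _
  obtain ⟨a₀, a₁, b₀, b₁, rfl, ha₀, ha₁, hb₀, hb₁⟩ := exists_formQuad_eq hdeg
  obtain ⟨ω, u₀, u₁, v₀, v₁, hω, h⟩ := (suspensionData ϖ P).exists_phi_of_closed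
    (degreeGESubmodule _ _ 3) (degreeGESubmodule _ _ 2) (graph_acyclic ϖ P hϖ hint)
    ((closed_iff ϖ P).mpr hdη) ((ha₀.mono (by omega)).compLeft _)
    ((hb₀.mono (by omega)).compLeft _)
    ((((ha₁.mono (by omega)).compLeft _).sub ((hb₀.mono (by omega)).compLeft _)).compLeft _)
    ((hb₁.mono (by omega)).compLeft _)
  rw [isD_iff] at h
  refine ⟨degreePart k ω, degreePart (k + 1) (formQuad u₀ u₁ v₀ v₁), ?_, ?_, ?_, ?_⟩
  · have h1 := degreePart_totalD (R := ℂ_[p]) (twistedPderiv (dworkPotential ϖ P)) k ω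
    have h2 : totalD (twistedPderiv (dworkPotential ϖ P)) ω = 0 := hω
    rw [h2] at h1
    exact h1.trans (funext fun s => ite_self _)
  · exact degreePart_eq_self fun s hs => if_neg hs
  · exact degreePart_eq_self fun s hs => if_neg hs
  · have h3 : formQuad a₀ (a₁ - (suspensionData ϖ P).phiY ω) b₀
        (b₁ - (suspensionData ϖ P).phiXY ω) = formQuad a₀ a₁ b₀ b₁ - suspMap ϖ P ω := by
      rw [suspMap_apply, ← formQuad_sub, sub_zero, sub_zero]
    rw [degreePart_totalD, h, h3, degreePart_sub, hη, degreePart_suspMap]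

/-- A closed form of degree `k` is exact if its suspension is exact. -/
lemma exists_of_suspMap_exact (hϖ : ϖ ^ (p - 1) = -(p : ℂ_[p])) (hint : ∀ m, ‖P.coeff m‖ ≤ 1)
    {k : ℕ} (hk : 2 ≤ k) {ω : Finset (Fin (n + 1)) → Overconvergent p (Fin (n + 1))}
    (hω : degreePart (k + 1) ω = ω) (hdω : hypD ϖ P ω = 0)
    {θ : Finset (Fin (n + 2 + 1)) → Overconvergent p (Fin (n + 2 + 1))}
    (hθ : degreePart (k + 2) θ = θ)
    (h : totalD (twistedPderiv (dworkPotential ϖ (addXY P))) θ = suspMap ϖ P ω) :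
    ∃ η, degreePart k η = η ∧ hypD ϖ P η = ω := by
  have hdeg : DegreeGE (k + 2) θ := hθ ▸ degreeGE_degreePart _ _
  have hdegω : DegreeGE (k + 1) ω := hω ▸ degreeGE_degreePart _ _
  obtain ⟨u₀, u₁, v₀, v₁, rfl, hu₀, hu₁, hv₀, hv₁⟩ := exists_formQuad_eq hdeg
  obtain ⟨η, hη⟩ := (suspensionData ϖ P).exact_of_phi_exact
    (degreeGESubmodule _ _ 3) (degreeGESubmodule _ _ 2) (graph_acyclic ϖ P hϖ hint) hdω
    ((isD_iff ϖ P).mpr h) ((hdegω.mono (by omega)).compLeft _)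
    ((((hu₁.mono (by omega)).compLeft _).sub ((hv₀.mono (by omega)).compLeft _)).compLeft _)
    ((hv₁.mono (by omega)).compLeft _)
  refine ⟨degreePart k η, degreePart_eq_self fun s hs => if_neg hs, ?_⟩
  have h1 : hypD ϖ P η = ω := hη
  rw [← hω, ← h1]
  exact degreePart_totalD (R := ℂ_[p]) (twistedPderiv (dworkPotential ϖ P)) k η

end SuspensionMap

/-! ### Cohomology classes of closed forms -/

section Classes

universe u

variable {R : Type u} [CommRing R]

/-- The cohomology class of a cocycle. -/
def cocycleClass (K : CochainComplex (ModuleCat.{u} R) ℕ) (k : ℕ) :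
    LinearMap.ker (K.d k (k + 1)).hom →ₗ[R] K.homology k :=
  (K.liftCycles (A := ModuleCat.of R (LinearMap.ker (K.d k (k + 1)).hom))
    (ModuleCat.ofHom (LinearMap.ker (K.d k (k + 1)).hom).subtype) (k + 1) (by simp)
    (by ext x; exact x.2) ≫ K.homologyπ k).hom

lemma cocycleClass_surjective (K : CochainComplex (ModuleCat.{u} R) ℕ) (k : ℕ) :
    Function.Surjective (cocycleClass K k) := by
  intro c
  obtain ⟨z, rfl⟩ := (ModuleCat.epi_iff_surjective (K.homologyπ k)).mp inferInstance c
  have h1 : (K.d k (k + 1)).hom ((K.iCycles k).hom z) = 0 := by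
    rw [← LinearMap.comp_apply, ← ModuleCat.hom_comp, K.iCycles_d]
    rfl
  refine ⟨⟨(K.iCycles k).hom z, h1⟩, ?_⟩
  rw [cocycleClass, ModuleCat.hom_comp, LinearMap.comp_apply]
  congr 1
  refine (ModuleCat.mono_iff_injective (K.iCycles k)).mp inferInstance ?_
  change (K.iCycles k).hom _ = (K.iCycles k).hom z
  rw [← LinearMap.comp_apply, ← ModuleCat.hom_comp, K.liftCycles_i]
  rfl

lemma cocycleClass_eq_zero_iff (K : CochainComplex (ModuleCat.{u} R) ℕ) (k : ℕ)
    (x : LinearMap.ker (K.d (k + 1) (k + 1 + 1)).hom) :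
    cocycleClass K (k + 1) x = 0 ↔ ∃ y, (K.d k (k + 1)).hom y = x.1 := by
  have hex : (ShortComplex.mk _ _ (K.toCycles_comp_homologyπ k (k + 1))).Exact :=
    ShortComplex.exact_of_g_is_cokernel _ (K.homologyIsCokernel k (k + 1) (by simp))
  rw [ShortComplex.moduleCat_exact_iff] at hex
  have hi := (ModuleCat.mono_iff_injective (K.iCycles (k + 1))).mp inferInstance
  have hx : (K.iCycles (k + 1)).hom ((K.liftCycles
      (A := ModuleCat.of R (LinearMap.ker (K.d (k + 1) (k + 1 + 1)).hom))
      (ModuleCat.ofHom (LinearMap.ker (K.d (k + 1) (k + 1 + 1)).hom).subtype) (k + 1 + 1) (by simp)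
      (by ext x; exact x.2)).hom x) = x.1 := by
    rw [← LinearMap.comp_apply, ← ModuleCat.hom_comp, K.liftCycles_i]
    rfl
  have ht : ∀ y, (K.iCycles (k + 1)).hom ((K.toCycles k (k + 1)).hom y) =
      (K.d k (k + 1)).hom y := by
    intro y
    rw [← LinearMap.comp_apply, ← ModuleCat.hom_comp, K.toCycles_i]
  rw [cocycleClass, ModuleCat.hom_comp, LinearMap.comp_apply]
  constructor
  · intro h
    obtain ⟨y, hy⟩ := hex _ h
    refine ⟨y, ?_⟩
    rw [← ht, ← hx]
    exact congrArg _ hy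
  · rintro ⟨y, hy⟩
    rw [← ht, ← hx] at hy
    have h1 := hi hy
    rw [← h1, ← LinearMap.comp_apply, ← ModuleCat.hom_comp, K.toCycles_comp_homologyπ]
    rfl

lemma homologyMap_cocycleClass {K L : CochainComplex (ModuleCat.{u} R) ℕ} (φ : K ⟶ L) (k : ℕ)
    (x : LinearMap.ker (K.d k (k + 1)).hom) (y : LinearMap.ker (L.d k (k + 1)).hom)
    (hxy : (φ.f k).hom x.1 = y.1) :
    (HomologicalComplex.homologyMap φ k).hom (cocycleClass K k x) = cocycleClass L k y := by
  have hn : ∀ z, (HomologicalComplex.homologyMap φ k).hom ((K.homologyπ k).hom z) =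
      (L.homologyπ k).hom ((HomologicalComplex.cyclesMap φ k).hom z) := fun z => by
    rw [← LinearMap.comp_apply, ← ModuleCat.hom_comp, HomologicalComplex.homologyπ_naturality]
    rfl
  rw [cocycleClass, cocycleClass, ModuleCat.hom_comp, ModuleCat.hom_comp, LinearMap.comp_apply,
    LinearMap.comp_apply, hn]
  congr 1
  refine (ModuleCat.mono_iff_injective (L.iCycles k)).mp inferInstance ?_
  change (L.iCycles k).hom _ = (L.iCycles k).hom _
  rw [← LinearMap.comp_apply, ← ModuleCat.hom_comp, ← LinearMap.comp_apply, ← ModuleCat.hom_comp,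
    HomologicalComplex.cyclesMap_i, HomologicalComplex.liftCycles_i_assoc, ← LinearMap.comp_apply,
    ← ModuleCat.hom_comp, L.liftCycles_i]
  exact hxy

/-- An isomorphism of cohomology groups from a linear map of cochains that induces a bijection of
cohomology classes. -/
lemma exists_homologyEquiv {K L : CochainComplex (ModuleCat.{u} R) ℕ} {k l : ℕ}
    (F : LinearMap.ker (K.d (k + 1) (k + 1 + 1)).hom →ₗ[R]
      LinearMap.ker (L.d (l + 1) (l + 1 + 1)).hom)
    (hs : ∀ y : LinearMap.ker (L.d (l + 1) (l + 1 + 1)).hom,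
      ∃ x w, (L.d l (l + 1)).hom w = y.1 - (F x).1)
    (hi : ∀ x, (∃ w, (L.d l (l + 1)).hom w = (F x).1) ↔ ∃ w, (K.d k (k + 1)).hom w = x.1) :
    ∃ Φ : K.homology (k + 1) ≃ₗ[R] L.homology (l + 1),
      ∀ x, Φ (cocycleClass K (k + 1) x) = cocycleClass L (l + 1) (F x) := by
  have hsurj : Function.Surjective (cocycleClass L (l + 1) ∘ₗ F) := by
    intro c
    obtain ⟨y, rfl⟩ := cocycleClass_surjective L (l + 1) c
    obtain ⟨x, w, hw⟩ := hs y
    refine ⟨x, ?_⟩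
    have h := (cocycleClass_eq_zero_iff L l (y - F x)).mpr ⟨w, hw⟩
    rw [map_sub, sub_eq_zero] at h
    exact h.symm
  have hker : LinearMap.ker (cocycleClass K (k + 1)) =
      LinearMap.ker (cocycleClass L (l + 1) ∘ₗ F) := by
    ext x
    rw [LinearMap.mem_ker, LinearMap.mem_ker, LinearMap.comp_apply, cocycleClass_eq_zero_iff,
      cocycleClass_eq_zero_iff, hi]
  refine ⟨((cocycleClass K (k + 1)).quotKerEquivOfSurjective
    (cocycleClass_surjective K (k + 1))).symm ≪≫ₗ Submodule.quotEquivOfEq _ _ hker ≪≫ₗ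
      (cocycleClass L (l + 1) ∘ₗ F).quotKerEquivOfSurjective hsurj, fun x => ?_⟩
  have h1 : ((cocycleClass K (k + 1)).quotKerEquivOfSurjective
      (cocycleClass_surjective K (k + 1))).symm (cocycleClass K (k + 1) x) =
        Submodule.Quotient.mk x := by
    rw [LinearEquiv.symm_apply_eq]
    rfl
  rw [LinearEquiv.trans_apply, LinearEquiv.trans_apply, h1]
  rfl

end Classes

/-! ### Homogeneous forms -/

section Homogeneous

universe u

variable {R : Type u} [CommRing R] {M : Type u} [AddCommGroup M] [Module R M] {ι : Type}

/-- The component of degree `k` of a form. -/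
def drRes (k : ℕ) (ω : Finset ι → M) : DRForm ι M k := fun s => ω s.1

lemma drRes_drExt {k : ℕ} (ω : DRForm ι M k) : drRes k (drExt ω) = ω :=
  funext fun s => drExt_of_card ω s

lemma drExt_drRes (k : ℕ) (ω : Finset ι → M) : drExt (drRes k ω) = degreePart k ω := by
  ext s
  simp only [drExt, degreePart, drRes]
  split_ifs <;> rfl

lemma degreePart_drExt {k : ℕ} (ω : DRForm ι M k) : degreePart k (drExt ω) = drExt ω := by
  rw [← drExt_drRes, drRes_drExt]

lemma drExt_injective {k : ℕ} : Function.Injective (drExt : DRForm ι M k → Finset ι → M) := by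
  intro ω η h
  rw [← drRes_drExt ω, h, drRes_drExt]

variable [LinearOrder ι]

lemma totalD_drExt (D : ι → M →ₗ[R] M) {k : ℕ} (ω : DRForm ι M k) :
    totalD D (drExt ω) = drExt (drD D k ω) := by
  have h := degreePart_totalD D k (drExt ω)
  rw [degreePart_drExt] at h
  rw [h, ← drExt_drRes]
  congr 1
  ext s
  rw [drD_apply]
  exact totalD_apply D _ s.1

lemma drD_drRes (D : ι → M →ₗ[R] M) (k : ℕ) (ω : Finset ι → M) :
    drD D k (drRes k ω) = drRes (k + 1) (totalD D ω) := by
  refine drExt_injective ?_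
  rw [← totalD_drExt, drExt_drRes, drExt_drRes, degreePart_totalD]

end Homogeneous

/-! ### The Frobenius factor of `x y t` -/

section FrobFactor

variable {p : ℕ} [Fact p.Prime] {n : ℕ} {ι κ : Type}

lemma expand_rename (e : ι ↪ κ) {q : ℕ} (hq : q ≠ 0) (f : MvPowerSeries ι ℂ_[p]) :
    MvPowerSeries.expand q hq (MvPowerSeries.rename e f) =
      MvPowerSeries.rename e (MvPowerSeries.expand q hq f) := by
  have h1 : MvPowerSeries.HasSubst
      (fun i => MvPowerSeries.X (e i) : ι → MvPowerSeries κ ℂ_[p]) := MvPowerSeries.HasSubst.X_comp _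
  have h2 : MvPowerSeries.HasSubst
      (fun i => MvPowerSeries.X i ^ q : ι → MvPowerSeries ι ℂ_[p]) := MvPowerSeries.HasSubst.X_pow hq
  have h3 : MvPowerSeries.expand q hq f =
      MvPowerSeries.subst (fun i => MvPowerSeries.X i ^ q : ι → MvPowerSeries ι ℂ_[p]) f := by
    rw [MvPowerSeries.expand, MvPowerSeries.coe_substAlgHom]
  rw [h3, MvPowerSeries.rename_eq_subst, MvPowerSeries.rename_eq_subst]
  change MvPowerSeries.expand q hq (MvPowerSeries.subst (fun i => MvPowerSeries.X (e i)) f) =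
    MvPowerSeries.subst (fun i => MvPowerSeries.X (e i)) _
  rw [MvPowerSeries.expand_subst q hq h1, MvPowerSeries.subst_comp_subst_apply h2 h1]
  congr 1
  funext i
  rw [MvPowerSeries.expand_X, MvPowerSeries.subst_pow h1, MvPowerSeries.subst_X h1]

/-- The monomial `x y t`. -/
def xytPoly (n : ℕ) : MvPolynomial (Fin (n + 2 + 1)) ℂ_[p] :=
  MvPolynomial.X (xIdx n) * (MvPolynomial.X (yIdx n) * MvPolynomial.X (Fin.last (n + 2)))

/-- The power series `e^{ϖ (u ^ p - u)}` with `u = x y t`. -/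
def xytSeries (ϖ : ℂ_[p]) (n : ℕ) : MvPowerSeries (Fin (n + 2 + 1)) ℂ_[p] :=
  mvExp (frobExponent (MvPolynomial.C ϖ * xytPoly n))

lemma isOverconvergent_xytSeries {ϖ : ℂ_[p]} (hϖ : ϖ ^ (p - 1) = -(p : ℂ_[p])) (n : ℕ) :
    IsOverconvergent (xytSeries ϖ n) := by
  have hp : p.Prime := Fact.out
  have key : ∀ m, (xytPoly n : MvPolynomial _ ℂ_[p]).coeff m = 0 ∨
      (xytPoly n : MvPolynomial _ ℂ_[p]).coeff m = 1 := by
    classical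
    intro m
    simp only [xytPoly, MvPolynomial.X, MvPolynomial.monomial_mul, mul_one,
      MvPolynomial.coeff_monomial]
    split_ifs
    · exact Or.inr rfl
    · exact Or.inl rfl
  refine isOverconvergent_mvExp_frobExponent hϖ _ (by simp [xytPoly]) (fun m => ?_) fun m => ?_
  · rcases key m with h | h <;> rw [h] <;> simp
  · rcases key m with h | h <;> rw [h] <;> simp [hp.ne_zero]

lemma frobExponent_add (W W' : MvPolynomial ι ℂ_[p]) :
    frobExponent (W + W') = frobExponent W + frobExponent W' := by
  rw [frobExponent, frobExponent, frobExponent, map_add, add_sub_add_comm]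

lemma frobExponent_rename (e : ι → κ) (W : MvPolynomial ι ℂ_[p]) :
    frobExponent (MvPolynomial.rename e W) = MvPolynomial.rename e (frobExponent W) := by
  rw [frobExponent, frobExponent, map_sub, MvPolynomial.rename_expand]

lemma constantCoeff_frobExponent_xyt (ϖ : ℂ_[p]) (n : ℕ) :
    MvPolynomial.constantCoeff (frobExponent (MvPolynomial.C ϖ * xytPoly n)) = 0 := by
  simp [frobExponent, xytPoly, (Fact.out : p.Prime).ne_zero]

lemma frobSeries_addXY (ϖ : ℂ_[p]) (P : MvPolynomial (Fin n) ℂ_[p]) :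
    frobSeries ϖ (addXY P) =
      MvPowerSeries.rename (ztEmb n) (frobSeries ϖ P) * xytSeries ϖ n := by
  have h : dworkPotential ϖ (addXY P) = MvPolynomial.rename (ztEmb n) (dworkPotential ϖ P) +
      MvPolynomial.C ϖ * xytPoly n := dworkPotential_addXY ϖ P
  have h0 := constantCoeff_frobExponent ϖ P
  rw [frobSeries, frobSeries, h, frobExponent_add, frobExponent_rename, rename_mvExp _ h0,
    mvExp_add (by rw [MvPolynomial.constantCoeff_rename, h0]) (constantCoeff_frobExponent_xyt ϖ n)]
  rfl

lemma isOverconvergent_frobSeries_addXY {ϖ : ℂ_[p]} (hϖ : ϖ ^ (p - 1) = -(p : ℂ_[p]))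
    {P : MvPolynomial (Fin n) ℂ_[p]} (h : IsOverconvergent (frobSeries ϖ P)) :
    IsOverconvergent (frobSeries ϖ (addXY P)) := by
  rw [frobSeries_addXY]
  exact (h.rename _).mul (isOverconvergent_xytSeries hϖ n)

lemma pderiv_frobExponent_xyt (ϖ : ℂ_[p]) (i : Fin (n + 2 + 1)) :
    MvPolynomial.pderiv i (frobExponent (MvPolynomial.C ϖ * xytPoly n)) =
      MvPolynomial.C ϖ * (((p : MvPolynomial (Fin (n + 2 + 1)) ℂ_[p]) * xytPoly n ^ (p - 1) - 1) *
        MvPolynomial.pderiv i (xytPoly n)) := by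
  have h : frobExponent (MvPolynomial.C ϖ * xytPoly n) =
      MvPolynomial.C ϖ * (xytPoly n ^ p - xytPoly n) := by
    simp only [frobExponent, xytPoly, map_mul, MvPolynomial.expand_X, MvPolynomial.expand_C]
    ring
  rw [h, MvPolynomial.pderiv_C_mul, map_sub, MvPolynomial.pderiv_pow]
  ring

lemma pderiv_xytSeries (ϖ : ℂ_[p]) (i : Fin (n + 2 + 1)) :
    MvPowerSeries.pderiv ℂ_[p] i (xytSeries ϖ n) = MvPowerSeries.C ϖ *
      (((p : MvPowerSeries (Fin (n + 2 + 1)) ℂ_[p]) *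
        ((xytPoly n : MvPolynomial (Fin (n + 2 + 1)) ℂ_[p]) :
          MvPowerSeries (Fin (n + 2 + 1)) ℂ_[p]) ^ (p - 1) - 1) *
      ((MvPolynomial.pderiv i (xytPoly n) : MvPolynomial (Fin (n + 2 + 1)) ℂ_[p]) :
        MvPowerSeries (Fin (n + 2 + 1)) ℂ_[p])) * xytSeries ϖ n := by
  have h1 := pderiv_mvExp _ (constantCoeff_frobExponent_xyt ϖ n) i
  have h2 : (((p : MvPolynomial (Fin (n + 2 + 1)) ℂ_[p]) * xytPoly n ^ (p - 1) - 1 :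
      MvPolynomial (Fin (n + 2 + 1)) ℂ_[p]) : MvPowerSeries (Fin (n + 2 + 1)) ℂ_[p]) =
      (p : MvPowerSeries (Fin (n + 2 + 1)) ℂ_[p]) *
        ((xytPoly n : MvPolynomial (Fin (n + 2 + 1)) ℂ_[p]) :
          MvPowerSeries (Fin (n + 2 + 1)) ℂ_[p]) ^ (p - 1) - 1 := by
    refine (map_sub (MvPolynomial.coeToMvPowerSeries.ringHom
      (R := ℂ_[p]) (σ := Fin (n + 2 + 1))) _ _).trans ?_
    rw [map_mul, map_pow, map_natCast, map_one]
    rfl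
  rw [pderiv_frobExponent_xyt, MvPolynomial.coe_mul, MvPolynomial.coe_C, MvPolynomial.coe_mul,
    h2] at h1
  exact h1

lemma pderiv_xytPoly_x : MvPolynomial.pderiv (xIdx n) (xytPoly n : MvPolynomial _ ℂ_[p]) =
    MvPolynomial.X (yIdx n) * MvPolynomial.X (Fin.last (n + 2)) := by
  rw [xytPoly, MvPolynomial.pderiv_mul, MvPolynomial.pderiv_mul, MvPolynomial.pderiv_X_self,
    MvPolynomial.pderiv_X_of_ne yIdx_ne_xIdx, MvPolynomial.pderiv_X_of_ne last_ne_xIdx]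
  ring

lemma pderiv_xytPoly_t : MvPolynomial.pderiv (Fin.last (n + 2)) (xytPoly n : MvPolynomial _ ℂ_[p]) =
    MvPolynomial.X (xIdx n) * MvPolynomial.X (yIdx n) := by
  rw [xytPoly, MvPolynomial.pderiv_mul, MvPolynomial.pderiv_mul, MvPolynomial.pderiv_X_self,
    MvPolynomial.pderiv_X_of_ne last_ne_xIdx.symm, MvPolynomial.pderiv_X_of_ne last_ne_yIdx.symm]
  ring

lemma pderiv_xytPoly_z {i : Fin (n + 1)} (hi : i ≠ Fin.last n) :
    MvPolynomial.pderiv (ztEmb n i) (xytPoly n : MvPolynomial _ ℂ_[p]) = 0 := by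
  have h : Fin.last (n + 2) ≠ ztEmb n i := by
    rw [← ztEmb_last]
    exact fun h => hi ((ztEmb n).injective h).symm
  rw [xytPoly, MvPolynomial.pderiv_mul, MvPolynomial.pderiv_mul,
    MvPolynomial.pderiv_X_of_ne h, MvPolynomial.pderiv_X_of_ne (ztEmb_ne_xIdx i).symm,
    MvPolynomial.pderiv_X_of_ne (ztEmb_ne_yIdx i).symm]
  ring

lemma killCompl_X_mul {m : ℕ} (i : Fin (m + 1)) (f : MvPowerSeries (Fin (m + 1)) ℂ_[p]) :
    MvPowerSeries.killCompl i.succAboveEmb (MvPowerSeries.X i * f) = 0 := by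
  ext I
  rw [MvPowerSeries.coeff_killCompl, coeff_X_mul_eq, if_pos, map_zero]
  refine Finsupp.embDomain_of_notMem_range _ _ _ ?_
  rintro ⟨k, hk⟩
  exact Fin.succAbove_ne i k hk

/-- The series `e^{ϖ (u ^ p - u)}` takes the value `1` at `y = 0`. -/
lemma killCompl_xytSeries (ϖ : ℂ_[p]) (n : ℕ) :
    MvPowerSeries.killCompl (yIdx n).succAboveEmb (xytSeries ϖ n) = 1 := by
  have h0 : MvPolynomial.constantCoeff (0 : MvPolynomial (Fin (n + 2)) ℂ_[p]) = 0 := map_zero _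
  have h1 : MvPowerSeries.killCompl (yIdx n).succAboveEmb (xytSeries ϖ n) = mvExp 0 := by
    refine eq_mvExp h0 ?_ fun i => ?_
    · rw [← MvPowerSeries.coeff_zero_eq_constantCoeff_apply, MvPowerSeries.coeff_killCompl,
        Finsupp.embDomain_zero, MvPowerSeries.coeff_zero_eq_constantCoeff_apply, xytSeries,
        constantCoeff_mvExp _ (constantCoeff_frobExponent_xyt ϖ n)]
    · have h2 : MvPolynomial.pderiv ((yIdx n).succAboveEmb i) (xytPoly n : MvPolynomial _ ℂ_[p]) =
          MvPolynomial.X (yIdx n) * MvPolynomial.pderiv ((yIdx n).succAboveEmb i)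
            (MvPolynomial.X (xIdx n) * MvPolynomial.X (Fin.last (n + 2))) := by
        have hne : yIdx n ≠ (yIdx n).succAboveEmb i := (Fin.succAbove_ne _ _).symm
        rw [xytPoly, mul_left_comm, MvPolynomial.pderiv_mul, MvPolynomial.pderiv_X_of_ne hne,
          zero_mul, zero_add]
      rw [← killCompl_pderiv, pderiv_xytSeries, h2, map_zero, MvPolynomial.coe_zero, zero_mul,
        MvPolynomial.coe_mul, MvPolynomial.coe_X, mul_left_comm _ (MvPowerSeries.X (yIdx n)),
        mul_left_comm _ (MvPowerSeries.X (yIdx n)), mul_assoc, killCompl_X_mul]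
  rw [h1]
  refine (eq_mvExp h0 (map_one _) fun i => ?_).symm
  rw [MvPowerSeries.pderiv_one, map_zero, MvPolynomial.coe_zero, zero_mul]

/-- The power series `f` with `y f = (p / ϖ) (e^{ϖ (u ^ p - u)} - 1)`. -/
def xytQuot (ϖ : ℂ_[p]) (n : ℕ) : MvPowerSeries (Fin (n + 2 + 1)) ℂ_[p] :=
  (ϖ⁻¹ * p) • shiftX (yIdx n) (xytSeries ϖ n)

lemma X_mul_xytQuot (ϖ : ℂ_[p]) (n : ℕ) :
    MvPowerSeries.X (yIdx n) * xytQuot ϖ n =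
      MvPowerSeries.C (ϖ⁻¹ * p) * (xytSeries ϖ n - 1) := by
  have h := rename_killCompl_add_X_mul_shiftX (yIdx n) (xytSeries ϖ n)
  rw [killCompl_xytSeries, map_one] at h
  rw [xytQuot, mul_smul_comm, MvPowerSeries.smul_eq_C_mul, ← eq_sub_iff_add_eq'.mpr h]

/-- The power series `p² u ^ (p - 1) e^{ϖ (u ^ p - u)} - p` with `u = x y t`. -/
def xytDefect (ϖ : ℂ_[p]) (n : ℕ) : MvPowerSeries (Fin (n + 2 + 1)) ℂ_[p] :=
  (p : MvPowerSeries (Fin (n + 2 + 1)) ℂ_[p]) ^ 2 *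
    ((xytPoly n : MvPolynomial (Fin (n + 2 + 1)) ℂ_[p]) :
      MvPowerSeries (Fin (n + 2 + 1)) ℂ_[p]) ^ (p - 1) * xytSeries ϖ n - p

lemma C_mul_C_inv_mul {ϖ : ℂ_[p]} (hϖ : ϖ ≠ 0) :
    (MvPowerSeries.C ϖ * MvPowerSeries.C (ϖ⁻¹ * p) : MvPowerSeries ι ℂ_[p]) = p := by
  rw [← map_mul, ← mul_assoc, mul_inv_cancel₀ hϖ, one_mul, map_natCast]

lemma pderiv_x_xytQuot {ϖ : ℂ_[p]} (hϖ : ϖ ≠ 0) (n : ℕ) :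
    MvPowerSeries.pderiv ℂ_[p] (xIdx n) (xytQuot ϖ n) + MvPowerSeries.C ϖ *
      (MvPowerSeries.X (yIdx n) * (MvPowerSeries.X (Fin.last (n + 2)) * xytQuot ϖ n)) =
      MvPowerSeries.X (Fin.last (n + 2)) * xytDefect ϖ n := by
  refine X_mul_injective (yIdx n) ?_
  have h1 := congrArg (MvPowerSeries.pderiv ℂ_[p] (xIdx n)) (X_mul_xytQuot ϖ n)
  have h2 := X_mul_xytQuot ϖ n
  have h3 := C_mul_C_inv_mul (ι := Fin (n + 2 + 1)) hϖ
  have h4 : MvPowerSeries.pderiv ℂ_[p] (xIdx n) (MvPowerSeries.C (ϖ⁻¹ * p)) = 0 :=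
    MvPowerSeries.pderiv_C
  rw [Derivation.leibniz, MvPowerSeries.pderiv_X_of_ne yIdx_ne_xIdx, Derivation.leibniz, map_sub,
    h4, MvPowerSeries.pderiv_one, pderiv_xytSeries, pderiv_xytPoly_x, MvPolynomial.coe_mul,
    MvPolynomial.coe_X, MvPolynomial.coe_X, smul_eq_mul, smul_eq_mul, smul_eq_mul,
    smul_eq_mul, mul_zero, mul_zero, add_zero, add_zero, sub_zero] at h1
  simp only [xytDefect]
  linear_combination h1 + MvPowerSeries.C ϖ * MvPowerSeries.X (yIdx n) *
    MvPowerSeries.X (Fin.last (n + 2)) * h2 + MvPowerSeries.X (yIdx n) *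
    MvPowerSeries.X (Fin.last (n + 2)) * ((p : MvPowerSeries (Fin (n + 2 + 1)) ℂ_[p]) *
    ((xytPoly n : MvPolynomial (Fin (n + 2 + 1)) ℂ_[p]) :
      MvPowerSeries (Fin (n + 2 + 1)) ℂ_[p]) ^ (p - 1) * xytSeries ϖ n - 1) * h3

lemma pderiv_t_xytQuot {ϖ : ℂ_[p]} (hϖ : ϖ ≠ 0) (n : ℕ) :
    MvPowerSeries.pderiv ℂ_[p] (Fin.last (n + 2)) (xytQuot ϖ n) + MvPowerSeries.C ϖ *
      (MvPowerSeries.X (xIdx n) * (MvPowerSeries.X (yIdx n) * xytQuot ϖ n)) =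
      MvPowerSeries.X (xIdx n) * xytDefect ϖ n := by
  refine X_mul_injective (yIdx n) ?_
  have h1 := congrArg (MvPowerSeries.pderiv ℂ_[p] (Fin.last (n + 2))) (X_mul_xytQuot ϖ n)
  have h2 := X_mul_xytQuot ϖ n
  have h3 := C_mul_C_inv_mul (ι := Fin (n + 2 + 1)) hϖ
  have h4 : MvPowerSeries.pderiv ℂ_[p] (Fin.last (n + 2)) (MvPowerSeries.C (ϖ⁻¹ * p)) = 0 :=
    MvPowerSeries.pderiv_C
  rw [Derivation.leibniz, MvPowerSeries.pderiv_X_of_ne last_ne_yIdx.symm, Derivation.leibniz,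
    map_sub, h4, MvPowerSeries.pderiv_one, pderiv_xytSeries, pderiv_xytPoly_t, MvPolynomial.coe_mul,
    MvPolynomial.coe_X, MvPolynomial.coe_X, smul_eq_mul, smul_eq_mul, smul_eq_mul,
    smul_eq_mul, mul_zero, mul_zero, add_zero, add_zero, sub_zero] at h1
  simp only [xytDefect]
  linear_combination h1 + MvPowerSeries.C ϖ * MvPowerSeries.X (xIdx n) *
    MvPowerSeries.X (yIdx n) * h2 + MvPowerSeries.X (xIdx n) *
    MvPowerSeries.X (yIdx n) * ((p : MvPowerSeries (Fin (n + 2 + 1)) ℂ_[p]) *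
    ((xytPoly n : MvPolynomial (Fin (n + 2 + 1)) ℂ_[p]) :
      MvPowerSeries (Fin (n + 2 + 1)) ℂ_[p]) ^ (p - 1) * xytSeries ϖ n - 1) * h3

lemma pderiv_z_xytQuot (ϖ : ℂ_[p]) {i : Fin (n + 1)} (hi : i ≠ Fin.last n) :
    MvPowerSeries.pderiv ℂ_[p] (ztEmb n i) (xytQuot ϖ n) = 0 := by
  rw [xytQuot, Derivation.map_smul, ← shiftX_pderiv_of_ne (ztEmb_ne_yIdx i), pderiv_xytSeries,
    pderiv_xytPoly_z hi, MvPolynomial.coe_zero, mul_zero, mul_zero, zero_mul, map_zero, smul_zero]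

end FrobFactor

/-! ### Pullback of inhomogeneous forms -/

section TotalPull

universe u

variable {R : Type u} [CommRing R] {A : Type u} [CommRing A] [Algebra R A] {ι : Type}

/-- The map of inhomogeneous forms given by `g ↦ F g` on coefficients and `dz i ↦ c i dz i`. -/
def totalPull (F : A →ₗ[R] A) (c : ι → A) (ω : Finset ι → A) : Finset ι → A :=
  fun s => (∏ i ∈ s, c i) * F (ω s)

lemma drExt_drPull [LinearOrder ι] (F : A →ₗ[R] A) (c : ι → A) {k : ℕ} (ω : DRForm ι A k) :
    drExt (drPull F c k ω) = totalPull F c (drExt ω) := by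
  ext s
  rw [totalPull, drExt, drExt]
  split_ifs
  · rfl
  · rw [map_zero, mul_zero]

lemma totalPull_extMul [LinearOrder ι] (F : A →ₗ[R] A) (c : ι → A) (i : ι) (ω : Finset ι → A)
    (s : Finset ι) : totalPull F c (extMul (R := R) i ω) s =
      c i * extMul (R := R) i (totalPull F c ω) s := by
  rw [totalPull, extMul_apply, extMul_apply]
  split_ifs with hi
  · rw [map_zsmul, totalPull, mul_smul_comm, mul_smul_comm, ← mul_assoc (c i),
      Finset.mul_prod_erase _ _ hi]
  · rw [map_zero, mul_zero, mul_zero]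

lemma totalPull_formMk {m : ℕ} (F : A →ₗ[R] A) (c : Fin (m + 1) → A) (i : Fin (m + 1))
    (a b : Finset (Fin m) → A) :
    totalPull F c (formMk i a b) =
      formMk i (totalPull F (fun j => c (i.succAboveEmb j)) a)
        (fun s => c i * totalPull F (fun j => c (i.succAboveEmb j)) b s) := by
  ext s
  have h : ∏ j ∈ pivotPreimage i s, c (i.succAboveEmb j) = ∏ j ∈ s.erase i, c j := by
    rw [← map_pivotPreimage, Finset.prod_map]
  rw [totalPull, formMk, formMk]
  split_ifs with hi
  · rw [totalPull, h, map_zsmul, mul_smul_comm, ← mul_assoc, Finset.mul_prod_erase _ _ hi]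
  · rw [totalPull, h, Finset.erase_eq_of_notMem hi]

lemma totalPull_formQuad {n : ℕ} (F : A →ₗ[R] A) (c : Fin (n + 2 + 1) → A)
    (a₁ b₁ : Finset (Fin (n + 1)) → A) :
    totalPull F c (formQuad 0 a₁ 0 b₁) =
      formQuad 0 (fun s => c (yIdx n) * totalPull F (fun j => c (ztEmb n j)) a₁ s) 0
        (fun s => c (xIdx n) * (c (yIdx n) * totalPull F (fun j => c (ztEmb n j)) b₁ s)) := by
  have h0 : totalPull F (fun j => c (ztEmb n j)) 0 = 0 := by
    ext s
    rw [totalPull, Pi.zero_apply, map_zero, mul_zero]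
  have hy : c ((xIdx n).succAboveEmb (sIdx n)) = c (yIdx n) := congrArg c xIdx_succAbove_sIdx
  rw [formQuad, totalPull_formMk, totalPull_formMk, totalPull_formMk, formQuad, hy]
  change formMk _ (formMk _ (totalPull F (fun j => c (ztEmb n j)) 0) _)
    (fun s => c (xIdx n) * formMk _ (totalPull F (fun j => c (ztEmb n j)) 0) _ s) = _
  rw [h0]
  congr 1
  ext s
  simp only [formMk]
  split_ifs
  · rw [mul_smul_comm]
    rfl
  · exact mul_zero _

end TotalPull

/-! ### The Frobenius of the suspension -/

section FrobeniusElements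

variable {p : ℕ} [Fact p.Prime] {n : ℕ} {ι κ : Type} {ϖ : ℂ_[p]}

lemma diagSub_rename {m : ℕ} (ξ : Fin (m + 2)) (σ : Fin (m + 1)) (f : MvPowerSeries (Fin m) ℂ_[p]) :
    diagSub ξ σ (MvPowerSeries.rename σ.succAboveEmb f) =
      MvPowerSeries.rename (σ.succAboveEmb.trans ξ.succAboveEmb) f := by
  have hnot : ∀ J : Fin (m + 2) →₀ ℕ, J ξ ≠ 0 ∨ J (ξ.succAbove σ) ≠ 0 →
      MvPowerSeries.coeff J (MvPowerSeries.rename (σ.succAboveEmb.trans ξ.succAboveEmb) f) = 0 := by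
    intro J hJ
    refine MvPowerSeries.coeff_rename_eq_zero _ _ ?_
    rintro ⟨I, rfl⟩
    rcases hJ with hJ | hJ <;> refine hJ (Finsupp.mapDomain_of_notMem_range _ _ ?_)
    · rintro ⟨k, hk⟩
      exact Fin.succAbove_ne _ _ hk
    · rintro ⟨k, hk⟩
      exact Fin.succAbove_ne _ _ (Fin.succAbove_right_injective hk)
  refine diagSub_eq_of_diagPart ξ σ ?_ fun J hJ => hnot J (by omega)
  ext I
  rw [coeff_diagPart]
  by_cases hI : I σ = 0
  · obtain ⟨I', rfl⟩ : ∃ I', Finsupp.embDomain σ.succAboveEmb I' = I := by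
      refine ⟨dropExp σ I, ?_⟩
      have h := diagExp_apply_self (m := m) σ
      ext k
      rcases eq_or_ne k σ with rfl | hk
      · rw [hI, Finsupp.embDomain_of_notMem_range]
        rintro ⟨l, hl⟩
        exact Fin.succAbove_ne _ _ hl
      · obtain ⟨l, rfl⟩ := Fin.exists_succAbove_eq hk
        exact Finsupp.embDomain_apply_self _ _ _
    have h : diagExp ξ σ (Finsupp.embDomain σ.succAboveEmb I') =
        Finsupp.embDomain (σ.succAboveEmb.trans ξ.succAboveEmb) I' := by
      rw [diagExp, hI, Finsupp.single_zero, add_zero, Finsupp.embDomain_trans_apply]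
    rw [h, MvPowerSeries.coeff_embDomain_rename, MvPowerSeries.coeff_embDomain_rename]
  · rw [hnot _ (Or.inl (by rwa [diagExp_apply_self])), MvPowerSeries.coeff_rename_eq_zero]
    rintro ⟨I, rfl⟩
    refine hI (Finsupp.mapDomain_of_notMem_range _ _ ?_)
    rintro ⟨l, hl⟩
    exact Fin.succAbove_ne _ _ hl

lemma ocDiag_ocRename (f : Overconvergent p (Fin (n + 1))) :
    ocDiag n (ocRename (sIdx n).succAboveEmb f) = ocRename (ztEmb n) f :=
  Subtype.ext (diagSub_rename _ _ _)

lemma ocRename_mul (e : ι ↪ κ) (f g : Overconvergent p ι) :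
    ocRename e (f * g) = ocRename e f * ocRename e g :=
  Subtype.ext (map_mul (MvPowerSeries.rename e) f.1 g.1)

lemma ocRename_ocPoly (e : ι ↪ κ) (Q : MvPolynomial ι ℂ_[p]) :
    ocRename e (ocPoly Q) = ocPoly (MvPolynomial.rename e Q) :=
  Subtype.ext (MvPowerSeries.rename_coe e Q)

lemma ocRename_ocX (e : ι ↪ κ) (i : ι) (f : Overconvergent p ι) :
    ocRename e (ocX i f) = ocX (e i) (ocRename e f) := by
  rw [ocX_apply, ocX_apply, ocRename_mul, ocRename_ocPoly, MvPolynomial.rename_X]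

lemma ocRename_prod (e : ι ↪ κ) (c : ι → Overconvergent p ι) (s : Finset ι) :
    ocRename e (∏ i ∈ s, c i) = ∏ i ∈ s, ocRename e (c i) := by
  classical
  induction s using Finset.induction_on with
  | empty => exact Subtype.ext (map_one (MvPowerSeries.rename e))
  | insert i s hi ih => rw [Finset.prod_insert hi, Finset.prod_insert hi, ocRename_mul, ih]

lemma rename_frobFactor (e : ι ↪ κ) (i : ι) :
    MvPolynomial.rename e (frobFactor i : MvPolynomial ι ℂ_[p]) = frobFactor (e i) := by
  rw [frobFactor, frobFactor, map_mul, map_pow, MvPolynomial.rename_X, map_natCast]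

lemma twistedPderiv_mul (W : MvPolynomial ι ℂ_[p]) (i : ι) (f g : Overconvergent p ι) :
    twistedPderiv W i (f * g) = ocPderiv i f * g + f * twistedPderiv W i g := by
  refine Subtype.ext ?_
  change MvPowerSeries.pderiv ℂ_[p] i (f.1 * g.1) +
      (ocPoly (MvPolynomial.pderiv i W)).1 * (f.1 * g.1) =
    MvPowerSeries.pderiv ℂ_[p] i f.1 * g.1 + f.1 * (MvPowerSeries.pderiv ℂ_[p] i g.1 +
      (ocPoly (MvPolynomial.pderiv i W)).1 * g.1)
  rw [Derivation.leibniz, smul_eq_mul, smul_eq_mul]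
  ring

lemma ocExpand_mul (f g : Overconvergent p ι) : ocExpand (f * g) = ocExpand f * ocExpand g :=
  Subtype.ext (map_mul (MvPowerSeries.expand p (Fact.out : p.Prime).ne_zero) f.1 g.1)

lemma ocExpand_X (i : ι) : ocExpand (ocPoly (MvPolynomial.X i) : Overconvergent p ι) =
    ocPoly (MvPolynomial.X i) ^ p := by
  refine Subtype.ext ?_
  change MvPowerSeries.expand p _ ((MvPolynomial.X i : MvPolynomial ι ℂ_[p]) :
    MvPowerSeries ι ℂ_[p]) = ((MvPolynomial.X i : MvPolynomial ι ℂ_[p]) : MvPowerSeries ι ℂ_[p]) ^ p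
  rw [MvPolynomial.coe_X, MvPowerSeries.expand_X]

lemma frobFun_X_mul (P : MvPolynomial (Fin n) ℂ_[p]) (h : IsOverconvergent (frobSeries ϖ P))
    (i : Fin (n + 1)) (g : Overconvergent p (Fin (n + 1))) :
    frobFun ϖ P h (ocPoly (MvPolynomial.X i) * g) =
      ocPoly (MvPolynomial.X i) ^ p * frobFun ϖ P h g := by
  change _ * ocExpand (_ * g) = _ * (_ * ocExpand g)
  rw [ocExpand_mul, ocExpand_X, mul_left_comm]

/-- The element `e^{ϖ (u ^ p - u)}`, `u = x y t`, of the ring of overconvergent power series. -/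
def ocXytSeries (hϖ : ϖ ^ (p - 1) = -(p : ℂ_[p])) (n : ℕ) : Overconvergent p (Fin (n + 2 + 1)) :=
  ⟨xytSeries ϖ n, isOverconvergent_xytSeries hϖ n⟩

/-- The element `f` with `y f = (p / ϖ) (e^{ϖ (u ^ p - u)} - 1)`, `u = x y t`, of the ring of
overconvergent power series. -/
def ocXytQuot (hϖ : ϖ ^ (p - 1) = -(p : ℂ_[p])) (n : ℕ) : Overconvergent p (Fin (n + 2 + 1)) :=
  (ϖ⁻¹ * p) • ocShift (yIdx n) (ocXytSeries hϖ n)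

/-- The element `p² u ^ (p - 1) e^{ϖ (u ^ p - u)} - p`, `u = x y t`, of the ring of overconvergent
power series. -/
def ocXytDefect (hϖ : ϖ ^ (p - 1) = -(p : ℂ_[p])) (n : ℕ) : Overconvergent p (Fin (n + 2 + 1)) :=
  (p : Overconvergent p (Fin (n + 2 + 1))) ^ 2 * ocPoly (xytPoly n) ^ (p - 1) * ocXytSeries hϖ n -
    (p : Overconvergent p (Fin (n + 2 + 1)))

lemma coe_ocXytDefect (hϖ : ϖ ^ (p - 1) = -(p : ℂ_[p])) (n : ℕ) :
    (ocXytDefect hϖ n : MvPowerSeries (Fin (n + 2 + 1)) ℂ_[p]) = xytDefect ϖ n := by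
  have h : ((p : Overconvergent p (Fin (n + 2 + 1))) : MvPowerSeries (Fin (n + 2 + 1)) ℂ_[p]) = p :=
    map_natCast (Overconvergent p (Fin (n + 2 + 1))).subtype p
  rw [xytDefect, ← h]
  rfl

lemma frobFun_ocRename (hϖ : ϖ ^ (p - 1) = -(p : ℂ_[p])) (P : MvPolynomial (Fin n) ℂ_[p])
    (h : IsOverconvergent (frobSeries ϖ P)) (h' : IsOverconvergent (frobSeries ϖ (addXY P)))
    (g : Overconvergent p (Fin (n + 1))) :
    frobFun ϖ (addXY P) h' (ocRename (ztEmb n) g) =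
      ocXytSeries hϖ n * ocRename (ztEmb n) (frobFun ϖ P h g) := by
  refine Subtype.ext ?_
  change frobSeries ϖ (addXY P) * MvPowerSeries.expand p _ (MvPowerSeries.rename (ztEmb n) g.1) =
    xytSeries ϖ n * MvPowerSeries.rename (ztEmb n) (frobSeries ϖ P * MvPowerSeries.expand p _ g.1)
  rw [frobSeries_addXY, expand_rename, map_mul]
  ring

lemma twistedPderiv_xIdx_ocXytQuot_mul (hϖ : ϖ ^ (p - 1) = -(p : ℂ_[p]))
    (P : MvPolynomial (Fin n) ℂ_[p]) (g : Overconvergent p (Fin (n + 1))) :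
    twistedPderiv (dworkPotential ϖ (addXY P)) (xIdx n)
        (ocXytQuot hϖ n * ocRename (ztEmb n) g) =
      ocPoly (MvPolynomial.X (Fin.last (n + 2))) * ocXytDefect hϖ n * ocRename (ztEmb n) g := by
  have h := pderiv_x_xytQuot (root_ne_zero hϖ) n
  have h0 : MvPowerSeries.pderiv ℂ_[p] (xIdx n) (MvPowerSeries.rename (ztEmb n) g.1) = 0 := by
    refine pderiv_rename_of_notMem _ _ ?_ _
    rintro ⟨i, hi⟩
    exact ztEmb_ne_xIdx i hi
  rw [twistedPderiv_xIdx]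
  refine Subtype.ext ?_
  rw [Subalgebra.coe_mul, Subalgebra.coe_mul, coe_ocXytDefect]
  change MvPowerSeries.pderiv ℂ_[p] (xIdx n) (xytQuot ϖ n * MvPowerSeries.rename (ztEmb n) g.1) +
    ϖ • (((MvPolynomial.X (yIdx n) : MvPolynomial (Fin (n + 2 + 1)) ℂ_[p]) :
      MvPowerSeries (Fin (n + 2 + 1)) ℂ_[p]) *
      (((MvPolynomial.X (Fin.last (n + 2)) : MvPolynomial (Fin (n + 2 + 1)) ℂ_[p]) :
      MvPowerSeries (Fin (n + 2 + 1)) ℂ_[p]) *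
        (xytQuot ϖ n * MvPowerSeries.rename (ztEmb n) g.1))) =
    ((MvPolynomial.X (Fin.last (n + 2)) : MvPolynomial (Fin (n + 2 + 1)) ℂ_[p]) :
      MvPowerSeries (Fin (n + 2 + 1)) ℂ_[p]) * xytDefect ϖ n * MvPowerSeries.rename (ztEmb n) g.1
  rw [Derivation.leibniz, h0, smul_zero, zero_add, smul_eq_mul, MvPowerSeries.smul_eq_C_mul,
    MvPolynomial.coe_X, MvPolynomial.coe_X, ← h]
  ring

lemma twistedPderiv_ztEmb_ocXytQuot_mul (hϖ : ϖ ^ (p - 1) = -(p : ℂ_[p]))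
    (P : MvPolynomial (Fin n) ℂ_[p]) (i : Fin (n + 1)) (g : Overconvergent p (Fin (n + 1))) :
    twistedPderiv (dworkPotential ϖ (addXY P)) (ztEmb n i)
        (ocXytQuot hϖ n * ocRename (ztEmb n) g) =
      ocXytQuot hϖ n * ocRename (ztEmb n) (twistedPderiv (dworkPotential ϖ P) i g) +
        if i = Fin.last n then
          ocPoly (MvPolynomial.X (xIdx n)) * ocXytDefect hϖ n * ocRename (ztEmb n) g else 0 := by
  have h1 : twistedPderiv (MvPolynomial.rename (ztEmb n) (dworkPotential ϖ P)) (ztEmb n i)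
      (ocRename (ztEmb n) g) = ocRename (ztEmb n) (twistedPderiv (dworkPotential ϖ P) i g) :=
    twistedPderiv_ocRename _ (MvPolynomial.pderiv_rename (ztEmb n).injective _ _) _
  rw [twistedPderiv_addXY, twistedPderiv_mul, h1,
    add_comm (ocPderiv (ztEmb n i) (ocXytQuot hϖ n) * ocRename (ztEmb n) g)]
  refine (add_assoc _ _ _).trans (congrArg _ ?_)
  split_ifs with hi
  · have h := pderiv_t_xytQuot (root_ne_zero hϖ) n
    rw [hi, ztEmb_last]
    refine Subtype.ext ?_
    rw [Subalgebra.coe_mul _ (ocPoly _ * _), Subalgebra.coe_mul, coe_ocXytDefect]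
    change MvPowerSeries.pderiv ℂ_[p] (Fin.last (n + 2)) (xytQuot ϖ n) *
        MvPowerSeries.rename (ztEmb n) g.1 +
      ϖ • (((MvPolynomial.X (xIdx n) : MvPolynomial (Fin (n + 2 + 1)) ℂ_[p]) :
        MvPowerSeries (Fin (n + 2 + 1)) ℂ_[p]) *
        (((MvPolynomial.X (yIdx n) : MvPolynomial (Fin (n + 2 + 1)) ℂ_[p]) :
        MvPowerSeries (Fin (n + 2 + 1)) ℂ_[p]) *
          (xytQuot ϖ n * MvPowerSeries.rename (ztEmb n) g.1))) =
      ((MvPolynomial.X (xIdx n) : MvPolynomial (Fin (n + 2 + 1)) ℂ_[p]) :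
        MvPowerSeries (Fin (n + 2 + 1)) ℂ_[p]) * xytDefect ϖ n * MvPowerSeries.rename (ztEmb n) g.1
    rw [MvPowerSeries.smul_eq_C_mul, MvPolynomial.coe_X, MvPolynomial.coe_X, ← h]
    ring
  · have h : ocPderiv (ztEmb n i) (ocXytQuot hϖ n) = 0 := Subtype.ext (pderiv_z_xytQuot ϖ hi)
    rw [h, zero_mul, add_zero]

end FrobeniusElements

section FrobeniusHomotopy

variable {p : ℕ} [Fact p.Prime] {n : ℕ} {ϖ : ℂ_[p]}

/-- The comparison of the coefficients of `dy` in `totalD_formQuad_ocXytQuot`, with `k = p - 1`,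
`q = p` and `Θ = e^{ϖ (u ^ p - u)}`. -/
lemma frobenius_identity_y {A : Type*} [CommRing A] (k : ℕ) (x y t Θ q w : A) :
    -(x * (q ^ 2 * (x ^ k * (y ^ k * t ^ k)) * Θ - q) * w) =
      q * y ^ k * -(x ^ k * x * (Θ * (q * t ^ k * w))) - q * -(x * w) := by
  ring

/-- The comparison of the coefficients of `dx dy` in `totalD_formQuad_ocXytQuot`. -/
lemma frobenius_identity_xy {A : Type*} [CommRing A] (k : ℕ) (x y t Θ q w : A) :
    t * (q ^ 2 * (x ^ k * (y ^ k * t ^ k)) * Θ - q) * w =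
      q * x ^ k * (q * y ^ k * (t ^ k * t * (Θ * w))) - q * (t * w) := by
  ring

lemma mul_neg_mul_mul_comm {A : Type*} [CommRing A] (a b c d : A) :
    a * -(b * (c * d)) = -(b * (c * (a * d))) := by
  ring

lemma phiY_apply_eq (P : MvPolynomial (Fin n) ℂ_[p])
    (ω : Finset (Fin (n + 1)) → Overconvergent p (Fin (n + 1))) (s : Finset (Fin (n + 1))) :
    (suspensionData ϖ P).phiY ω s = -(ocPoly (MvPolynomial.X (xIdx n)) *
      ocRename (ztEmb n) (extMul (R := ℂ_[p]) (Fin.last n) ω s)) := by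
  rw [← ocDiag_ocRename]
  rfl

lemma phiXY_apply_eq (P : MvPolynomial (Fin n) ℂ_[p])
    (ω : Finset (Fin (n + 1)) → Overconvergent p (Fin (n + 1))) (s : Finset (Fin (n + 1))) :
    (suspensionData ϖ P).phiXY ω s =
      ocPoly (MvPolynomial.X (Fin.last (n + 2))) * ocRename (ztEmb n) (ω s) := by
  have h := ocRename_ocX (ztEmb n) (Fin.last n) (ω s)
  rw [ztEmb_last, ocX_apply (Fin.last (n + 2))] at h
  rw [← h, ← ocDiag_ocRename]
  rfl

lemma prod_frobFactor_ztEmb (s : Finset (Fin (n + 1))) :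
    ∏ j ∈ s, (ocPoly (frobFactor (ztEmb n j)) : Overconvergent p (Fin (n + 2 + 1))) =
      ocRename (ztEmb n) (∏ j ∈ s, ocPoly (frobFactor j)) := by
  rw [ocRename_prod]
  refine Finset.prod_congr rfl fun j _ => ?_
  rw [ocRename_ocPoly, rename_frobFactor]

lemma ocPoly_frobFactor {ι : Type} (i : ι) : (ocPoly (frobFactor i) : Overconvergent p ι) =
    (p : Overconvergent p ι) * ocPoly (MvPolynomial.X i) ^ (p - 1) := by
  refine Subtype.ext ?_
  have h : ((p : Overconvergent p ι) : MvPowerSeries ι ℂ_[p]) = p :=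
    map_natCast (Overconvergent p ι).subtype p
  change ((frobFactor i : MvPolynomial ι ℂ_[p]) : MvPowerSeries ι ℂ_[p]) =
    ((p : Overconvergent p ι) : MvPowerSeries ι ℂ_[p]) *
      ((MvPolynomial.X i : MvPolynomial ι ℂ_[p]) : MvPowerSeries ι ℂ_[p]) ^ (p - 1)
  rw [h, frobFactor, MvPolynomial.coe_mul, MvPolynomial.coe_pow]
  congr 1
  exact map_natCast (MvPolynomial.coeToMvPowerSeries.ringHom (R := ℂ_[p]) (σ := ι)) p

lemma ocPoly_xytPoly (n : ℕ) : (ocPoly (xytPoly n) : Overconvergent p (Fin (n + 2 + 1))) =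
    ocPoly (MvPolynomial.X (xIdx n)) *
      (ocPoly (MvPolynomial.X (yIdx n)) * ocPoly (MvPolynomial.X (Fin.last (n + 2)))) := by
  rw [xytPoly, ocPoly_mul, ocPoly_mul]

/-- The Frobenius on the total space of forms of the hypersurface `P = 0`. -/
def frobForm (P : MvPolynomial (Fin n) ℂ_[p]) (h : IsOverconvergent (frobSeries ϖ P))
    (ω : Finset (Fin (n + 1)) → Overconvergent p (Fin (n + 1))) :
    Finset (Fin (n + 1)) → Overconvergent p (Fin (n + 1)) :=
  totalPull (frobFun ϖ P h) (fun i => ocPoly (frobFactor i)) ω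

lemma totalPull_phiY (hϖ : ϖ ^ (p - 1) = -(p : ℂ_[p]))
    (P : MvPolynomial (Fin n) ℂ_[p]) (h : IsOverconvergent (frobSeries ϖ P))
    (h' : IsOverconvergent (frobSeries ϖ (addXY P)))
    (ω : Finset (Fin (n + 1)) → Overconvergent p (Fin (n + 1))) (s : Finset (Fin (n + 1))) :
    totalPull (frobFun ϖ (addXY P) h') (fun j => ocPoly (frobFactor (ztEmb n j)))
        ((suspensionData ϖ P).phiY ω) s = -(ocPoly (MvPolynomial.X (xIdx n)) ^ p *
      (ocXytSeries hϖ n * (ocPoly (frobFactor (Fin.last (n + 2))) *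
        ocRename (ztEmb n) (extMul (R := ℂ_[p]) (Fin.last n) (frobForm P h ω) s)))) := by
  have h2 := totalPull_extMul (frobFun ϖ P h) (fun i => ocPoly (frobFactor i)) (Fin.last n) ω s
  have h3 := congrArg (ocRename (ztEmb n)) h2
  rw [ocRename_mul, ocRename_ocPoly, rename_frobFactor, ztEmb_last, totalPull, ocRename_mul,
    ← prod_frobFactor_ztEmb] at h3
  rw [totalPull, phiY_apply_eq, map_neg, frobFun_X_mul, frobFun_ocRename hϖ P h, frobForm, ← h3]
  generalize ocRename (p := p) (ztEmb n) _ = w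
  generalize ∏ i ∈ s, ocPoly (p := p) (frobFactor (ztEmb n i)) = a
  generalize ocXytSeries hϖ n = Θ
  generalize ocPoly (p := p) (MvPolynomial.X (xIdx n)) ^ p = b
  exact mul_neg_mul_mul_comm a b Θ w

lemma totalPull_phiXY (hϖ : ϖ ^ (p - 1) = -(p : ℂ_[p]))
    (P : MvPolynomial (Fin n) ℂ_[p]) (h : IsOverconvergent (frobSeries ϖ P))
    (h' : IsOverconvergent (frobSeries ϖ (addXY P)))
    (ω : Finset (Fin (n + 1)) → Overconvergent p (Fin (n + 1))) (s : Finset (Fin (n + 1))) :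
    totalPull (frobFun ϖ (addXY P) h') (fun j => ocPoly (frobFactor (ztEmb n j)))
        ((suspensionData ϖ P).phiXY ω) s = ocPoly (MvPolynomial.X (Fin.last (n + 2))) ^ p *
      (ocXytSeries hϖ n * ocRename (ztEmb n) (frobForm P h ω s)) := by
  have h3 : ocRename (ztEmb n) (frobForm P h ω s) = _ := ocRename_mul _ _ _
  rw [← prod_frobFactor_ztEmb] at h3
  rw [totalPull, phiXY_apply_eq, frobFun_X_mul, frobFun_ocRename hϖ P h, h3, mul_left_comm,
    mul_left_comm (ocXytSeries hϖ n)]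

lemma suspD_ocXytQuot_mul (hϖ : ϖ ^ (p - 1) = -(p : ℂ_[p]))
    (P : MvPolynomial (Fin n) ℂ_[p]) (ω : Finset (Fin (n + 1)) → Overconvergent p (Fin (n + 1)))
    (hω : hypD ϖ P ω = 0) :
    suspD ϖ P ((LinearMap.mulLeft ℂ_[p] (ocXytQuot hϖ n) ∘ₗ ocRename (ztEmb n)).compLeft _ ω) =
      (LinearMap.mulLeft ℂ_[p] (ocPoly (MvPolynomial.X (xIdx n)) * ocXytDefect hϖ n) ∘ₗ
        ocRename (ztEmb n)).compLeft _ (extMul (R := ℂ_[p]) (Fin.last n) ω) := by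
  have h1 := totalD_compLeft_add
    (fun i => twistedPderiv (dworkPotential ϖ (addXY P)) (ztEmb n i))
    (twistedPderiv (dworkPotential ϖ P))
    (LinearMap.mulLeft ℂ_[p] (ocXytQuot hϖ n) ∘ₗ ocRename (ztEmb n))
    (LinearMap.mulLeft ℂ_[p] (ocPoly (MvPolynomial.X (xIdx n)) * ocXytDefect hϖ n) ∘ₗ
      ocRename (ztEmb n)) (Fin.last n) (twistedPderiv_ztEmb_ocXytQuot_mul hϖ P) ω
  have h2 : totalD (twistedPderiv (dworkPotential ϖ P)) ω = 0 := hω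
  rw [h2, map_zero, zero_add, extMul_compLeft] at h1
  exact h1

/-- The suspension of the Frobenius pullback `ω'` of a form, multiplied by `p`, differs from the
Frobenius pullback of its suspension by the differential of `f dy ω'`, where `f` is the power series
`(p / (ϖ y)) (e^{ϖ (u ^ p - u)} - 1)`, `u = x y t`. -/
lemma totalD_formQuad_ocXytQuot (hϖ : ϖ ^ (p - 1) = -(p : ℂ_[p]))
    (P : MvPolynomial (Fin n) ℂ_[p]) (h : IsOverconvergent (frobSeries ϖ P))
    (h' : IsOverconvergent (frobSeries ϖ (addXY P)))
    (ω : Finset (Fin (n + 1)) → Overconvergent p (Fin (n + 1)))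
    (hω : hypD ϖ P (frobForm P h ω) = 0) :
    totalD (twistedPderiv (dworkPotential ϖ (addXY P)))
        (formQuad 0 ((LinearMap.mulLeft ℂ_[p] (ocXytQuot hϖ n) ∘ₗ ocRename (ztEmb n)).compLeft _
          (frobForm P h ω)) 0 0) =
      frobForm (addXY P) h' (suspMap ϖ P ω) - (p : ℂ_[p]) • suspMap ϖ P (frobForm P h ω) := by
  have hpow : ∀ g : Overconvergent p (Fin (n + 2 + 1)), g ^ p = g ^ (p - 1) * g := fun g => by
    rw [← pow_succ, Nat.sub_add_cancel (Fact.out : p.Prime).one_le]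
  have hT : frobForm (addXY P) h' (formQuad 0 ((suspensionData ϖ P).phiY ω) 0
      ((suspensionData ϖ P).phiXY ω)) = _ := totalPull_formQuad _ _ _ _
  have hx : (twistedPderiv (dworkPotential ϖ (addXY P)) (xIdx n)).compLeft _
      ((LinearMap.mulLeft ℂ_[p] (ocXytQuot hϖ n) ∘ₗ ocRename (ztEmb n)).compLeft _
        (frobForm P h ω)) = (LinearMap.mulLeft ℂ_[p]
        (ocPoly (MvPolynomial.X (Fin.last (n + 2))) * ocXytDefect hϖ n) ∘ₗ
          ocRename (ztEmb n)).compLeft _ (frobForm P h ω) :=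
    funext fun s => twistedPderiv_xIdx_ocXytQuot_mul hϖ P (frobForm P h ω s)
  have hsmul : ∀ g : Overconvergent p (Fin (n + 2 + 1)),
      (p : ℂ_[p]) • g = (p : Overconvergent p (Fin (n + 2 + 1))) * g := fun g => by
    rw [Nat.cast_smul_eq_nsmul, nsmul_eq_mul]
  rw [totalD_formQuad, suspD_ocXytQuot_mul hϖ P _ hω, hx, suspMap_apply, suspMap_apply,
    ← formQuad_smul, hT, ← formQuad_sub]
  simp only [map_zero, sub_zero, smul_zero, zero_sub]
  congr 1
  · ext1 s
    rw [Pi.sub_apply, totalPull_phiY hϖ P h, Pi.smul_apply, phiY_apply_eq, hsmul, Pi.neg_apply]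
    change -(ocPoly (MvPolynomial.X (xIdx n)) * ocXytDefect hϖ n * ocRename (ztEmb n) _) = _
    generalize ocRename (p := p) (ztEmb n) _ = w
    rw [ocXytDefect, ocPoly_frobFactor, ocPoly_frobFactor, ocPoly_xytPoly, mul_pow, mul_pow, hpow]
    generalize ocXytSeries hϖ n = Θ
    exact frobenius_identity_y _ _ _ _ _ _ _
  · ext1 s
    rw [Pi.sub_apply, totalPull_phiXY hϖ P h, Pi.smul_apply, phiXY_apply_eq, hsmul]
    change ocPoly (MvPolynomial.X (Fin.last (n + 2))) * ocXytDefect hϖ n * ocRename (ztEmb n) _ = _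
    generalize ocRename (p := p) (ztEmb n) _ = w
    rw [ocXytDefect, ocPoly_frobFactor, ocPoly_frobFactor, ocPoly_xytPoly, mul_pow, mul_pow, hpow]
    generalize ocXytSeries hϖ n = Θ
    exact frobenius_identity_xy _ _ _ _ _ _ _

end FrobeniusHomotopy

/-! ### The suspension isomorphism in cohomology -/

section Cohomology

variable {p : ℕ} [Fact p.Prime] {n : ℕ} {ϖ : ℂ_[p]}

/-- A cochain of degree `k`, as a form. -/
def dworkExt (ϖ : ℂ_[p]) (P : MvPolynomial (Fin n) ℂ_[p]) (k : ℕ) :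
    (dworkComplex ϖ P).X k →ₗ[ℂ_[p]] (Finset (Fin (n + 1)) → Overconvergent p (Fin (n + 1))) where
  toFun (ω : DRForm (Fin (n + 1)) (Overconvergent p (Fin (n + 1))) k) := drExt ω
  map_add' (ω η : DRForm (Fin (n + 1)) (Overconvergent p (Fin (n + 1))) k) := by
    ext1 s
    change drExt (ω + η) s = drExt ω s + drExt η s
    simp only [drExt, Pi.add_apply]
    split_ifs <;> simp
  map_smul' a (ω : DRForm (Fin (n + 1)) (Overconvergent p (Fin (n + 1))) k) := by
    ext1 s
    change drExt (a • ω) s = a • drExt ω s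
    simp only [drExt, Pi.smul_apply]
    split_ifs <;> simp

/-- The part of degree `k` of a form, as a cochain. -/
def dworkRes (ϖ : ℂ_[p]) (P : MvPolynomial (Fin n) ℂ_[p]) (k : ℕ) :
    (Finset (Fin (n + 1)) → Overconvergent p (Fin (n + 1))) →ₗ[ℂ_[p]] (dworkComplex ϖ P).X k where
  toFun ω := (drRes k ω : DRForm (Fin (n + 1)) (Overconvergent p (Fin (n + 1))) k)
  map_add' _ _ := rfl
  map_smul' _ _ := rfl

lemma dworkRes_dworkExt (P : MvPolynomial (Fin n) ℂ_[p]) (k : ℕ) (ω : (dworkComplex ϖ P).X k) :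
    dworkRes ϖ P k (dworkExt ϖ P k ω) = ω :=
  drRes_drExt _

lemma dworkExt_dworkRes (P : MvPolynomial (Fin n) ℂ_[p]) (k : ℕ)
    (ω : Finset (Fin (n + 1)) → Overconvergent p (Fin (n + 1))) :
    dworkExt ϖ P k (dworkRes ϖ P k ω) = degreePart k ω :=
  drExt_drRes _ _

lemma degreePart_dworkExt (P : MvPolynomial (Fin n) ℂ_[p]) (k : ℕ) (ω : (dworkComplex ϖ P).X k) :
    degreePart k (dworkExt ϖ P k ω) = dworkExt ϖ P k ω :=
  degreePart_drExt _

lemma dworkComplex_d_apply (P : MvPolynomial (Fin n) ℂ_[p]) (k : ℕ)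
    (ω : DRForm (Fin (n + 1)) (Overconvergent p (Fin (n + 1))) k) :
    ((dworkComplex ϖ P).d k (k + 1)).hom ω = drD (twistedPderiv (dworkPotential ϖ P)) k ω := by
  have h := deRhamComplex_d (twistedPderiv (dworkPotential ϖ P)) (twistedPderiv_comm _) k
  exact LinearMap.congr_fun (congrArg ModuleCat.Hom.hom h) ω

lemma totalD_dworkExt (P : MvPolynomial (Fin n) ℂ_[p]) (k : ℕ) (ω : (dworkComplex ϖ P).X k) :
    totalD (twistedPderiv (dworkPotential ϖ P)) (dworkExt ϖ P k ω) =
      dworkExt ϖ P (k + 1) (((dworkComplex ϖ P).d k (k + 1)).hom ω) :=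
  (totalD_drExt _ _).trans (congrArg drExt (dworkComplex_d_apply P k ω).symm)

lemma dworkComplex_d_dworkRes (P : MvPolynomial (Fin n) ℂ_[p]) (k : ℕ)
    (ω : Finset (Fin (n + 1)) → Overconvergent p (Fin (n + 1))) :
    ((dworkComplex ϖ P).d k (k + 1)).hom (dworkRes ϖ P k ω) =
      dworkRes ϖ P (k + 1) (totalD (twistedPderiv (dworkPotential ϖ P)) ω) :=
  (dworkComplex_d_apply P k _).trans (drD_drRes _ _ _)

lemma totalD_dworkExt_cocycle (P : MvPolynomial (Fin n) ℂ_[p]) (k : ℕ)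
    (x : LinearMap.ker ((dworkComplex ϖ P).d k (k + 1)).hom) :
    totalD (twistedPderiv (dworkPotential ϖ P)) (dworkExt ϖ P k x.1) = 0 := by
  have h : ((dworkComplex ϖ P).d k (k + 1)).hom x.1 = 0 := x.2
  rw [totalD_dworkExt, h, map_zero]

variable (P : MvPolynomial (Fin n) ℂ_[p])

/-- The suspension of cocycles. -/
def suspCocycle (k : ℕ) : LinearMap.ker ((dworkComplex ϖ P).d k (k + 1)).hom →ₗ[ℂ_[p]]
    LinearMap.ker ((dworkComplex ϖ (addXY P)).d (k + 2) (k + 2 + 1)).hom :=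
  (dworkRes ϖ (addXY P) (k + 2) ∘ₗ suspMap ϖ P ∘ₗ dworkExt ϖ P k).restrict fun x hx => by
    have h : hypD ϖ P (dworkExt ϖ P k x) = 0 := totalD_dworkExt_cocycle P k ⟨x, hx⟩
    rw [LinearMap.mem_ker, LinearMap.comp_apply, LinearMap.comp_apply, dworkComplex_d_dworkRes,
      totalD_suspMap, h, map_zero, map_zero]

lemma coe_suspCocycle (k : ℕ) (x : LinearMap.ker ((dworkComplex ϖ P).d k (k + 1)).hom) :
    (suspCocycle P k x).1 =
      dworkRes ϖ (addXY P) (k + 2) (suspMap ϖ P (dworkExt ϖ P k x.1)) := rfl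

/-- The suspension isomorphism. -/
lemma exists_suspensionEquiv (hϖ : ϖ ^ (p - 1) = -(p : ℂ_[p])) (hint : ∀ m, ‖P.coeff m‖ ≤ 1)
    (k : ℕ) (hk : 2 ≤ k) :
    ∃ Φ : (dworkComplex ϖ P).homology (k + 1) ≃ₗ[ℂ_[p]]
        (dworkComplex ϖ (addXY P)).homology (k + 1 + 2),
      ∀ x, Φ (cocycleClass (dworkComplex ϖ P) (k + 1) x) =
        cocycleClass (dworkComplex ϖ (addXY P)) (k + 1 + 2) (suspCocycle P (k + 1) x) := by
  refine exists_homologyEquiv (K := dworkComplex ϖ P) (L := dworkComplex ϖ (addXY P)) (k := k)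
    (l := k + 2) (suspCocycle P (k + 1)) (fun y => ?_) fun x => ⟨?_, ?_⟩
  · obtain ⟨ω, θ, hω, hdeg, -, hθ⟩ := exists_suspMap_of_closed ϖ P hϖ hint
      (k := k + 1) (by omega) (degreePart_dworkExt _ _ _)
      (totalD_dworkExt_cocycle (addXY P) (k + 2 + 1) y)
    have hω' : totalD (twistedPderiv (dworkPotential ϖ P)) ω = 0 := hω
    refine ⟨⟨dworkRes ϖ P (k + 1) ω, ?_⟩, dworkRes ϖ (addXY P) (k + 2) θ, ?_⟩
    · rw [LinearMap.mem_ker, dworkComplex_d_dworkRes, hω', map_zero]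
    · rw [dworkComplex_d_dworkRes, hθ, map_sub, dworkRes_dworkExt, coe_suspCocycle,
        dworkExt_dworkRes, hdeg]
  · rintro ⟨w, hw⟩
    obtain ⟨η, -, hη⟩ := exists_of_suspMap_exact ϖ P hϖ hint hk
      (degreePart_dworkExt P (k + 1) x.1) (totalD_dworkExt_cocycle P (k + 1) x)
      (θ := dworkExt ϖ (addXY P) (k + 2) w) (degreePart_dworkExt _ _ _) (by
        rw [totalD_dworkExt, hw, coe_suspCocycle]
        refine (dworkExt_dworkRes _ _ _).trans ?_
        rw [degreePart_suspMap, degreePart_dworkExt])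
    have hη' : totalD (twistedPderiv (dworkPotential ϖ P)) η = _ := hη
    refine ⟨dworkRes ϖ P k η, ?_⟩
    rw [dworkComplex_d_dworkRes, hη', dworkRes_dworkExt]
  · rintro ⟨w, hw⟩
    refine ⟨dworkRes ϖ (addXY P) (k + 2) (suspMap ϖ P (dworkExt ϖ P k w)), ?_⟩
    rw [dworkComplex_d_dworkRes, totalD_suspMap, hypD, totalD_dworkExt, hw, coe_suspCocycle]

/-- The Frobenius pullback of cocycles. -/
def frobCocycle (h : IsOverconvergent (frobSeries ϖ P)) (k : ℕ)
    (x : LinearMap.ker ((dworkComplex ϖ P).d k (k + 1)).hom) :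
    LinearMap.ker ((dworkComplex ϖ P).d k (k + 1)).hom :=
  ⟨((dworkFrobenius ϖ P h).f k).hom x.1, by
    have hc := LinearMap.congr_fun
      (congrArg ModuleCat.Hom.hom ((dworkFrobenius ϖ P h).comm k (k + 1))) x.1
    have hx : ((dworkComplex ϖ P).d k (k + 1)).hom x.1 = 0 := x.2
    rw [ModuleCat.hom_comp, ModuleCat.hom_comp, LinearMap.comp_apply, LinearMap.comp_apply, hx,
      map_zero] at hc
    exact hc⟩

lemma dworkExt_dworkFrobenius (h : IsOverconvergent (frobSeries ϖ P)) (k : ℕ)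
    (ω : (dworkComplex ϖ P).X k) :
    dworkExt ϖ P k (((dworkFrobenius ϖ P h).f k).hom ω) = frobForm P h (dworkExt ϖ P k ω) :=
  drExt_drPull _ _ _

lemma dworkFrobenius_dworkRes (h : IsOverconvergent (frobSeries ϖ P)) (k : ℕ)
    (ω : Finset (Fin (n + 1)) → Overconvergent p (Fin (n + 1))) :
    ((dworkFrobenius ϖ P h).f k).hom (dworkRes ϖ P k ω) = dworkRes ϖ P k (frobForm P h ω) := rfl

lemma homologyMap_dworkFrobenius (h : IsOverconvergent (frobSeries ϖ P)) (k : ℕ)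
    (x : LinearMap.ker ((dworkComplex ϖ P).d k (k + 1)).hom) :
    (HomologicalComplex.homologyMap (dworkFrobenius ϖ P h) k).hom
        (cocycleClass (dworkComplex ϖ P) k x) =
      cocycleClass (dworkComplex ϖ P) k (frobCocycle P h k x) :=
  homologyMap_cocycleClass _ k x _ rfl

/-- The Frobenius of the suspension of a cocycle is cohomologous to `p` times the suspension of its
Frobenius. -/
lemma cocycleClass_frobCocycle_suspCocycle (hϖ : ϖ ^ (p - 1) = -(p : ℂ_[p]))
    (h : IsOverconvergent (frobSeries ϖ P)) (h' : IsOverconvergent (frobSeries ϖ (addXY P)))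
    (k : ℕ) (x : LinearMap.ker ((dworkComplex ϖ P).d k (k + 1)).hom) :
    cocycleClass (dworkComplex ϖ (addXY P)) (k + 2)
        (frobCocycle (addXY P) h' (k + 2) (suspCocycle P k x)) =
      (p : ℂ_[p]) • cocycleClass (dworkComplex ϖ (addXY P)) (k + 2)
        (suspCocycle P k (frobCocycle P h k x)) := by
  rw [← sub_eq_zero, ← map_smul, ← map_sub]
  refine (cocycleClass_eq_zero_iff _ (k + 1) _).mpr ?_
  have h1 : dworkExt ϖ P k (frobCocycle P h k x).1 = frobForm P h (dworkExt ϖ P k x.1) :=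
    dworkExt_dworkFrobenius P h k x.1
  have h2 : hypD ϖ P (frobForm P h (dworkExt ϖ P k x.1)) = 0 := by
    rw [← h1]
    exact totalD_dworkExt_cocycle P k (frobCocycle P h k x)
  refine ⟨dworkRes ϖ (addXY P) (k + 1) _, (dworkComplex_d_dworkRes _ _ _).trans
    ((congrArg _ (totalD_formQuad_ocXytQuot hϖ P h h' _ h2)).trans ?_)⟩
  rw [map_sub, map_smul, ← dworkFrobenius_dworkRes, ← h1]
  rfl

end Cohomology

end

theorem mainTheorem1 (p : ℕ) [Fact p.Prime] (hp : Odd p)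
    (ϖ : ℂ_[p]) (hϖ : ϖ ^ (p - 1) = -(p : ℂ_[p]))
    (n : ℕ) (P : MvPolynomial (Fin n) ℂ_[p]) (hP : IsSmoothHypersurface P)
    (hint : ∀ m, ‖P.coeff m‖ ≤ 1) :
    ((∀ m, ‖P.coeff m ^ p - P.coeff m‖ < 1) → IsOverconvergent (frobSeries ϖ P)) ∧
    ∃ Φ : ∀ i : ℕ, 1 ≤ i →
        (HypersurfaceCohomology ϖ P i ≃ₗ[ℂ_[p]] HypersurfaceCohomology ϖ (addXY P) (i + 2)),
      ∀ hX : IsOverconvergent (frobSeries ϖ P),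
        ∃ hX' : IsOverconvergent (frobSeries ϖ (addXY P)),
          ∀ (i : ℕ) (hi : 1 ≤ i) (c : HypersurfaceCohomology ϖ P i),
            Φ i hi ((p : ℂ_[p]) • hypersurfaceFrobenius ϖ P hX i c) =
              hypersurfaceFrobenius ϖ (addXY P) hX' (i + 2) (Φ i hi c) := by
  have hp0 : (p : ℂ_[p]) ≠ 0 := Nat.cast_ne_zero.mpr (Fact.out : p.Prime).ne_zero
  have hequiv := fun (i : ℕ) (hi : 1 ≤ i) =>
    exists_suspensionEquiv P hϖ hint (i + 1) (by omega)
  choose Φ hΦ using hequiv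
  refine ⟨isOverconvergent_frobSeries hϖ P hint, Φ, fun hX =>
    ⟨isOverconvergent_frobSeries_addXY hϖ hX, fun i hi c => ?_⟩⟩
  obtain ⟨x, rfl⟩ := cocycleClass_surjective (dworkComplex ϖ P) (i + 2) c
  rw [hypersurfaceFrobenius, hypersurfaceFrobenius, LinearMap.smul_apply, LinearMap.smul_apply,
    smul_smul, mul_inv_cancel₀ hp0, one_smul, homologyMap_dworkFrobenius]
  refine (hΦ i hi _).trans (Eq.trans ?_ (congrArg _ (congrArg _ (hΦ i hi x).symm)))
  have h := cocycleClass_frobCocycle_suspCocycle P hϖ hX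
    (isOverconvergent_frobSeries_addXY hϖ hX) (i + 2) x
  have h' := homologyMap_dworkFrobenius (addXY P) (isOverconvergent_frobSeries_addXY hϖ hX)
    (i + 2 + 2) (suspCocycle P (i + 2) x)
  -- `p` times the suspension of the pullback is the pullback of the suspension, in which the Frobenius
  -- includes the factor `p⁻¹`
  rw [eq_inv_smul_iff₀ hp0]
  exact h.symm.trans h'.symm
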